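/- Let $F$ be a number field with adele ring $\mathbb A$, and let $H$ be an $F$-quasisplit classical group ($\mathrm{GL}_n$, possibly over a quadratic extension of $F$ by restriction of scalars, $\mathrm{Sp}_{2n}$, split $\mathrm{SO}_{2n+1}$, quasisplit $\mathrm{SO}_{2n}$, or a quasisplit unitary group $\mathrm U_{E/F}(n)$). For an $F$-group $G$ write $[G]=G(F)\backslash G(\mathbb A)$. A character is a continuous unitary character, and $[x,y]=xyx^{-1}y^{-1}$. Call $(C,\psi_C,X,Y)$ an *exchange quadruple* if $C,X,Y$ are unipotent $F$-subgroups of $H$, $\psi_C$ is a nontrivial character of $C(\mathbb A)$ trivial on $C(F)$, and 1. $X$ and $Y$ normalize $C$; 2. $X\cap C$ is normal in $X$, $Y\cap C$ is normal in $Y$, and $(X\cap C)\backslash X$, $(Y\cap C)\backslash Y$ are abelian; 3. $X(\mathbb A)$ and $Y(\mathbb A)$, acting on $C(\mathbb A)$ by conjugation, preserve $\psi_C$; 4. $\psi_C$ is trivial on $(X\cap C)(\mathbb A)$ and on $(Y\cap C)(\mathbb A)$; 5. $[X,Y]\subset C$; 6. $(x,y)\mapsto\psi_C([x,y])$ is a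 non-degenerate pairing $(X\cap C)(\mathbb A)\backslash X(\mathbb A)\times (Y\cap C)(\mathbb A)\backslash Y(\mathbb A)\to\mathbb C^*$, multiplicative in each coordinate, which identifies $(Y\cap C)(F)\backslash Y(F)$ with the Pontryagin dual of $X(F)(X\cap C)(\mathbb A)\backslash X(\mathbb A)$ and $(X\cap C)(F)\backslash X(F)$ with the Pontryagin dual of $Y(F)(Y\cap C)(\mathbb A)\backslash Y(\mathbb A)$. Let $r\ge 0$, let $C$ be a unipotent $F$-subgroup of $H$, $\psi_C$ a nontrivial character of $C(\mathbb A)$ trivial on $C(F)$, and let $X_1,\dots,X_r,Y_1,\dots,Y_r$ be $F$-subgroups of $H$. Assume that for every $1\le i\le r$ the character $\psi_C$ extends to a character of $(X_{i-1}\cdots X_1CY_r\cdots Y_{i+1})(\mathbb A)$ that is trivial on $X_j(\mathbb A)$ for $1\le j<i$ and on $Y_j(\mathbb A)$ for $i<j\le r$, and that, with this extension again denoted $\psi_C$, the quadruple $$(X_{i-1}\cdots X_1\,C\,Y_r\cdots Y_{i+1},\ \psi_C,\ X_i,\ Y_i)$$ is an exchange quadruple. (The products denote the $F$-subgroups generated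 by their factors, which are the product sets when these are groups.) Then $\psi_C$ extends uniquely to a character of $(X_r\cdots X_1C)(\mathbb A)$ trivial on all $X_j(\mathbb A)$, and uniquely to a character of $(CY_r\cdots Y_1)(\mathbb A)$ trivial on all $Y_j(\mathbb A)$ (both again denoted $\psi_C$), and for every automorphic form $f$ on $H(\mathbb A)$, $$\int_{[X_r\cdots X_1C]} f(ug)\,\psi_C^{-1}(u)\,du=0\quad\text{for all } g\in H(\mathbb A)$$ if and only if $$\int_{[CY_r\cdots Y_1]} f(ug)\,\psi_C^{-1}(u)\,du=0\quad\text{for all } g\in H(\mathbb A),$$ where $du$ denotes the invariant measures of total mass $1$. -/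

import Mathlib

universe u

open NumberField Matrix MeasureTheory Topology

noncomputable section

namespace RootExchange

/-- The adele ring of a number field. -/
abbrev Adele (F : Type u) [Field F] [NumberField F] : Type u := AdeleRing (𝓞 F) F

/-! ### Matrix groups over `F` -/

/-- A group functor `R ↦ G(R) ≤ GL_ι(R)` on commutative `F`-algebras. -/
abbrev MatGroup (F : Type u) [Field F] (ι : Type) [Fintype ι] [DecidableEq ι] : Type (u + 1) :=
  (R : Type u) → [CommRing R] → [Algebra F R] → Subgroup (GL ι R)

section MatGroup

variable {F : Type u} [Field F] {ι : Type} [Fintype ι] [DecidableEq ι]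

/-- `G` is a closed `F`-subgroup (scheme) of `GL_ι`: it is cut out by polynomial equations in the
matrix entries with coefficients in `F`. -/
def IsClosedSubgroup (G : MatGroup F ι) : Prop :=
  ∃ S : Set (MvPolynomial (ι × ι) F), ∀ (R : Type u) [CommRing R] [Algebra F R] (g : GL ι R),
    g ∈ G R ↔ ∀ p ∈ S, MvPolynomial.aeval (fun ij : ι × ι => (g : Matrix ι ι R) ij.1 ij.2) p = 0

/-- `U` is a unipotent `F`-subgroup of `H`. -/
structure IsUnipotentSubgroup (H U : MatGroup F ι) : Prop where
  closed : IsClosedSubgroup U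
  le : ∀ (R : Type u) [CommRing R] [Algebra F R], U R ≤ H R
  unipotent : ∀ (R : Type u) [CommRing R] [Algebra F R], ∀ g ∈ U R,
    IsNilpotent ((g : Matrix ι ι R) - 1)

end MatGroup

/-! ### Quasisplit classical groups -/

/-- Data of a classical group over `F`: the group of all `g` with `gᵀ Q g = Q` that commute with
the matrix `δ` (and with `det g = 1` if `special`). -/
structure ClassicalData (F : Type u) (ι : Type) where
  Q : Matrix ι ι F
  δ : Matrix ι ι F
  special : Prop

/-- The antidiagonal matrix with entries `1`. -/
def antidiag (F : Type u) [Field F] (n : ℕ) : Matrix (Fin n) (Fin n) F :=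
  Matrix.of fun i j => if j = i.rev then 1 else 0

/-- The matrix of `n` hyperbolic planes. -/
def hyperbolic (F : Type u) [Field F] (n : ℕ) : Matrix (Fin n ⊕ Fin n) (Fin n ⊕ Fin n) F :=
  Matrix.fromBlocks 0 1 1 0

/-- For `E = F(√d)`, multiplication by `√d` on `Eⁿ = Fⁿ ⊕ √d Fⁿ`. -/
def sqrtMat {F : Type u} [Field F] (n : ℕ) (d : F) : Matrix (Fin n ⊕ Fin n) (Fin n ⊕ Fin n) F :=
  Matrix.fromBlocks 0 (d • 1) 1 0

/-- The quasisplit classical groups over `F`: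
* `GL_n`, and `GL_n` over a quadratic extension `E = F(√d)` regarded as a group over `F`;
* `Sp_{2n}`;
* the split `SO_{2n+1}`;
* the quasisplit `SO_{2n+2}` of the sum of `n` hyperbolic planes and the form `x² - d y²`
  (which is split exactly when `d` is a square);
* the quasisplit unitary group `U_{E/F}(n)`, `E = F(√d)`, of the hermitian form `h` on `Eⁿ` with
  antidiagonal matrix. In the coordinates `Eⁿ = Fⁿ ⊕ √d Fⁿ` the matrix `Q` is that of the
  `F`-bilinear form `Re h`, where `h = Re h + √d Im h`; an `E`-linear map preserves `h` if and only
  if it preserves `Re h`. -/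
inductive IsQuasisplitClassical {F : Type u} [Field F] : {ι : Type} → ClassicalData F ι → Prop
  | gl (n : ℕ) : IsQuasisplitClassical (ι := Fin n) ⟨0, 0, False⟩
  | resGL (n : ℕ) (d : F) (hd : ¬ IsSquare d) :
      IsQuasisplitClassical (ι := Fin n ⊕ Fin n) ⟨0, sqrtMat n d, False⟩
  | sp (n : ℕ) : IsQuasisplitClassical (ι := Fin n ⊕ Fin n) ⟨Matrix.J (Fin n) F, 0, False⟩
  | soOdd (n : ℕ) : IsQuasisplitClassical (ι := (Fin n ⊕ Fin n) ⊕ Fin 1)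
      ⟨Matrix.fromBlocks (hyperbolic F n) 0 0 1, 0, True⟩
  | soEven (n : ℕ) (d : F) (hd : d ≠ 0) : IsQuasisplitClassical (ι := (Fin n ⊕ Fin n) ⊕ Fin 2)
      ⟨Matrix.fromBlocks (hyperbolic F n) 0 0 (Matrix.diagonal ![1, -d]), 0, True⟩
  | unitary (n : ℕ) (d : F) (hd : ¬ IsSquare d) : IsQuasisplitClassical (ι := Fin n ⊕ Fin n)
      ⟨Matrix.fromBlocks (antidiag F n) 0 0 (-d • antidiag F n), sqrtMat n d, False⟩

section Classical

variable {F : Type u} [Field F] {ι : Type} [Fintype ι] [DecidableEq ι]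

/-- The functor of points of a classical group. -/
def ClassicalData.points (D : ClassicalData F ι) : MatGroup F ι := fun R _ _ =>
  { carrier := {g | (g : Matrix ι ι R)ᵀ * D.Q.map (algebraMap F R) * (g : Matrix ι ι R)
        = D.Q.map (algebraMap F R) ∧
      Commute (g : Matrix ι ι R) (D.δ.map (algebraMap F R)) ∧
      (D.special → (g : Matrix ι ι R).det = 1)}
    one_mem' := by simp
    mul_mem' := by
      rintro a b ⟨ha, ha', ha''⟩ ⟨hb, hb', hb''⟩
      refine ⟨?_, ?_, fun h => ?_⟩
      · rw [Units.val_mul, Matrix.transpose_mul]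
        calc _ = (b : Matrix ι ι R)ᵀ * ((a : Matrix ι ι R)ᵀ * D.Q.map (algebraMap F R)
              * (a : Matrix ι ι R)) * (b : Matrix ι ι R) := by simp only [mul_assoc]
          _ = _ := by rw [ha, hb]
      · rw [Units.val_mul]; exact ha'.mul_left hb'
      · rw [Units.val_mul, Matrix.det_mul, ha'' h, hb'' h, one_mul]
    inv_mem' := by
      rintro a ⟨ha, ha', ha''⟩
      have h1 : (a : Matrix ι ι R) * ((a⁻¹ : GL ι R) : Matrix ι ι R) = 1 := a.mul_inv
      refine ⟨?_, ?_, fun h => ?_⟩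
      · have h2 : ((a⁻¹ : GL ι R) : Matrix ι ι R)ᵀ * (a : Matrix ι ι R)ᵀ = 1 := by
          rw [← Matrix.transpose_mul, h1, Matrix.transpose_one]
        calc _ = ((a⁻¹ : GL ι R) : Matrix ι ι R)ᵀ * ((a : Matrix ι ι R)ᵀ
              * D.Q.map (algebraMap F R) * (a : Matrix ι ι R))
              * ((a⁻¹ : GL ι R) : Matrix ι ι R) := by rw [ha]
          _ = (((a⁻¹ : GL ι R) : Matrix ι ι R)ᵀ * (a : Matrix ι ι R)ᵀ)
              * D.Q.map (algebraMap F R)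
              * ((a : Matrix ι ι R) * ((a⁻¹ : GL ι R) : Matrix ι ι R)) := by
                simp only [mul_assoc]
          _ = _ := by rw [h1, h2, one_mul, mul_one]
      · exact Commute.units_inv_left ha'
      · have h3 := congrArg Matrix.det h1
        rwa [Matrix.det_mul, ha'' h, one_mul, Matrix.det_one] at h3 }

end Classical

/-! ### Adelic, rational and archimedean points -/

section Points

variable {F : Type u} [Field F] [NumberField F] {ι : Type} [Fintype ι] [DecidableEq ι]

/-- The group `G(𝔸)`, as a subgroup of `H(𝔸)`. -/
def adelic (H G : MatGroup F ι) : Subgroup (H (Adele F)) :=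
  (G (Adele F)).subgroupOf (H (Adele F))

/-- The group `G(F)`, embedded diagonally in `H(𝔸)`. -/
def rational (H G : MatGroup F ι) : Subgroup (H (Adele F)) :=
  ((G F).map (GeneralLinearGroup.map (algebraMap F (Adele F)))).subgroupOf (H (Adele F))

/-- The projection of the adeles to the archimedean adeles. -/
def toInf (F : Type u) [Field F] [NumberField F] : Adele F →+* InfiniteAdeleRing F :=
  RingHom.fst (InfiniteAdeleRing F) (IsDedekindDomain.FiniteAdeleRing (𝓞 F) F)

/-- The projection of the adeles to the finite adeles. -/
def toFin (F : Type u) [Field F] [NumberField F] :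
    Adele F →+* IsDedekindDomain.FiniteAdeleRing (𝓞 F) F :=
  RingHom.snd (InfiniteAdeleRing F) (IsDedekindDomain.FiniteAdeleRing (𝓞 F) F)

theorem adeleMatrix_ext {κ : Type} {M N : Matrix κ κ (Adele F)}
    (h1 : M.map (toInf F) = N.map (toInf F)) (h2 : M.map (toFin F) = N.map (toFin F)) : M = N := by
  ext i j
  exact Prod.ext (congrFun (congrFun h1 i) j) (congrFun (congrFun h2 i) j)

/-- The adelic matrix with archimedean component `M` and finite component `1`. -/
def infMatrix {κ : Type} [DecidableEq κ] (M : Matrix κ κ (InfiniteAdeleRing F)) :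
    Matrix κ κ (Adele F) :=
  Matrix.of fun i j =>
    ((M i j, (1 : Matrix κ κ (IsDedekindDomain.FiniteAdeleRing (𝓞 F) F)) i j) :
      InfiniteAdeleRing F × IsDedekindDomain.FiniteAdeleRing (𝓞 F) F)

theorem infMatrix_inf {κ : Type} [DecidableEq κ] (M : Matrix κ κ (InfiniteAdeleRing F)) :
    (infMatrix M).map (toInf F) = M := rfl

theorem infMatrix_fin {κ : Type} [DecidableEq κ] (M : Matrix κ κ (InfiniteAdeleRing F)) :
    (infMatrix M).map (toFin F) = 1 := rfl

theorem infMatrix_mul (M N : Matrix ι ι (InfiniteAdeleRing F)) :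
    infMatrix (M * N) = infMatrix M * infMatrix N := by
  apply adeleMatrix_ext
  · rw [Matrix.map_mul, infMatrix_inf, infMatrix_inf, infMatrix_inf]
  · rw [Matrix.map_mul, infMatrix_fin, infMatrix_fin, infMatrix_fin, one_mul]

theorem infMatrix_one {κ : Type} [DecidableEq κ] :
    infMatrix (1 : Matrix κ κ (InfiniteAdeleRing F)) = 1 := by
  apply adeleMatrix_ext
  · rw [infMatrix_inf, Matrix.map_one _ (map_zero _) (map_one _)]
  · rw [infMatrix_fin, Matrix.map_one _ (map_zero _) (map_one _)]

/-- The inclusion `g ↦ (g, 1)` of `GL(F_∞)` in `GL(𝔸)`. -/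
def infGL : GL ι (InfiniteAdeleRing F) →* GL ι (Adele F) :=
  Units.map { toFun := infMatrix, map_one' := infMatrix_one, map_mul' := infMatrix_mul }

theorem infGL_mem (D : ClassicalData F ι) (g : GL ι (InfiniteAdeleRing F))
    (hg : g ∈ D.points (InfiniteAdeleRing F)) : infGL g ∈ D.points (Adele F) := by
  obtain ⟨h1, h2, h3⟩ := hg
  have hv : ((infGL g : GL ι (Adele F)) : Matrix ι ι (Adele F)) = infMatrix g := rfl
  have hi : ∀ A : Matrix ι ι F, (A.map (algebraMap F (Adele F))).map (toInf F) =
    A.map (algebraMap F (InfiniteAdeleRing F)) := fun A => rfl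
  refine ⟨?_, ?_, fun h => ?_⟩
  · rw [hv]
    apply adeleMatrix_ext
    · rw [Matrix.map_mul, Matrix.map_mul, Matrix.transpose_map, infMatrix_inf, hi, h1]
    · rw [Matrix.map_mul, Matrix.map_mul, Matrix.transpose_map, infMatrix_fin,
        Matrix.transpose_one, one_mul, mul_one]
  · rw [hv]
    apply adeleMatrix_ext
    · rw [Matrix.map_mul, Matrix.map_mul, infMatrix_inf, hi]
      exact h2
    · rw [Matrix.map_mul, Matrix.map_mul, infMatrix_fin, one_mul, mul_one]
  · rw [hv]
    apply Prod.ext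
    · change toInf F _ = 1
      rw [RingHom.map_det, RingHom.mapMatrix_apply, infMatrix_inf, h3 h]
    · change toFin F _ = 1
      rw [RingHom.map_det, RingHom.mapMatrix_apply, infMatrix_fin, Matrix.det_one]

/-- The real algebra `F_∞ = ℝ^{r₁} × ℂ^{r₂}`. -/
abbrev RealAlg (F : Type u) [Field F] : Type u := mixedEmbedding.mixedSpace F

/-- The real Lie group `H(F_∞)`, as a group of matrices over `ℝ^{r₁} × ℂ^{r₂}`. -/
def archPoints (H : MatGroup F ι) : Subgroup (GL ι (RealAlg F)) :=
  (H (InfiniteAdeleRing F)).comap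
    (GeneralLinearGroup.map (InfiniteAdeleRing.ringEquiv_mixedSpace F).symm.toRingHom)

/-- The inclusion of `H(F_∞)` in `H(𝔸)`. -/
def archEmb (D : ClassicalData F ι) : archPoints D.points →* D.points (Adele F) where
  toFun h := ⟨infGL (GeneralLinearGroup.map
    (InfiniteAdeleRing.ringEquiv_mixedSpace F).symm.toRingHom h), infGL_mem D _ h.2⟩
  map_one' := by ext1; simp
  map_mul' a b := by ext1; simp

end Points

/-! ### Automorphic forms -/

section Automorphic

attribute [local instance] LieRing.ofAssociativeRing LieAlgebra.ofAssociativeAlgebra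

variable {F : Type u} [Field F] [NumberField F] {ι : Type} [Fintype ι] [DecidableEq ι]

/-- The Lie algebra of `H(F_∞)`. (The condition `det g = 1` adds nothing: it occurs only for
special orthogonal groups, whose Lie algebra is that of the full orthogonal group.) -/
def lieAlg (D : ClassicalData F ι) : LieSubalgebra ℝ (Matrix ι ι (RealAlg F)) where
  carrier := {X | Xᵀ * D.Q.map (mixedEmbedding F) + D.Q.map (mixedEmbedding F) * X = 0 ∧
    X * D.δ.map (mixedEmbedding F) = D.δ.map (mixedEmbedding F) * X}
  zero_mem' := by simp
  add_mem' := by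
    rintro a b ⟨ha, ha'⟩ ⟨hb, hb'⟩
    refine ⟨?_, ?_⟩
    · rw [Matrix.transpose_add, add_mul, mul_add, add_add_add_comm, ha, hb, add_zero]
    · rw [add_mul, mul_add, ha', hb']
  smul_mem' := by
    rintro c a ⟨ha, ha'⟩
    refine ⟨?_, ?_⟩
    · rw [Matrix.transpose_smul, smul_mul_assoc, mul_smul_comm, ← smul_add, ha, smul_zero]
    · rw [smul_mul_assoc, mul_smul_comm, ha']
  lie_mem' := by
    rintro a b ⟨ha, ha'⟩ ⟨hb, hb'⟩
    have h1 := eq_neg_of_add_eq_zero_left ha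
    have h2 := eq_neg_of_add_eq_zero_left hb
    refine ⟨?_, ?_⟩
    · rw [Ring.lie_def, Matrix.transpose_sub, Matrix.transpose_mul, Matrix.transpose_mul, sub_mul,
        mul_sub, mul_assoc, mul_assoc, h1, h2, mul_neg, mul_neg, ← mul_assoc, ← mul_assoc, h1, h2,
        neg_mul, neg_mul, ← mul_assoc, ← mul_assoc]
      abel
    · rw [Ring.lie_def, sub_mul, mul_sub, mul_assoc, mul_assoc, hb', ha', ← mul_assoc, ← mul_assoc,
        ha', hb', mul_assoc, mul_assoc]

open scoped Classical in
/-- The one-parameter subgroup `exp (t X)` of `H(F_∞)`. -/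
def expPoint (D : ClassicalData F ι) (X : lieAlg D) (t : ℝ) : archPoints D.points :=
  if h : ∃ u : archPoints D.points,
    ((u : GL ι (RealAlg F)) : Matrix ι ι (RealAlg F)) =
      NormedSpace.exp (t • (X : Matrix ι ι (RealAlg F)))
  then h.choose else 1

/-- The right derivative `(X f)(g) = d/dt f(g exp(tX))` at `t = 0`. -/
def lieDeriv (D : ClassicalData F ι) (X : lieAlg D) (f : D.points (Adele F) → ℂ) :
    D.points (Adele F) → ℂ :=
  fun g => deriv (fun t : ℝ => f (g * archEmb D (expPoint D X t))) 0

/-- The action of a product `X₁ ⋯ X_k` of elements of the Lie algebra, `X₁ (⋯ (X_k f))`. -/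
def wordDeriv (D : ClassicalData F ι) (w : List (lieAlg D)) (f : D.points (Adele F) → ℂ) :
    D.points (Adele F) → ℂ :=
  w.foldr (lieDeriv D) f

/-- `f` is finite under the centre of the universal enveloping algebra: the functions `z f`, for
`z` in the centre, span a finite-dimensional space. An element `z` of the enveloping algebra is
written as a linear combination `P` of products of elements of the Lie algebra. -/
def IsZFinite (D : ClassicalData F ι) (f : D.points (Adele F) → ℂ) : Prop :=
  ∃ W : Submodule ℂ (D.points (Adele F) → ℂ), FiniteDimensional ℂ W ∧
    ∀ P : List (lieAlg D) →₀ ℝ,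
      (P.sum fun w c => c • (w.map (UniversalEnvelopingAlgebra.ι ℝ)).prod) ∈
        Subalgebra.center ℝ (UniversalEnvelopingAlgebra ℝ (lieAlg D)) →
      (P.sum fun w c => (c : ℂ) • wordDeriv D w f) ∈ W

open scoped Classical in
/-- Smooth functions on `H(𝔸)`: continuous, `C^∞` in the archimedean variable (locally the
restriction of a smooth function of the matrix entries) and right invariant under an open subgroup
of the group of finite adelic points (equivalently, under a neighbourhood of `1` there). -/
structure IsSmooth (D : ClassicalData F ι) (f : D.points (Adele F) → ℂ) : Prop where
  continuous : Continuous f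
  arch : ∀ g : D.points (Adele F), ∃ φ : (ι → ι → RealAlg F) → ℂ,
    ContDiffAt ℝ ((⊤ : ℕ∞) : WithTop ℕ∞) φ (1 : Matrix ι ι (RealAlg F)) ∧
    ∀ᶠ h in 𝓝 (1 : archPoints D.points),
      f (g * archEmb D h) = φ ((h : GL ι (RealAlg F)) : Matrix ι ι (RealAlg F))
  fin : ∃ V ∈ 𝓝 (1 : D.points (Adele F)), ∀ k ∈ V,
    GeneralLinearGroup.map (toInf F) (k : GL ι (Adele F)) = 1 → ∀ g, f (g * k) = f g

/-- `K` is a maximal compact subgroup of the topological group `G`. -/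
def IsMaximalCompact {G : Type*} [Group G] [TopologicalSpace G] (K : Subgroup G) : Prop :=
  IsCompact (K : Set G) ∧ ∀ K' : Subgroup G, IsCompact (K' : Set G) → K ≤ K' → K' = K

/-- The height `∏_v max_{i,j} (|g_{ij}|_v, |(g⁻¹)_{ij}|_v)` on `GL_ι(𝔸)`. -/
def height (g : GL ι (Adele F)) : ℝ :=
  (∏ v : InfinitePlace F, (((Finset.univ : Finset (ι × ι)).sup fun ij =>
      max ‖toInf F ((g : Matrix ι ι (Adele F)) ij.1 ij.2) v‖₊
        ‖toInf F (((g⁻¹ : GL ι (Adele F)) : Matrix ι ι (Adele F)) ij.1 ij.2) v‖₊ : NNReal) : ℝ)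
      ^ v.mult) *
  ∏ᶠ v : IsDedekindDomain.HeightOneSpectrum (𝓞 F), (((Finset.univ : Finset (ι × ι)).sup fun ij =>
      max ‖toFin F ((g : Matrix ι ι (Adele F)) ij.1 ij.2) v‖₊
        ‖toFin F (((g⁻¹ : GL ι (Adele F)) : Matrix ι ι (Adele F)) ij.1 ij.2) v‖₊ : NNReal) : ℝ)

/-- Automorphic forms on `H(𝔸)`, with respect to a maximal compact subgroup `K` of `H(F_∞)`.
A smooth function that is right `K`-finite is finite under `K × K_f` for every compact
open subgroup `K_f` of the group of finite adelic points. -/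
structure IsAutomorphicForm (D : ClassicalData F ι) (K : Subgroup (archPoints D.points))
    (f : D.points (Adele F) → ℂ) : Prop where
  smooth : IsSmooth D f
  left_invariant : ∀ γ ∈ rational D.points D.points, ∀ g, f (γ * g) = f g
  finite : FiniteDimensional ℂ
    (Submodule.span ℂ (Set.range fun k : K => fun g => f (g * archEmb D k)))
  zfinite : IsZFinite D f
  moderate : ∃ (c : ℝ) (N : ℕ), ∀ g : D.points (Adele F), ‖f g‖ ≤ c * height (g : GL ι (Adele F)) ^ N

end Automorphic

/-! ### Characters and the conditions for root exchange -/

section Exchange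

open scoped commutatorElement

variable {F : Type u} [Field F] [NumberField F] {ι : Type} [Fintype ι] [DecidableEq ι]

open scoped Classical in
/-- The value `ψ(z)` for `z` in `G(𝔸)` (and `1` for other `z` in `H(𝔸)`). -/
def charValue {H G : MatGroup F ι} (ψ : adelic H G →* Circle) (z : H (Adele F)) : Circle :=
  if h : z ∈ adelic H G then ψ ⟨z, h⟩ else 1

/-- `ψ` is a nontrivial character of `[G] = G(F)\G(𝔸)`. -/
structure IsNontrivialCharacter {H G : MatGroup F ι} (ψ : adelic H G →* Circle) : Prop where
  continuous : Continuous ψ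
  rational : ∀ γ : adelic H G, (γ : H (Adele F)) ∈ rational H G → ψ γ = 1
  nontrivial : ψ ≠ 1

/-- The conditions on a quadruple `(C, ψ, X, Y)` under which roots can be exchanged. The last
fields say that `(x, y) ↦ ψ([x, y])` induces a non-degenerate bimultiplicative pairing of
`(X ∩ C)(𝔸)\X(𝔸)` and `(Y ∩ C)(𝔸)\Y(𝔸)` which identifies `(Y ∩ C)(F)\Y(F)` with the group of
continuous characters of `X(F)(X ∩ C)(𝔸)\X(𝔸)`, and vice versa. -/
structure IsExchangeQuadruple (H C : MatGroup F ι) (ψ : adelic H C →* Circle) (X Y : MatGroup F ι) :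
    Prop where
  unipotent_C : IsUnipotentSubgroup H C
  unipotent_X : IsUnipotentSubgroup H X
  unipotent_Y : IsUnipotentSubgroup H Y
  character : IsNontrivialCharacter ψ
  normalize_X : ∀ x ∈ adelic H X, ∀ c ∈ adelic H C, x * c * x⁻¹ ∈ adelic H C
  normalize_Y : ∀ y ∈ adelic H Y, ∀ c ∈ adelic H C, y * c * y⁻¹ ∈ adelic H C
  normal_X : ((adelic H X ⊓ adelic H C).subgroupOf (adelic H X)).Normal
  normal_Y : ((adelic H Y ⊓ adelic H C).subgroupOf (adelic H Y)).Normal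
  abelian_X : ∀ x ∈ adelic H X, ∀ x' ∈ adelic H X, ⁅x, x'⁆ ∈ adelic H X ⊓ adelic H C
  abelian_Y : ∀ y ∈ adelic H Y, ∀ y' ∈ adelic H Y, ⁅y, y'⁆ ∈ adelic H Y ⊓ adelic H C
  preserve_X : ∀ x ∈ adelic H X, ∀ c ∈ adelic H C, charValue ψ (x * c * x⁻¹) = charValue ψ c
  preserve_Y : ∀ y ∈ adelic H Y, ∀ c ∈ adelic H C, charValue ψ (y * c * y⁻¹) = charValue ψ c
  trivial_X : ∀ z ∈ adelic H X ⊓ adelic H C, charValue ψ z = 1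
  trivial_Y : ∀ z ∈ adelic H Y ⊓ adelic H C, charValue ψ z = 1
  commutator : ∀ x ∈ adelic H X, ∀ y ∈ adelic H Y, ⁅x, y⁆ ∈ adelic H C
  mul_left : ∀ x ∈ adelic H X, ∀ x' ∈ adelic H X, ∀ y ∈ adelic H Y,
    charValue ψ ⁅x * x', y⁆ = charValue ψ ⁅x, y⁆ * charValue ψ ⁅x', y⁆
  mul_right : ∀ x ∈ adelic H X, ∀ y ∈ adelic H Y, ∀ y' ∈ adelic H Y,
    charValue ψ ⁅x, y * y'⁆ = charValue ψ ⁅x, y⁆ * charValue ψ ⁅x, y'⁆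
  nondegenerate_X : ∀ x ∈ adelic H X, (∀ y ∈ adelic H Y, charValue ψ ⁅x, y⁆ = 1) →
    x ∈ adelic H X ⊓ adelic H C
  nondegenerate_Y : ∀ y ∈ adelic H Y, (∀ x ∈ adelic H X, charValue ψ ⁅x, y⁆ = 1) →
    y ∈ adelic H Y ⊓ adelic H C
  dual_X_injective : ∀ y ∈ rational H Y, (∀ x ∈ adelic H X, charValue ψ ⁅x, y⁆ = 1) →
    y ∈ rational H Y ⊓ rational H C
  dual_X_surjective : ∀ χ : adelic H X →* Circle, Continuous χ →
    (∀ x : adelic H X, (x : H (Adele F)) ∈ rational H X ⊔ (adelic H X ⊓ adelic H C) → χ x = 1) →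
    ∃ y ∈ rational H Y, ∀ x : adelic H X, χ x = charValue ψ ⁅(x : H (Adele F)), y⁆
  dual_Y_injective : ∀ x ∈ rational H X, (∀ y ∈ adelic H Y, charValue ψ ⁅x, y⁆ = 1) →
    x ∈ rational H X ⊓ rational H C
  dual_Y_surjective : ∀ χ : adelic H Y →* Circle, Continuous χ →
    (∀ y : adelic H Y, (y : H (Adele F)) ∈ rational H Y ⊔ (adelic H Y ⊓ adelic H C) → χ y = 1) →
    ∃ x ∈ rational H X, ∀ y : adelic H Y, χ y = charValue ψ ⁅x, (y : H (Adele F))⁆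

/-- The group `X_a ⋯ X_1 C Y_r ⋯ Y_{b+1}` generated by `X_1, …, X_a`, `C` and `Y_{b+1}, …, Y_r`
(which is the product set as soon as the latter is a group). -/
def chainGroup (C : MatGroup F ι) (X Y : ℕ → MatGroup F ι) (r a b : ℕ) : MatGroup F ι :=
  fun R _ _ => (⨆ j ∈ Finset.Ioc 0 a, X j R) ⊔ C R ⊔ ⨆ j ∈ Finset.Ioc b r, Y j R

/-- `χ` is the extension of the character `ψ` of `C(𝔸)` to `X_a ⋯ X_1 C Y_r ⋯ Y_{b+1}` that is
trivial on the groups `X_j(𝔸)` and `Y_j(𝔸)`. -/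
structure IsTrivialExtension {H C : MatGroup F ι} (ψ : adelic H C →* Circle)
    (X Y : ℕ → MatGroup F ι) (r a b : ℕ) (χ : adelic H (chainGroup C X Y r a b) →* Circle) :
    Prop where
  on_C : ∀ c ∈ adelic H C, charValue χ c = charValue ψ c
  on_X : ∀ j ∈ Finset.Ioc 0 a, ∀ x ∈ adelic H (X j), charValue χ x = 1
  on_Y : ∀ j ∈ Finset.Ioc b r, ∀ y ∈ adelic H (Y j), charValue χ y = 1

/-! ### Fourier coefficients -/

/-- `[G] = G(F)\G(𝔸)`: the orbits of `G(F)` on `G(𝔸)` under left multiplication. -/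
abbrev AutQuot (H G : MatGroup F ι) : Type u :=
  MulAction.orbitRel.Quotient ((rational H G).subgroupOf (adelic H G)) (adelic H G)

instance (H G : MatGroup F ι) : MeasurableSpace (AutQuot H G) := borel _

instance (H G : MatGroup F ι) : BorelSpace (AutQuot H G) := ⟨rfl⟩

/-- Right translation by `h ∈ G(𝔸)` on `[G]`. -/
def rightTranslate (H G : MatGroup F ι) (h : adelic H G) : AutQuot H G → AutQuot H G :=
  Quotient.map (fun g => g * h) fun a b hab => by
    obtain ⟨γ, hγ⟩ := hab
    exact ⟨γ, by rw [← hγ]; exact (smul_mul_assoc γ b h).symm⟩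

/-- `ν` is the invariant measure on `[G]`, of total mass `1`. -/
structure IsInvariantMeasure (H G : MatGroup F ι) (ν : Measure (AutQuot H G)) : Prop where
  prob : IsProbabilityMeasure ν
  regular : ν.Regular
  invariant : ∀ h : adelic H G, ν.map (rightTranslate H G h) = ν

/-- The Fourier coefficient `∫_{[G]} f(u g) χ(u)⁻¹ du`. For `f` left invariant under `H(F)` and
`χ` trivial on `G(F)` the integrand does not depend on the representative `u` of a class. -/
def fourierCoeff (H G : MatGroup F ι) (ν : Measure (AutQuot H G)) (χ : adelic H G →* Circle)
    (f : H (Adele F) → ℂ) (g : H (Adele F)) : ℂ :=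
  ∫ q : AutQuot H G, f ((Quotient.out q : adelic H G) * g) *
    (((χ (Quotient.out q))⁻¹ : Circle) : ℂ) ∂ν

end Exchange

end RootExchange
end

open RootExchange

/-! The integrals over `[G]` that occur are invariant means on the quotients `Γ\A`, where
`A = G(𝔸)` and `Γ = G(F)`. Working with means rather than measures allows one to treat all groups as
subgroups of `H(𝔸)`, to integrate in stages without any measure theory on the quotients, and to deal
with the groups `X_i ⋯ X_1 C Y_r ⋯ Y_{i+1}`, which are not assumed to be closed subgroup schemes.

**One exchange.** Let `(B, ψ, X, Y)` be an exchange quadruple, `A = X(𝔸) B(𝔸)` and `Γ = X(F) B(F)`.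
The commutators of `A` lie in `B(𝔸)`, so that `T = A/Γ B(𝔸)` is a compact abelian group. For given
`g`, let `Φ (a)` be the integral of `f (c a g) ψ⁻¹ (c a)` over `c` in `[B]`; it is a function on `T`,
and the coefficient of `f` along `X B` at `g` is the integral of `Φ` over `T`. As `f` is invariant
under `y ∈ Y(F)`, replacing `g` by `y⁻¹ g` multiplies `Φ` by the character `a ↦ ψ([y, a])`. By duality
and nondegeneracy of the pairing these characters separate the points of `T`
(`IsExchangeQuadruple.separates`), so by the Stone-Weierstrass theorem the coefficients along `X B`
vanish for all `g` if and only if `Φ = 0` for all `g`, that is, if and only if the coefficients along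
`B` vanish (`mean_twist_eq_zero_iff`, `IsExchangeQuadruple.mean_eq_zero_iff`). The quadruple being
symmetric in `X` and `Y`, the same holds for `B Y`. With `B = X_{i-1} ⋯ X_1 C Y_r ⋯ Y_{i+1}` this
compares the coefficients along `X_i ⋯ X_1 C Y_r ⋯ Y_{i+1}` and `X_{i-1} ⋯ X_1 C Y_r ⋯ Y_i`, and
the theorem follows by induction on `i` (`IsExchangeChain.exists_iff`).

**Integration in stages.** The formula used above, by which a mean on `Γ\A` is the composition of
integration along `[B]` and of its restriction to functions on `T`
(`IsAbelianExtension.mean_eq_mean_fibreMean`), holds for every invariant mean if the mean on `[B]` is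
*ergodic*: every continuous function is carried uniformly close to its mean by an average of right
translations. Ergodic means are unique.

**Unipotent groups.** It remains to show that `[U]` is compact and has an ergodic mean if `U` is a
unipotent group (`IsUnipotentSubgroup.exists_isErgodicMean`). Exponential and logarithm relate `U` to
its Lie algebra, the space of tangent vectors at `1`; by Engel's theorem there is a filtration of the
algebra of matrices by spaces of matrices that are triangular for a flag. It defines a central
filtration of `U(𝔸)` whose steps are generated by `U(F)` and compact sets, since the quotient of the
adele ring by `F` is compact. One then ascends along this filtration
(`IsErgodicMean.of_central`), averaging over compact abelian groups.

**Extension of characters.** As `ψ` is invariant under `X` and trivial on `X ∩ B`, it extends to `X B`.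
The extension is continuous because `X(𝔸) B(𝔸)` is the product of a discrete group of rational points
and of compact subsets of `B(𝔸)` and `X(𝔸)` (`continuousOn_of_eq_mul_mul`). -/

set_option linter.unusedSectionVars false

noncomputable section

namespace RootExchange

/-! ### Invariant means on `Γ\A` -/

section Means

variable {G : Type*} [Group G]

/-- The operators obtained from right translations by elements of `S` by forming convex
combinations and compositions. -/
inductive AvgOp (S : Set G) : ((G → ℂ) → (G → ℂ)) → Prop
  | trans (h : G) (hh : h ∈ S) : AvgOp S (fun φ a => φ (a * h))
  | conv (P Q : (G → ℂ) → (G → ℂ)) (t : ℝ) (h0 : 0 ≤ t) (h1 : t ≤ 1) (hP : AvgOp S P)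
      (hQ : AvgOp S Q) : AvgOp S (fun φ a => t * P φ a + (1 - t : ℝ) * Q φ a)
  | comp (P Q : (G → ℂ) → (G → ℂ)) (hP : AvgOp S P) (hQ : AvgOp S Q) : AvgOp S (fun φ => P (Q φ))

namespace AvgOp

variable {S : Set G} {Q : (G → ℂ) → (G → ℂ)}

theorem mono {S' : Set G} (hS : S ⊆ S') (hQ : AvgOp S Q) : AvgOp S' Q := by
  induction hQ with
  | trans h hh => exact .trans h (hS hh)
  | conv P Q t h0 h1 _ _ hP hQ => exact .conv P Q t h0 h1 hP hQ
  | comp P Q _ _ hP hQ => exact .comp P Q hP hQ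

/-- Averaging over `C` preserves an estimate that holds on a right coset of `C`, or on any set that
is stable under right translation by `C`. -/
theorem norm_sub_le (hQ : AvgOp S Q) {B : Set G} (hB : ∀ b ∈ B, ∀ s ∈ S, b * s ∈ B) {φ : G → ℂ}
    {c : ℂ} {ε : ℝ} (hφ : ∀ b ∈ B, ‖φ b - c‖ ≤ ε) : ∀ b ∈ B, ‖Q φ b - c‖ ≤ ε := by
  induction hQ generalizing φ with
  | trans h hh => exact fun b hb => hφ _ (hB b hb h hh)
  | conv P Q t h0 h1 _ _ hP hQ =>
    intro b hb
    have e : (t : ℂ) * P φ b + ((1 - t : ℝ) : ℂ) * Q φ b - c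
        = t * (P φ b - c) + ((1 - t : ℝ) : ℂ) * (Q φ b - c) := by push_cast; ring
    rw [e]
    refine (norm_add_le _ _).trans ?_
    rw [norm_mul, norm_mul, Complex.norm_real, Complex.norm_real, Real.norm_of_nonneg h0,
      Real.norm_of_nonneg (sub_nonneg.2 h1)]
    nlinarith [mul_le_mul_of_nonneg_left (hP hφ b hb) h0,
      mul_le_mul_of_nonneg_left (hQ hφ b hb) (sub_nonneg.2 h1)]
  | comp P Q _ _ hP hQ => exact hP (hQ hφ)

/-- Functions that are invariant under `S` behave as constants for averages over `S`. -/
theorem mul_of_inv (hQ : AvgOp S Q) {B : Set G} (hB : ∀ b ∈ B, ∀ s ∈ S, b * s ∈ B) {φ w η : G → ℂ}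
    (hw : ∀ b ∈ B, ∀ s ∈ S, w (b * s) = w b) (h : ∀ b ∈ B, η b = φ b * w b) :
    ∀ b ∈ B, Q η b = Q φ b * w b := by
  induction hQ generalizing φ η with
  | trans x hx =>
    intro b hb
    change η (b * x) = φ (b * x) * w b
    rw [h _ (hB b hb x hx), hw b hb x hx]
  | conv P Q t h0 h1 _ _ hP hQ =>
    intro b hb
    change t * P η b + ((1 - t : ℝ) : ℂ) * Q η b
      = (t * P φ b + ((1 - t : ℝ) : ℂ) * Q φ b) * w b
    rw [hP h b hb, hQ h b hb]; ring
  | comp P Q _ _ hP hQ => exact hP (hQ h)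

end AvgOp

variable [TopologicalSpace G]

/-- `φ` is continuous on `A` and left `Γ`-invariant there, so that it is a continuous function on
`Γ\A`. The values of `φ` outside `A` play no role. -/
structure IsAutomorphic (A Γ : Subgroup G) (φ : G → ℂ) : Prop where
  cont : ContinuousOn φ A
  inv : ∀ γ ∈ Γ, ∀ a ∈ A, φ (γ * a) = φ a

/-- `m` is a right `A`-invariant mean on the continuous functions on `Γ\A`. The field `bound`
expresses positivity and the triangle inequality together. -/
structure IsMean (A Γ : Subgroup G) (m : (G → ℂ) → ℂ) : Prop where
  add : ∀ φ φ', IsAutomorphic A Γ φ → IsAutomorphic A Γ φ' →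
    m (fun a => φ a + φ' a) = m φ + m φ'
  smul : ∀ (c : ℂ) φ, IsAutomorphic A Γ φ → m (fun a => c * φ a) = c * m φ
  one : m (fun _ => 1) = 1
  bound : ∀ (φ : G → ℂ) (w : G → ℝ), IsAutomorphic A Γ φ →
    IsAutomorphic A Γ (fun a => (w a : ℂ)) → (∀ a ∈ A, ‖φ a‖ ≤ w a) →
    ‖m φ‖ ≤ (m fun a => (w a : ℂ)).re
  right_inv : ∀ φ, IsAutomorphic A Γ φ → ∀ h ∈ A, m (fun a => φ (a * h)) = m φ

/-- A mean `m` such that every continuous function on `Γ\A` has averages of right translates that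
are uniformly close to its mean. Such a mean is the only one (`IsErgodicMean.unique`). -/
structure IsErgodicMean (A Γ : Subgroup G) (m : (G → ℂ) → ℂ) : Prop extends IsMean A Γ m where
  approx : ∀ φ, IsAutomorphic A Γ φ → ∀ ε > 0, ∃ Q, AvgOp (A : Set G) Q ∧
    ∀ a ∈ A, ‖Q φ a - m φ‖ ≤ ε

/-- `A = Γ K` for a compact subset `K` of `A`. -/
def IsCocompact (A Γ : Subgroup G) : Prop :=
  ∃ K : Set G, IsCompact K ∧ K ⊆ A ∧ ∀ a ∈ A, ∃ γ ∈ Γ, ∃ k ∈ K, a = γ * k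

variable {A Γ C : Subgroup G} {m : (G → ℂ) → ℂ}

theorem IsAutomorphic.mono {Γ' : Subgroup G} {φ : G → ℂ} (h : IsAutomorphic A Γ φ) (hΓ : Γ' ≤ Γ) :
    IsAutomorphic A Γ' φ :=
  ⟨h.cont, fun γ hγ => h.inv γ (hΓ hγ)⟩

theorem IsAutomorphic.const (c : ℂ) : IsAutomorphic A Γ (fun _ => c) :=
  ⟨continuousOn_const, fun _ _ _ _ => rfl⟩

theorem IsAutomorphic.add {φ φ' : G → ℂ} (h : IsAutomorphic A Γ φ) (h' : IsAutomorphic A Γ φ') :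
    IsAutomorphic A Γ (fun a => φ a + φ' a) :=
  ⟨h.cont.add h'.cont, fun γ hγ a ha => by rw [h.inv γ hγ a ha, h'.inv γ hγ a ha]⟩

theorem IsAutomorphic.mul {φ φ' : G → ℂ} (h : IsAutomorphic A Γ φ) (h' : IsAutomorphic A Γ φ') :
    IsAutomorphic A Γ (fun a => φ a * φ' a) :=
  ⟨h.cont.mul h'.cont, fun γ hγ a ha => by rw [h.inv γ hγ a ha, h'.inv γ hγ a ha]⟩

theorem IsAutomorphic.conj {φ : G → ℂ} (h : IsAutomorphic A Γ φ) :
    IsAutomorphic A Γ (fun a => starRingEnd ℂ (φ a)) :=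
  ⟨Complex.continuous_conj.comp_continuousOn h.cont, fun γ hγ a ha => by
    rw [h.inv γ hγ a ha]⟩

theorem IsAutomorphic.const_mul {φ : G → ℂ} (c : ℂ) (h : IsAutomorphic A Γ φ) :
    IsAutomorphic A Γ (fun a => c * φ a) :=
  (IsAutomorphic.const c).mul h

theorem IsAutomorphic.sub {φ φ' : G → ℂ} (h : IsAutomorphic A Γ φ) (h' : IsAutomorphic A Γ φ') :
    IsAutomorphic A Γ (fun a => φ a - φ' a) :=
  ⟨h.cont.sub h'.cont, fun γ hγ a ha => by rw [h.inv γ hγ a ha, h'.inv γ hγ a ha]⟩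

theorem IsAutomorphic.translate [ContinuousMul G] {φ : G → ℂ} (h : IsAutomorphic A Γ φ) {x : G}
    (hx : x ∈ A) : IsAutomorphic A Γ (fun a => φ (a * x)) :=
  ⟨h.cont.comp (continuous_mul_const x).continuousOn fun a ha => A.mul_mem ha hx,
    fun γ hγ a ha => by rw [mul_assoc, h.inv γ hγ _ (A.mul_mem ha hx)]⟩

theorem IsAutomorphic.norm {φ : G → ℂ} (h : IsAutomorphic A Γ φ) :
    IsAutomorphic A Γ (fun a => ((‖φ a‖ : ℝ) : ℂ)) :=
  ⟨Complex.continuous_ofReal.comp_continuousOn h.cont.norm, fun γ hγ a ha => by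
    rw [h.inv γ hγ a ha]⟩

namespace AvgOp

variable {S : Set G} {Q : (G → ℂ) → (G → ℂ)}

theorem isAutomorphic [ContinuousMul G] (hQ : AvgOp S Q) (hS : S ⊆ A) {φ : G → ℂ}
    (hφ : IsAutomorphic A Γ φ) : IsAutomorphic A Γ (Q φ) := by
  induction hQ generalizing φ with
  | trans h hh => exact hφ.translate (hS hh)
  | conv P Q t h0 h1 _ _ hP hQ => exact ((hP hφ).const_mul _).add ((hQ hφ).const_mul _)
  | comp P Q _ _ hP hQ => exact hP (hQ hφ)

end AvgOp

namespace IsMean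

theorem sub (hm : IsMean A Γ m) {φ φ' : G → ℂ} (h : IsAutomorphic A Γ φ)
    (h' : IsAutomorphic A Γ φ') : m (fun a => φ a - φ' a) = m φ - m φ' := by
  have := hm.add φ (fun a => (-1) * φ' a) h (h'.const_mul _)
  rw [hm.smul _ _ h'] at this
  simpa [sub_eq_add_neg] using this

theorem const (hm : IsMean A Γ m) (c : ℂ) : m (fun _ => c) = c := by
  have := hm.smul c _ (IsAutomorphic.const 1)
  simpa [hm.one] using this

theorem norm_le (hm : IsMean A Γ m) {φ : G → ℂ} (h : IsAutomorphic A Γ φ) {B : ℝ}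
    (hB : ∀ a ∈ A, ‖φ a‖ ≤ B) : ‖m φ‖ ≤ B := by
  have := hm.bound φ (fun _ => B) h (IsAutomorphic.const _) hB
  rwa [hm.const, Complex.ofReal_re] at this

theorem dist_le (hm : IsMean A Γ m) {φ φ' : G → ℂ} (h : IsAutomorphic A Γ φ)
    (h' : IsAutomorphic A Γ φ') {B : ℝ} (hB : ∀ a ∈ A, ‖φ a - φ' a‖ ≤ B) : ‖m φ - m φ'‖ ≤ B := by
  rw [← hm.sub h h']
  exact hm.norm_le (h.sub h') hB

theorem congr (hm : IsMean A Γ m) {φ φ' : G → ℂ} (h : IsAutomorphic A Γ φ)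
    (h' : IsAutomorphic A Γ φ') (e : ∀ a ∈ A, φ a = φ' a) : m φ = m φ' := by
  have := hm.dist_le h h' (B := 0) fun a ha => by rw [e a ha, sub_self, norm_zero]
  exact sub_eq_zero.1 (norm_le_zero_iff.1 this)

/-- The mean of a nonnegative function is a nonnegative real number. -/
theorem im_eq_zero (hm : IsMean A Γ m) {w : G → ℝ} (h : IsAutomorphic A Γ (fun a => (w a : ℂ)))
    (hw : ∀ a ∈ A, 0 ≤ w a) : m (fun a => (w a : ℂ)) = ((m fun a => (w a : ℂ)).re : ℂ) := by
  have := hm.bound _ w h h fun a ha => by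
    rw [Complex.norm_real, Real.norm_of_nonneg (hw a ha)]
  set z := m fun a => (w a : ℂ)
  have h1 : |z.re| = ‖z‖ := le_antisymm (Complex.abs_re_le_norm z) (this.trans (le_abs_self _))
  have h2 := Complex.abs_re_eq_norm.1 h1
  exact Complex.ext rfl (by simpa using h2)

theorem avg [ContinuousMul G] (hm : IsMean A Γ m) {S : Set G} (hS : S ⊆ A)
    {Q : (G → ℂ) → (G → ℂ)} (hQ : AvgOp S Q) {φ : G → ℂ} (hφ : IsAutomorphic A Γ φ) :
    m (Q φ) = m φ := by
  induction hQ generalizing φ with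
  | trans h hh => exact hm.right_inv φ hφ h (hS hh)
  | conv P Q t h0 h1 h2 h3 hP hQ =>
    rw [hm.add _ _ ((h2.isAutomorphic hS hφ).const_mul _) ((h3.isAutomorphic hS hφ).const_mul _),
      hm.smul _ _ (h2.isAutomorphic hS hφ), hm.smul _ _ (h3.isAutomorphic hS hφ), hP hφ, hQ hφ]
    push_cast; ring
  | comp P Q _ h3 hP hQ => rw [hP (h3.isAutomorphic hS hφ), hQ hφ]

theorem mono {Γ' : Subgroup G} (hm : IsMean A Γ m) (hΓ : Γ ≤ Γ') : IsMean A Γ' m where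
  add φ φ' h h' := hm.add φ φ' (h.mono hΓ) (h'.mono hΓ)
  smul c φ h := hm.smul c φ (h.mono hΓ)
  one := hm.one
  bound φ w h h' := hm.bound φ w (h.mono hΓ) (h'.mono hΓ)
  right_inv φ h := hm.right_inv φ (h.mono hΓ)

theorem sum (hm : IsMean A Γ m) {n : ℕ} {φ : Fin n → G → ℂ} (h : ∀ i, IsAutomorphic A Γ (φ i)) :
    IsAutomorphic A Γ (fun a => ∑ i, φ i a) ∧ m (fun a => ∑ i, φ i a) = ∑ i, m (φ i) := by
  induction n with
  | zero =>
    simp only [Finset.univ_eq_empty, Finset.sum_empty]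
    exact ⟨IsAutomorphic.const 0, hm.const 0⟩
  | succ n ih =>
    simp only [Fin.sum_univ_succ]
    obtain ⟨h1, h2⟩ := ih fun i => h i.succ
    exact ⟨(h 0).add h1, by rw [hm.add _ _ (h 0) h1, h2]⟩

end IsMean

namespace IsErgodicMean

theorem unique [ContinuousMul G] (hm : IsErgodicMean A Γ m) {m' : (G → ℂ) → ℂ}
    (hm' : IsMean A Γ m') {φ : G → ℂ} (hφ : IsAutomorphic A Γ φ) : m' φ = m φ := by
  refine sub_eq_zero.1 (norm_le_zero_iff.1 (le_of_forall_pos_le_add fun ε hε => ?_))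
  obtain ⟨Q, hQ, h⟩ := hm.approx φ hφ ε hε
  have hQφ := hQ.isAutomorphic subset_rfl hφ
  have := hm'.dist_le hQφ (IsAutomorphic.const (m φ)) h
  rw [hm'.const, hm'.avg subset_rfl hQ hφ] at this
  simpa using this

/-- Finitely many functions can be averaged simultaneously. -/
theorem approx_finset [ContinuousMul G] (hm : IsErgodicMean A Γ m) {ι : Type*} (s : Finset ι)
    (φ : ι → G → ℂ) (hφ : ∀ i ∈ s, IsAutomorphic A Γ (φ i)) {ε : ℝ} (hε : 0 < ε) :
    ∃ Q, AvgOp (A : Set G) Q ∧ ∀ i ∈ s, ∀ a ∈ A, ‖Q (φ i) a - m (φ i)‖ ≤ ε := by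
  classical
  induction s using Finset.induction_on with
  | empty => exact ⟨_, .trans 1 A.one_mem, by simp⟩
  | insert i s hi ih =>
    obtain ⟨Q, hQ, h⟩ := ih fun j hj => hφ j (Finset.mem_insert_of_mem hj)
    have hφi := hφ i (Finset.mem_insert_self i s)
    obtain ⟨P, hP, h'⟩ := hm.approx (Q (φ i)) (hQ.isAutomorphic subset_rfl hφi) ε hε
    rw [hm.avg subset_rfl hQ hφi] at h'
    refine ⟨_, .comp P Q hP hQ, fun j hj => ?_⟩
    obtain rfl | hj := Finset.mem_insert.1 hj
    · exact h'
    · exact hP.norm_sub_le (fun b hb s hs => A.mul_mem hb hs) (h j hj)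

/-- The mean is invariant under automorphisms of the pair `(A, Γ)`. -/
theorem conj_eq [IsTopologicalGroup G] (hm : IsErgodicMean A Γ m) {s : G}
    (hA : ∀ a ∈ A, s * a * s⁻¹ ∈ A) (hA' : ∀ a ∈ A, s⁻¹ * a * s ∈ A)
    (hΓ : ∀ a ∈ Γ, s * a * s⁻¹ ∈ Γ) {φ : G → ℂ} (hφ : IsAutomorphic A Γ φ) :
    m (fun a => φ (s * a * s⁻¹)) = m φ := by
  have key : ∀ φ, IsAutomorphic A Γ φ → IsAutomorphic A Γ (fun a => φ (s * a * s⁻¹)) := by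
    refine fun φ hφ => ⟨hφ.cont.comp (by fun_prop) fun a ha => hA a ha, fun γ hγ a ha => ?_⟩
    rw [← hφ.inv _ (hΓ γ hγ) _ (hA a ha)]
    congr 1; group
  refine hm.unique (m' := fun φ => m (fun a => φ (s * a * s⁻¹))) ⟨?_, ?_, ?_, ?_, ?_⟩ hφ
  · exact fun φ φ' h h' => hm.add _ _ (key φ h) (key φ' h')
  · exact fun c φ h => hm.smul c _ (key φ h)
  · exact hm.one
  · exact fun φ w h h' hw => hm.bound _ (fun a => w (s * a * s⁻¹)) (key φ h) (key _ h')
      fun a ha => hw _ (hA a ha)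
  · intro φ h x hx
    rw [← hm.right_inv _ (key φ h) _ (hA' x hx)]
    congr 1; ext a; group

end IsErgodicMean

/-- The evaluation at `1` is the mean for the one-point space `A\A`. -/
theorem isErgodicMean_self : IsErgodicMean A A (fun φ => φ 1) := by
  have key : ∀ φ, IsAutomorphic A A φ → ∀ a ∈ A, φ a = φ 1 := fun φ h a ha => by
    simpa using h.inv a ha 1 A.one_mem
  refine ⟨⟨fun _ _ _ _ => rfl, fun _ _ _ => rfl, rfl, fun φ w h h' hw => ?_, fun φ h a ha => ?_⟩,
    fun φ h ε hε => ⟨_, .trans 1 A.one_mem, fun a ha => ?_⟩⟩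
  · simpa using hw 1 A.one_mem
  · simpa using key φ h a ha
  · simp only [mul_one, key φ h a ha, sub_self, norm_zero]
    exact hε.le

/-- A continuous function on a compact quotient `Γ\A` is uniformly continuous for right
translations. -/
theorem IsAutomorphic.uniform [IsTopologicalGroup G] {φ : G → ℂ} (hφ : IsAutomorphic A Γ φ)
    (hK : IsCocompact A Γ) {ε : ℝ} (hε : 0 < ε) :
    ∃ W ∈ 𝓝 (1 : G), ∀ a ∈ A, ∀ w ∈ W, w ∈ A → ‖φ (a * w) - φ a‖ ≤ ε := by
  obtain ⟨K, hKc, hKA, hK⟩ := hK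
  have hc : Continuous fun a : A => φ a := continuousOn_iff_continuous_domRestrict.1 hφ.cont
  have hK' : IsCompact (Subtype.val ⁻¹' K : Set A) := by
    rw [Topology.IsInducing.subtypeVal.isCompact_iff]
    convert hKc
    ext x
    simpa using fun h => hKA h
  have hF : Continuous fun p : A × A => φ ((p.1 * p.2 : A)) - φ p.1 :=
    (hc.comp continuous_mul).sub (hc.comp continuous_fst)
  obtain ⟨u, v, hu, hv, hKu, h1v, huv⟩ := generalized_tube_lemma hK'
    (isCompact_singleton (x := (1 : A))) ((Metric.isOpen_ball (x := (0 : ℂ)) (ε := ε)).preimage hF) (by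
      rintro ⟨a, b⟩ ⟨-, rfl : b = 1⟩
      simpa using hε)
  obtain ⟨W, hW, hWv⟩ := isOpen_induced_iff.1 hv
  have h1 : (1 : A) ∈ v := h1v rfl
  rw [← hWv] at h1
  refine ⟨W, hW.mem_nhds h1, fun a ha w hw hwA => ?_⟩
  obtain ⟨γ, hγ, k, hk, rfl⟩ := hK a ha
  have hkA := hKA hk
  rw [mul_assoc, hφ.inv γ hγ _ (A.mul_mem hkA hwA), hφ.inv γ hγ _ hkA]
  have hwv : (⟨w, hwA⟩ : A) ∈ v := by rw [← hWv]; exact hw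
  have := @huv (⟨k, hkA⟩, ⟨w, hwA⟩) ⟨hKu hk, hwv⟩
  simpa using (mem_ball_zero_iff.1 this).le

theorem IsAutomorphic.bounded {φ : G → ℂ} (hφ : IsAutomorphic A Γ φ) (hK : IsCocompact A Γ) :
    ∃ B : ℝ, ∀ a ∈ A, ‖φ a‖ ≤ B := by
  obtain ⟨K, hKc, hKA, hK⟩ := hK
  obtain ⟨B, hB⟩ := hKc.exists_bound_of_continuousOn (hφ.cont.mono hKA)
  refine ⟨B, fun a ha => ?_⟩
  obtain ⟨γ, hγ, k, hk, rfl⟩ := hK a ha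
  rw [hφ.inv γ hγ k (hKA hk)]
  exact hB k hk

end Means

/-! ### Functions on the quotient by a normal subgroup -/

section Quotient

variable {G : Type*} [Group G]

/-- The function induced by `φ` on `A/N`. It is meant for `φ` constant on the cosets of `N`. -/
def quotFun (A N : Subgroup G) (φ : G → ℂ) : A ⧸ N.subgroupOf A → ℂ :=
  fun t => φ (Quotient.out t : A)

open scoped Classical in
/-- The pullback to `A`, extended by zero to `G`, of a function on `A/N`. -/
def liftFun {α : Type*} [Zero α] (A N : Subgroup G) (F : A ⧸ N.subgroupOf A → α) :
    G → α :=
  fun g => if h : g ∈ A then F (QuotientGroup.mk ⟨g, h⟩) else 0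

theorem liftFun_apply {α : Type*} [Zero α] {A N : Subgroup G} (F : A ⧸ N.subgroupOf A → α) {a : G}
    (ha : a ∈ A) : liftFun A N F a = F (QuotientGroup.mk ⟨a, ha⟩) :=
  dif_pos ha

theorem mem_sup_iff_exists_mul {Γ C : Subgroup G} (h : ∀ γ ∈ Γ, ∀ c ∈ C, γ * c * γ⁻¹ ∈ C) {x : G} :
    x ∈ Γ ⊔ C ↔ ∃ γ ∈ Γ, ∃ c ∈ C, x = γ * c := by
  refine ⟨fun hx => ?_, ?_⟩
  · let P : Subgroup G :=
      { carrier := {x | ∃ γ ∈ Γ, ∃ c ∈ C, x = γ * c}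
        one_mem' := ⟨1, Γ.one_mem, 1, C.one_mem, by simp⟩
        mul_mem' := by
          rintro _ _ ⟨γ, hγ, c, hc, rfl⟩ ⟨γ', hγ', c', hc', rfl⟩
          refine ⟨γ * γ', Γ.mul_mem hγ hγ', γ'⁻¹ * c * γ'⁻¹⁻¹ * c',
            C.mul_mem (h _ (Γ.inv_mem hγ') _ hc) hc', by group⟩
        inv_mem' := by
          rintro _ ⟨γ, hγ, c, hc, rfl⟩
          exact ⟨γ⁻¹, Γ.inv_mem hγ, γ * c⁻¹ * γ⁻¹, h _ hγ _ (C.inv_mem hc), by group⟩ }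
    have h1 : Γ ⊔ C ≤ P := sup_le (fun γ hγ => ⟨γ, hγ, 1, C.one_mem, by simp⟩)
      fun c hc => ⟨1, Γ.one_mem, c, hc, by simp⟩
    exact h1 hx
  · rintro ⟨γ, hγ, c, hc, rfl⟩
    exact Subgroup.mul_mem_sup hγ hc

variable {A N : Subgroup G}

theorem normal_of_commutator (hcomm : ∀ a ∈ A, ∀ b ∈ A, a * b * a⁻¹ * b⁻¹ ∈ N) :
    (N.subgroupOf A).Normal := by
  refine ⟨fun n hn a => ?_⟩
  have h1 : ((a * n * a⁻¹ : A) : G) = (a * n * (a : G)⁻¹ * (n : G)⁻¹) * n := by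
    push_cast; group
  rw [Subgroup.mem_subgroupOf, h1]
  exact N.mul_mem (hcomm _ a.2 _ n.2) hn

variable [TopologicalSpace G]

theorem quotFun_mk (hN : (N.subgroupOf A).Normal) {φ : G → ℂ} (hφ : IsAutomorphic A N φ) (a : A) :
    quotFun A N φ (QuotientGroup.mk a) = φ a := by
  obtain ⟨n, hn⟩ := QuotientGroup.mk_out_eq_mul (N.subgroupOf A) a
  have h1 : ((QuotientGroup.mk a : A ⧸ N.subgroupOf A).out : A) = (a * n * a⁻¹) * a := by
    rw [hn]; group
  have h2 : ((a * n * a⁻¹ : A) : G) ∈ N := hN.conj_mem n n.2 a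
  change φ ((QuotientGroup.mk a : A ⧸ N.subgroupOf A).out : A) = _
  rw [h1, Subgroup.coe_mul, hφ.inv _ h2 _ a.2]

theorem continuous_quotFun (hN : (N.subgroupOf A).Normal) {φ : G → ℂ} (hφ : IsAutomorphic A N φ) :
    Continuous (quotFun A N φ) := by
  refine (QuotientGroup.isQuotientMap_mk (N := N.subgroupOf A)).continuous_iff.2 ?_
  refine (continuousOn_iff_continuous_domRestrict.1 hφ.cont).congr fun a => ?_
  exact (quotFun_mk hN hφ a).symm

theorem isAutomorphic_liftFun (hNA : N ≤ A) (hN : (N.subgroupOf A).Normal)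
    {F : A ⧸ N.subgroupOf A → ℂ} (hF : Continuous F) : IsAutomorphic A N (liftFun A N F) := by
  refine ⟨?_, fun n hn a ha => ?_⟩
  · rw [continuousOn_iff_continuous_domRestrict]
    refine (hF.comp QuotientGroup.continuous_mk).congr fun a => ?_
    exact (liftFun_apply F a.2).symm
  · rw [liftFun_apply F ha, liftFun_apply F (A.mul_mem (hNA hn) ha)]
    congr 1
    rw [QuotientGroup.eq]
    have : (⟨n * a, A.mul_mem (hNA hn) ha⟩ : A)⁻¹ * ⟨a, ha⟩
        = (⟨a, ha⟩ : A)⁻¹ * ⟨n⁻¹, A.inv_mem (hNA hn)⟩ * (⟨a, ha⟩ : A)⁻¹⁻¹ := by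
      ext; simp
    rw [this]
    exact hN.conj_mem _ (N.inv_mem hn) _

theorem compactSpace_quotient (hN : (N.subgroupOf A).Normal) (hK : IsCocompact A N) :
    CompactSpace (A ⧸ N.subgroupOf A) := by
  obtain ⟨K, hKc, hKA, hK⟩ := hK
  have hK' : IsCompact (Subtype.val ⁻¹' K : Set A) := by
    rw [Topology.IsInducing.subtypeVal.isCompact_iff]
    convert hKc
    ext x
    simpa using fun h => hKA h
  refine ⟨?_⟩
  convert hK'.image (QuotientGroup.continuous_mk (N := N.subgroupOf A))
  refine (Set.eq_univ_of_forall fun t => ?_).symm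
  obtain ⟨a, rfl⟩ := QuotientGroup.mk_surjective t
  obtain ⟨n, hn, k, hk, h⟩ := hK a a.2
  refine ⟨⟨k, hKA hk⟩, hk, ?_⟩
  rw [QuotientGroup.eq]
  have : (⟨k, hKA hk⟩ : A)⁻¹ * a = (⟨k, hKA hk⟩ : A)⁻¹ * (a * (⟨k, hKA hk⟩ : A)⁻¹)
      * (⟨k, hKA hk⟩ : A)⁻¹⁻¹ := by group
  rw [this]
  refine hN.conj_mem _ ?_ _
  rw [Subgroup.mem_subgroupOf]
  simpa [h] using hn

/-- Integration over the compact abelian group `A/N`. The last clause says that the mean is strictly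
positive. -/
theorem exists_isErgodicMean_quotient [IsTopologicalGroup G]
    (hcomm : ∀ a ∈ A, ∀ b ∈ A, a * b * a⁻¹ * b⁻¹ ∈ N) (hK : IsCocompact A N) :
    ∃ m, IsErgodicMean A N m ∧ ∀ w : G → ℝ, IsAutomorphic A N (fun a => (w a : ℂ)) →
      (∀ a ∈ A, 0 ≤ w a) → m (fun a => (w a : ℂ)) = 0 → ∀ a ∈ A, w a = 0 := by
  have hN := normal_of_commutator hcomm
  have := compactSpace_quotient hN hK
  let : MeasurableSpace (A ⧸ N.subgroupOf A) := borel _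
  have : BorelSpace (A ⧸ N.subgroupOf A) := ⟨rfl⟩
  let μ : Measure (A ⧸ N.subgroupOf A) := Measure.haarMeasure ⊤
  have : IsProbabilityMeasure μ := ⟨by
    have := Measure.haarMeasure_self (K₀ := (⊤ : TopologicalSpace.PositiveCompacts
      (A ⧸ N.subgroupOf A)))
    rwa [TopologicalSpace.PositiveCompacts.coe_top] at this⟩
  have hab : ∀ s t : A ⧸ N.subgroupOf A, s * t = t * s := by
    intro s t
    obtain ⟨a, rfl⟩ := QuotientGroup.mk_surjective s
    obtain ⟨b, rfl⟩ := QuotientGroup.mk_surjective t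
    rw [← QuotientGroup.mk_mul, ← QuotientGroup.mk_mul, QuotientGroup.eq,
      Subgroup.mem_subgroupOf]
    have := hcomm _ (A.inv_mem b.2) _ (A.inv_mem a.2)
    convert this using 1
    push_cast; group
  have hint : ∀ {E : Type _} [NormedAddCommGroup E] {F : A ⧸ N.subgroupOf A → E},
      Continuous F → Integrable F μ := fun hF =>
    hF.integrable_of_hasCompactSupport (HasCompactSupport.of_compactSpace _)
  have hint' : ∀ {F : A ⧸ N.subgroupOf A → C(A ⧸ N.subgroupOf A, ℂ)},
      Continuous F → Integrable F μ := fun hF =>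
    hF.integrable_of_hasCompactSupport (HasCompactSupport.of_compactSpace _)
  have hre : ∀ w : G → ℝ, IsAutomorphic A N (fun a => (w a : ℂ)) →
      Continuous fun t : A ⧸ N.subgroupOf A => w (Quotient.out t : A) := fun w hw =>
    (Complex.continuous_re.comp (continuous_quotFun hN hw)).congr fun t => Complex.ofReal_re _
  refine ⟨fun φ => ∫ t, quotFun A N φ t ∂μ, ⟨⟨?_, ?_, ?_, ?_, ?_⟩, ?_⟩, ?_⟩
  · intro φ φ' h h'
    exact integral_add (hint (continuous_quotFun hN h)) (hint (continuous_quotFun hN h'))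
  · intro c φ h
    exact integral_const_mul c _
  · simp [quotFun]
  · intro φ w h h' hw
    have e : (∫ t, quotFun A N (fun a => (w a : ℂ)) t ∂μ)
        = ((∫ t : A ⧸ N.subgroupOf A, w (Quotient.out t : A) ∂μ : ℝ) : ℂ) :=
      integral_ofReal
    rw [e, Complex.ofReal_re]
    exact (norm_integral_le_integral_norm _).trans (integral_mono
      (hint (continuous_quotFun hN h)).norm (hint (hre w h')) fun t => hw _ (Quotient.out t : A).2)
  · intro φ h x hx
    have e : ∀ t, quotFun A N (fun a => φ (a * x)) t
        = quotFun A N φ ((QuotientGroup.mk ⟨x, hx⟩) * t) := by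
      intro t
      obtain ⟨a, rfl⟩ := QuotientGroup.mk_surjective t
      rw [quotFun_mk hN (h.translate hx), hab, ← QuotientGroup.mk_mul, quotFun_mk hN h]
      rfl
    simp only [e]
    exact integral_mul_left_eq_self _ _
  · intro φ h ε hε
    -- The constant `∫ φ` is the integral over `t` of the translates of `φ` by `t`.
    let F : C(A ⧸ N.subgroupOf A, ℂ) := ⟨_, continuous_quotFun hN h⟩
    let Φ : C(A ⧸ N.subgroupOf A, C(A ⧸ N.subgroupOf A, ℂ)) :=
      ContinuousMap.curry ⟨fun p => F (p.1 * p.2), by fun_prop⟩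
    have hΦ : (∫ t, Φ t ∂μ) ∈ closure (convexHull ℝ (Set.range Φ)) :=
      (convex_convexHull ℝ _).closure.integral_mem isClosed_closure
        (Filter.Eventually.of_forall fun t => subset_closure (subset_convexHull ℝ _ ⟨t, rfl⟩))
        (hint' Φ.continuous)
    have hv : ∀ s, (∫ t, Φ t ∂μ) s = ∫ t, quotFun A N φ t ∂μ := by
      intro s
      rw [ContinuousMap.integral_apply (hint' Φ.continuous)]
      have : ∀ t, (Φ t) s = quotFun A N φ (s * t) := fun t => by rw [hab]; rfl
      simp only [this]
      exact integral_mul_left_eq_self _ _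
    obtain ⟨g, hg, hgd⟩ := Metric.mem_closure_iff.1 hΦ ε hε
    have hsub : convexHull ℝ (Set.range Φ) ⊆ {g | ∃ Q, AvgOp (A : Set G) Q ∧
        ∀ a (ha : a ∈ A), Q φ a = g (QuotientGroup.mk ⟨a, ha⟩)} := by
      refine convexHull_min ?_ ?_
      · rintro _ ⟨t, rfl⟩
        obtain ⟨b, rfl⟩ := QuotientGroup.mk_surjective t
        refine ⟨_, .trans (S := (A : Set G)) (b : G) b.2, fun a ha => ?_⟩
        change _ = quotFun A N φ (QuotientGroup.mk b * QuotientGroup.mk ⟨a, ha⟩)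
        rw [hab, ← QuotientGroup.mk_mul, quotFun_mk hN h]
        rfl
      · rintro g ⟨P, hP, h1⟩ g' ⟨Q, hQ, h2⟩ r s hr hs hrs
        refine ⟨_, .conv P Q r hr (by linarith) hP hQ, fun a ha => ?_⟩
        rw [h1 a ha, h2 a ha, ← hrs]
        simp
    obtain ⟨Q, hQ, hQg⟩ := hsub hg
    refine ⟨Q, hQ, fun a ha => ?_⟩
    rw [hQg a ha, ← hv (QuotientGroup.mk ⟨a, ha⟩), ← dist_eq_norm, dist_comm]
    exact (ContinuousMap.dist_apply_le_dist _).trans hgd.le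
  · intro w hw h0 hm a ha
    have e : (∫ t, quotFun A N (fun a => (w a : ℂ)) t ∂μ)
        = ((∫ t : A ⧸ N.subgroupOf A, w (Quotient.out t : A) ∂μ : ℝ) : ℂ) :=
      integral_ofReal
    beta_reduce at hm
    rw [e, Complex.ofReal_eq_zero] at hm
    have h0' : 0 ≤ fun t : A ⧸ N.subgroupOf A => w (Quotient.out t : A) :=
      fun t => h0 _ (Quotient.out t : A).2
    have h1 := ((hre w hw).ae_eq_iff_eq μ continuous_const).1
      ((integral_eq_zero_iff_of_nonneg h0' (hint (hre w hw))).1 hm)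
    have h2 := quotFun_mk hN hw ⟨a, ha⟩
    have h3 : w ((QuotientGroup.mk ⟨a, ha⟩ : A ⧸ N.subgroupOf A).out : A) = 0 :=
      congrFun h1 (QuotientGroup.mk ⟨a, ha⟩)
    simp only [quotFun] at h2
    rw [h3] at h2
    simpa using h2.symm

end Quotient

/-! ### Means and central extensions -/

section AvgOp

variable {G : Type*} [Group G] {S : Set G} {Q : (G → ℂ) → (G → ℂ)}

theorem AvgOp.dist_le (hQ : AvgOp S Q) {B : Set G} (hB : ∀ b ∈ B, ∀ s ∈ S, b * s ∈ B)
    {φ φ' : G → ℂ} {ε : ℝ} (hφ : ∀ b ∈ B, ‖φ b - φ' b‖ ≤ ε) : ∀ b ∈ B, ‖Q φ b - Q φ' b‖ ≤ ε := by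
  induction hQ generalizing φ φ' with
  | trans h hh => exact fun b hb => hφ _ (hB b hb h hh)
  | conv P Q t h0 h1 _ _ hP hQ =>
    intro b hb
    have e : (t : ℂ) * P φ b + ((1 - t : ℝ) : ℂ) * Q φ b
        - ((t : ℂ) * P φ' b + ((1 - t : ℝ) : ℂ) * Q φ' b)
        = t * (P φ b - P φ' b) + ((1 - t : ℝ) : ℂ) * (Q φ b - Q φ' b) := by ring
    rw [e]
    refine (norm_add_le _ _).trans ?_
    rw [norm_mul, norm_mul, Complex.norm_real, Complex.norm_real, Real.norm_of_nonneg h0,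
      Real.norm_of_nonneg (sub_nonneg.2 h1)]
    nlinarith [mul_le_mul_of_nonneg_left (hP hφ b hb) h0,
      mul_le_mul_of_nonneg_left (hQ hφ b hb) (sub_nonneg.2 h1)]
  | comp P Q _ _ hP hQ => exact hP (hQ hφ)

theorem AvgOp.left_translate (hQ : AvgOp S Q) (φ : G → ℂ) (a : G) :
    Q (fun x => φ (a * x)) = fun x => Q φ (a * x) := by
  induction hQ generalizing φ with
  | trans h hh => funext x; simp only [mul_assoc]
  | conv P Q t h0 h1 _ _ hP hQ => simp only [hP, hQ]
  | comp P Q _ _ hP hQ => simp only [hQ, hP]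

/-- Averages over `S` are carried to averages over `S` by right translation by an element that
normalizes `S`. -/
theorem AvgOp.conj (hQ : AvgOp S Q) {a : G} (ha : ∀ s ∈ S, a⁻¹ * s * a ∈ S) :
    ∃ P, AvgOp S P ∧ ∀ φ, (fun x => P φ (x * a)) = Q (fun x => φ (x * a)) := by
  induction hQ with
  | trans h hh =>
    refine ⟨_, .trans _ (ha h hh), fun φ => ?_⟩
    funext x
    congr 1; group
  | conv P Q t h0 h1 _ _ hP hQ =>
    obtain ⟨P', hP', h⟩ := hP
    obtain ⟨Q', hQ', h'⟩ := hQ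
    refine ⟨_, .conv P' Q' t h0 h1 hP' hQ', fun φ => ?_⟩
    funext x
    change t * P' φ (x * a) + ((1 - t : ℝ) : ℂ) * Q' φ (x * a)
      = t * P (fun x => φ (x * a)) x + ((1 - t : ℝ) : ℂ) * Q (fun x => φ (x * a)) x
    rw [← h, ← h']
  | comp P Q _ _ hP hQ =>
    obtain ⟨P', hP', h⟩ := hP
    obtain ⟨Q', hQ', h'⟩ := hQ
    refine ⟨_, .comp P' Q' hP' hQ', fun φ => ?_⟩
    change _ = P (Q fun x => φ (x * a))
    rw [← h', ← h]

end AvgOp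

section Fibre

variable {G : Type*} [Group G] [TopologicalSpace G] {A C Γ Γ' ΓC : Subgroup G}
  {m mC m₂ : (G → ℂ) → ℂ} {φ : G → ℂ}

/-- The integral of `φ` over the coset `C a`, with respect to a mean on `C`. -/
def fibreMean (mC : (G → ℂ) → ℂ) (φ : G → ℂ) : G → ℂ := fun a => mC fun c => φ (c * a)

theorem IsAutomorphic.congr (h : IsAutomorphic A Γ φ) (hΓ : Γ ≤ A) {φ' : G → ℂ}
    (e : ∀ a ∈ A, φ' a = φ a) : IsAutomorphic A Γ φ' :=
  ⟨h.cont.congr e, fun γ hγ a ha => by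
    rw [e a ha, e _ (A.mul_mem (hΓ hγ) ha), h.inv γ hγ a ha]⟩

theorem IsAutomorphic.sup (h : IsAutomorphic A Γ φ) (h' : IsAutomorphic A Γ' φ) (hΓ : Γ ≤ A)
    (hΓ' : Γ' ≤ A) : IsAutomorphic A (Γ ⊔ Γ') φ := by
  refine ⟨h.cont, fun γ hγ => ?_⟩
  have hle : Γ ⊔ Γ' ≤ A := sup_le hΓ hΓ'
  let P : Subgroup G :=
    { carrier := {x | x ∈ A ∧ ∀ a ∈ A, φ (x * a) = φ a}
      one_mem' := ⟨A.one_mem, by simp⟩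
      mul_mem' := by
        rintro x y ⟨hx, hx'⟩ ⟨hy, hy'⟩
        exact ⟨A.mul_mem hx hy, fun a ha => by
          rw [mul_assoc, hx' _ (A.mul_mem hy ha), hy' a ha]⟩
      inv_mem' := by
        rintro x ⟨hx, hx'⟩
        refine ⟨A.inv_mem hx, fun a ha => ?_⟩
        rw [← hx' _ (A.mul_mem (A.inv_mem hx) ha), mul_inv_cancel_left] }
  have hP : Γ ⊔ Γ' ≤ P := sup_le (fun x hx => ⟨hΓ hx, h.inv x hx⟩) fun x hx => ⟨hΓ' hx, h'.inv x hx⟩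
  exact (hP hγ).2

variable [IsTopologicalGroup G]

theorem IsAutomorphic.fibre (hφ : IsAutomorphic A Γ φ) (hC : C ≤ A) (hΓ : ΓC ≤ Γ) {a : G}
    (ha : a ∈ A) : IsAutomorphic C ΓC (fun c => φ (c * a)) :=
  ⟨hφ.cont.comp (continuous_mul_const a).continuousOn fun c hc => A.mul_mem (hC hc) ha,
    fun γ hγ c hc => by rw [mul_assoc, hφ.inv γ (hΓ hγ) _ (A.mul_mem (hC hc) ha)]⟩

theorem IsAutomorphic.continuousOn_fibreMean (hφ : IsAutomorphic A Γ φ) (hC : C ≤ A) (hΓ : ΓC ≤ Γ)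
    (hK : IsCocompact A Γ) (hm : IsMean C ΓC mC) : ContinuousOn (fibreMean mC φ) A := by
  intro a ha
  rw [ContinuousWithinAt, Metric.tendsto_nhds]
  intro ε hε
  obtain ⟨W, hW, h⟩ := hφ.uniform hK (half_pos hε)
  have hW' : {x | a⁻¹ * x ∈ W} ∈ 𝓝 a :=
    (continuous_const_mul a⁻¹).continuousAt.preimage_mem_nhds (by simpa using hW)
  filter_upwards [mem_nhdsWithin_of_mem_nhds hW', self_mem_nhdsWithin] with x hx hxA
  rw [dist_eq_norm]
  refine (hm.dist_le (hφ.fibre hC hΓ hxA) (hφ.fibre hC hΓ ha) fun c hc => ?_).trans_lt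
    (half_lt_self hε)
  have := h (c * a) (A.mul_mem (hC hc) ha) (a⁻¹ * x) hx (A.mul_mem (A.inv_mem ha) hxA)
  rwa [mul_assoc, mul_inv_cancel_left] at this

/-- Integration in stages: a mean for `ΓC\C` followed by a mean on `A`. -/
theorem IsMean.comp_fibreMean (hm₂ : IsMean A Γ' m₂) (hm : IsMean C ΓC mC) (hC : C ≤ A)
    (hΓ : ΓC ≤ Γ) (hΓ' : Γ' ≤ A)
    (H : ∀ φ, IsAutomorphic A Γ φ → IsAutomorphic A Γ' (fibreMean mC φ)) :
    IsMean A Γ (fun φ => m₂ (fibreMean mC φ)) where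
  add φ φ' h h' := by
    rw [← hm₂.add _ _ (H φ h) (H φ' h')]
    exact hm₂.congr (H _ (h.add h')) ((H φ h).add (H φ' h'))
      fun a ha => hm.add _ _ (h.fibre hC hΓ ha) (h'.fibre hC hΓ ha)
  smul c φ h := by
    rw [← hm₂.smul _ _ (H φ h)]
    exact hm₂.congr (H _ (h.const_mul c)) ((H φ h).const_mul c)
      fun a ha => hm.smul _ _ (h.fibre hC hΓ ha)
  one := by
    have : fibreMean mC (fun _ : G => (1 : ℂ)) = fun _ => 1 := funext fun _ => hm.one
    rw [this, hm₂.one]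
  bound φ w h h' hw := by
    have e : ∀ a ∈ A, (((fibreMean mC fun a => (w a : ℂ)) a).re : ℂ)
        = (fibreMean mC fun a => (w a : ℂ)) a := fun a ha =>
      (hm.im_eq_zero (w := fun c => w (c * a)) (h'.fibre hC hΓ ha)
        fun c hc => (norm_nonneg _).trans (hw _ (A.mul_mem (hC hc) ha))).symm
    have h1 := (H _ h').congr hΓ' e
    rw [← hm₂.congr h1 (H _ h') e]
    exact hm₂.bound _ _ (H φ h) h1 fun a ha => hm.bound _ (fun c => w (c * a)) (h.fibre hC hΓ ha)
      (h'.fibre hC hΓ ha) fun c hc => hw _ (A.mul_mem (hC hc) ha)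
  right_inv φ h x hx := by
    rw [← hm₂.right_inv _ (H φ h) x hx]
    unfold fibreMean
    simp only [mul_assoc]

/-- Ascent along a central extension: if `Z` commutes with `A` modulo `L`, then averages over the
compact group `(L ∩ Z)\Z` turn functions on `L\A` into functions on `LZ\A`. -/
theorem IsErgodicMean.of_central {L Z : Subgroup G} (hL : L ≤ A) (hZ : Z ≤ A)
    (hcomm : ∀ a ∈ A, ∀ z ∈ Z, a * z * a⁻¹ * z⁻¹ ∈ L) (hKZ : IsCocompact Z (L ⊓ Z))
    (hK : IsCocompact A L) (hm₂ : IsErgodicMean A (L ⊔ Z) m₂) : ∃ m, IsErgodicMean A L m := by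
  obtain ⟨μ, hμ, -⟩ := exists_isErgodicMean_quotient (A := Z) (N := L ⊓ Z) (fun a ha b hb =>
    ⟨hcomm a (hZ ha) b hb, Z.mul_mem (Z.mul_mem (Z.mul_mem ha hb) (Z.inv_mem ha)) (Z.inv_mem hb)⟩)
    hKZ
  have hle : L ⊔ Z ≤ A := sup_le hL hZ
  have hLZ : L ⊓ Z ≤ L := inf_le_left
  have hswap : ∀ φ, IsAutomorphic A L φ → ∀ a ∈ A, ∀ z ∈ Z, φ (a * z) = φ (z * a) := by
    intro φ hφ a ha z hz
    rw [← hφ.inv _ (hcomm a ha z hz) _ (A.mul_mem (hZ hz) ha)]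
    congr 1; group
  have H : ∀ φ, IsAutomorphic A L φ → IsAutomorphic A (L ⊔ Z) (fibreMean μ φ) := by
    intro φ hφ
    have hc := hφ.continuousOn_fibreMean hZ hLZ hK hμ.toIsMean
    refine IsAutomorphic.sup ⟨hc, fun l hl a ha => ?_⟩ ⟨hc, fun z hz a ha => ?_⟩ hL hZ
    · refine hμ.congr (hφ.fibre hZ hLZ (A.mul_mem (hL hl) ha)) (hφ.fibre hZ hLZ ha) fun z hz => ?_
      rw [← hswap φ hφ _ (A.mul_mem (hL hl) ha) z hz, ← hswap φ hφ a ha z hz, mul_assoc,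
        hφ.inv l hl _ (A.mul_mem ha (hZ hz))]
    · simp only [fibreMean, ← mul_assoc]
      exact hμ.right_inv _ (hφ.fibre hZ hLZ ha) z hz
  have hm := hm₂.toIsMean.comp_fibreMean hμ.toIsMean hZ hLZ hle H
  refine ⟨_, hm, fun φ hφ ε hε => ?_⟩
  have hε3 : 0 < ε / 2 / 3 := by positivity
  obtain ⟨Q₂, hQ₂, h₂⟩ := hm₂.approx _ (H φ hφ) (ε / 2) (half_pos hε)
  -- One average over `Z` serves for all fibres, since `φ (a z) = φ (z a)`.
  obtain ⟨Q₁, hQ₁, h₁⟩ : ∃ Q₁, AvgOp (Z : Set G) Q₁ ∧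
      ∀ a ∈ A, ‖Q₁ φ a - fibreMean μ φ a‖ ≤ ε / 2 := by
    obtain ⟨W, hW, hu⟩ := hφ.uniform hK hε3
    obtain ⟨K, hKc, hKA, hK'⟩ := hK
    obtain ⟨t, htK, ht⟩ := hKc.elim_nhds_subcover (fun k => {x | k⁻¹ * x ∈ W}) fun k _ =>
      (continuous_const_mul k⁻¹).continuousAt.preimage_mem_nhds (by simpa using hW)
    have hfib : ∀ a ∈ A, IsAutomorphic Z (L ⊓ Z) (fun z => φ (a * z)) := fun a ha =>
      (hφ.fibre hZ hLZ ha).congr inf_le_right (hswap φ hφ a ha)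
    have hfib' : ∀ a ∈ A, μ (fun z => φ (a * z)) = fibreMean μ φ a := fun a ha =>
      hμ.congr (hfib a ha) (hφ.fibre hZ hLZ ha) (hswap φ hφ a ha)
    obtain ⟨Q, hQ, h⟩ := hμ.approx_finset t (fun k z => φ (k * z))
      (fun k hk => hfib k (hKA (htK k hk))) hε3
    refine ⟨Q, hQ, fun a ha => ?_⟩
    obtain ⟨l, hl, k, hk, rfl⟩ := hK' a ha
    obtain ⟨k₀, hk₀t, hk₀⟩ := Set.mem_iUnion₂.1 (ht hk)
    have hkA := hKA hk
    have hk₀A := hKA (htK _ hk₀t)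
    have hd : ∀ z ∈ Z, ‖φ (k * z) - φ (k₀ * z)‖ ≤ ε / 2 / 3 := fun z hz => by
      have := hu (z * k₀) (A.mul_mem (hZ hz) hk₀A) (k₀⁻¹ * k) hk₀ (A.mul_mem (A.inv_mem hk₀A) hkA)
      rwa [mul_assoc, mul_inv_cancel_left, ← hswap φ hφ k hkA z hz,
        ← hswap φ hφ k₀ hk₀A z hz] at this
    have e1 : Q φ (l * k) = Q (fun z => φ (k * z)) 1 := by
      rw [hQ.left_translate φ k]
      simpa using (hQ.isAutomorphic hZ hφ).inv l hl k hkA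
    have e2 : fibreMean μ φ (l * k) = μ fun z => φ (k * z) := by
      rw [hfib' k hkA]
      exact (H φ hφ).inv l (Subgroup.mem_sup_left hl) k hkA
    have d1 := hQ.dist_le (fun b hb s hs => Z.mul_mem hb hs) hd 1 Z.one_mem
    have d2 := h k₀ hk₀t 1 Z.one_mem
    have d3 := hμ.dist_le (hfib k hkA) (hfib k₀ hk₀A) hd
    rw [e1, e2]
    calc _ = ‖(Q (fun z => φ (k * z)) 1 - Q (fun z => φ (k₀ * z)) 1)
          + (Q (fun z => φ (k₀ * z)) 1 - μ fun z => φ (k₀ * z))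
          - ((μ fun z => φ (k * z)) - μ fun z => φ (k₀ * z))‖ := by congr 1; ring
      _ ≤ ε / 2 / 3 + ε / 2 / 3 + ε / 2 / 3 :=
        (norm_sub_le _ _).trans (add_le_add ((norm_add_le _ _).trans (add_le_add d1 d2)) d3)
      _ = ε / 2 := by ring
  refine ⟨_, .comp Q₂ Q₁ hQ₂ (hQ₁.mono hZ), fun a ha => ?_⟩
  have h3 := hQ₂.dist_le (fun b hb s hs => A.mul_mem hb hs) h₁ a ha
  calc _ = ‖(Q₂ (Q₁ φ) a - Q₂ (fibreMean μ φ) a) + (Q₂ (fibreMean μ φ) a - m₂ (fibreMean μ φ))‖ := by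
        rw [sub_add_sub_cancel]
    _ ≤ ε / 2 + ε / 2 := (norm_add_le _ _).trans (add_le_add h3 (h₂ a ha))
    _ = ε := add_halves ε

end Fibre

/-! ### Means and abelian extensions -/

section Extension

variable {G : Type*} [Group G] [TopologicalSpace G] {A C Γ : Subgroup G}
  {m mC : (G → ℂ) → ℂ} {φ : G → ℂ}

/-- `C ≤ A` is a subgroup containing the commutators of `A`, and `Γ\A` is compact. -/
structure IsAbelianExtension (A C Γ : Subgroup G) : Prop where
  le : C ≤ A
  le' : Γ ≤ A
  comm : ∀ a ∈ A, ∀ b ∈ A, a * b * a⁻¹ * b⁻¹ ∈ C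
  cocompact : IsCocompact A Γ

/-- The continuous unitary characters of `A/N` separate points. -/
def IsSeparated (A N : Subgroup G) : Prop :=
  ∀ a ∈ A, a ∉ N → ∃ ξ : G → Circle, IsAutomorphic A N (fun a => (ξ a : ℂ)) ∧
    (∀ a ∈ A, ∀ b ∈ A, ξ (a * b) = ξ a * ξ b) ∧ ξ a ≠ 1

namespace IsAbelianExtension

theorem conj_mem (h : IsAbelianExtension A C Γ) {a c : G} (ha : a ∈ A) (hc : c ∈ C) :
    a * c * a⁻¹ ∈ C := by
  have := C.mul_mem (h.comm a ha c (h.le hc)) hc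
  simpa using this

theorem conj_mem' (h : IsAbelianExtension A C Γ) {a c : G} (ha : a ∈ A) (hc : c ∈ C) :
    a⁻¹ * c * a ∈ C := by
  simpa using h.conj_mem (A.inv_mem ha) hc

theorem sup_le (h : IsAbelianExtension A C Γ) : Γ ⊔ C ≤ A := _root_.sup_le h.le' h.le

theorem comm_sup (h : IsAbelianExtension A C Γ) :
    ∀ a ∈ A, ∀ b ∈ A, a * b * a⁻¹ * b⁻¹ ∈ Γ ⊔ C :=
  fun a ha b hb => Subgroup.mem_sup_right (h.comm a ha b hb)

theorem cocompact_sup (h : IsAbelianExtension A C Γ) : IsCocompact A (Γ ⊔ C) := by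
  obtain ⟨K, hKc, hKA, hK⟩ := h.cocompact
  refine ⟨K, hKc, hKA, fun a ha => ?_⟩
  obtain ⟨γ, hγ, k, hk, e⟩ := hK a ha
  exact ⟨γ, Subgroup.mem_sup_left hγ, k, hk, e⟩

theorem t2Space_quotient (h : IsAbelianExtension A C Γ) (hs : IsSeparated A (Γ ⊔ C)) :
    T2Space (A ⧸ (Γ ⊔ C).subgroupOf A) := by
  have hN := normal_of_commutator h.comm_sup
  refine ⟨fun s t hst => ?_⟩
  obtain ⟨a, rfl⟩ := QuotientGroup.mk_surjective s
  obtain ⟨b, rfl⟩ := QuotientGroup.mk_surjective t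
  rw [ne_eq, QuotientGroup.eq] at hst
  obtain ⟨ξ, hξ, hmul, hne⟩ := hs _ (a⁻¹ * b : A).2 hst
  refine separated_by_continuous (continuous_quotFun hN hξ) ?_
  rw [quotFun_mk hN hξ, quotFun_mk hN hξ]
  intro e
  refine hne ?_
  have e' : ξ a = ξ b := Circle.ext e
  have := hmul a a.2 _ (a⁻¹ * b : A).2
  push_cast at this
  rw [mul_inv_cancel_left, ← e'] at this
  simpa using this.symm

variable [IsTopologicalGroup G]

/-- Integration along the fibres of `Γ\A → ΓC\A` gives functions on `ΓC\A`, because the mean on `C`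
is the only one and hence is invariant under conjugation by `Γ`. -/
theorem isAutomorphic_fibreMean (h : IsAbelianExtension A C Γ) (hmC : IsErgodicMean C (Γ ⊓ C) mC)
    (hφ : IsAutomorphic A Γ φ) : IsAutomorphic A (Γ ⊔ C) (fibreMean mC φ) := by
  have hc := hφ.continuousOn_fibreMean h.le inf_le_left h.cocompact hmC.toIsMean
  refine IsAutomorphic.sup ⟨hc, fun γ hγ a ha => ?_⟩ ⟨hc, fun c hc a ha => ?_⟩ h.le' h.le
  · have hγA := h.le' hγ
    rw [fibreMean, fibreMean, ← hmC.conj_eq (s := γ) (fun c hc => h.conj_mem hγA hc)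
      (fun c hc => h.conj_mem' hγA hc) (fun c hc => ⟨Γ.mul_mem (Γ.mul_mem hγ hc.1) (Γ.inv_mem hγ),
        h.conj_mem hγA hc.2⟩) (hφ.fibre h.le inf_le_left (A.mul_mem hγA ha))]
    have e : ∀ c ∈ C, φ (γ * c * γ⁻¹ * (γ * a)) = φ (c * a) := fun c hc => by
      rw [← hφ.inv γ hγ _ (A.mul_mem (h.le hc) ha)]
      congr 1; group
    have h1 := hφ.fibre h.le (inf_le_left : Γ ⊓ C ≤ Γ) ha
    exact hmC.congr (h1.congr inf_le_right e) h1 e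
  · simp only [fibreMean, ← mul_assoc]
    exact hmC.right_inv _ (hφ.fibre h.le inf_le_left ha) c hc

/-- A mean on `Γ\A` exists as soon as there is an ergodic one on the fibres. -/
theorem exists_isMean (h : IsAbelianExtension A C Γ) (hmC : IsErgodicMean C (Γ ⊓ C) mC) :
    ∃ m, IsMean A Γ m := by
  obtain ⟨μ, hμ, -⟩ := exists_isErgodicMean_quotient h.comm_sup h.cocompact_sup
  exact ⟨_, hμ.toIsMean.comp_fibreMean hmC.toIsMean h.le inf_le_left h.sup_le
    fun φ hφ => h.isAutomorphic_fibreMean hmC hφ⟩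

/-- Near every coset `C a₀`, a suitable average of `φ` over `C` is close to the integral of `φ`
along the fibres. -/
theorem exists_nhds_local (h : IsAbelianExtension A C Γ) (hm : IsMean A Γ m)
    (hmC : IsErgodicMean C (Γ ⊓ C) mC) (hφ : IsAutomorphic A Γ φ) {ε : ℝ} (hε : 0 < ε) {a₀ : G}
    (ha₀ : a₀ ∈ A) : ∃ W ∈ 𝓝 (1 : G), ∀ w : G → ℝ, IsAutomorphic A (Γ ⊔ C) (fun a => (w a : ℂ)) →
      (∀ a ∈ A, 0 ≤ w a) →
      (∀ a ∈ A, w a ≠ 0 → ∃ n ∈ Γ ⊔ C, ∃ v ∈ W, v ∈ A ∧ a = n * (a₀ * v)) →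
      ‖m (fun a => φ a * w a) - m (fun a => fibreMean mC φ a * w a)‖
        ≤ 3 * ε * (m fun a => (w a : ℂ)).re := by
  obtain ⟨Q₀, hQ₀, h₀⟩ := hmC.approx _ (hφ.fibre h.le inf_le_left ha₀) ε hε
  obtain ⟨Q, hQ, hQQ₀⟩ := hQ₀.conj (a := a₀) fun s hs => h.conj_mem' ha₀ hs
  have hCA : (C : Set G) ⊆ A := h.le
  have hΦ := h.isAutomorphic_fibreMean hmC hφ
  have hΓs : Γ ≤ Γ ⊔ C := le_sup_left
  have hψ := hQ.isAutomorphic hCA hφ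
  obtain ⟨W₁, hW₁, h₁⟩ := hψ.uniform h.cocompact hε
  obtain ⟨W₂, hW₂, h₂⟩ := hΦ.uniform h.cocompact_sup hε
  refine ⟨W₁ ∩ W₂, Filter.inter_mem hW₁ hW₂, fun w hw hw0 hsupp => ?_⟩
  have hwΓ := hw.mono hΓs
  have hΦΓ := hΦ.mono hΓs
  have hclose : ∀ a ∈ A, w a ≠ 0 → ‖Q φ a - fibreMean mC φ a‖ ≤ 3 * ε := by
    intro a ha hwa
    obtain ⟨n, hn, v, ⟨hv₁, hv₂⟩, hvA, rfl⟩ := hsupp a ha hwa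
    obtain ⟨γ, hγ, c, hc, rfl⟩ := (mem_sup_iff_exists_mul fun γ hγ c hc =>
      h.conj_mem (h.le' hγ) hc).1 hn
    have hca₀ := A.mul_mem (h.le hc) ha₀
    have e1 : Q φ (γ * c * (a₀ * v)) = Q φ (c * a₀ * v) := by
      rw [← hψ.inv γ hγ _ (A.mul_mem hca₀ hvA)]
      congr 1; group
    have d1 := h₁ (c * a₀) hca₀ v hv₁ hvA
    have d2 : ‖Q φ (c * a₀) - fibreMean mC φ a₀‖ ≤ ε := by
      have := h₀ c hc
      rwa [← hQQ₀] at this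
    have d3 := h₂ a₀ ha₀ v hv₂ hvA
    rw [e1, hΦ.inv _ hn _ (A.mul_mem ha₀ hvA)]
    calc _ = ‖(Q φ (c * a₀ * v) - Q φ (c * a₀)) + (Q φ (c * a₀) - fibreMean mC φ a₀)
          - (fibreMean mC φ (a₀ * v) - fibreMean mC φ a₀)‖ := by congr 1; ring
      _ ≤ ε + ε + ε :=
        (norm_sub_le _ _).trans (add_le_add ((norm_add_le _ _).trans (add_le_add d1 d2)) d3)
      _ = 3 * ε := by ring
  have e2 : m (fun a => φ a * w a) = m (fun a => Q φ a * w a) := by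
    rw [← hm.avg hCA hQ (hφ.mul hwΓ)]
    refine hm.congr (hQ.isAutomorphic hCA (hφ.mul hwΓ)) (hψ.mul hwΓ) ?_
    refine hQ.mul_of_inv (fun b hb s hs => A.mul_mem hb (h.le hs)) (fun b hb s hs => ?_)
      fun b hb => rfl
    rw [← hw.inv _ (Subgroup.mem_sup_right (h.conj_mem hb hs)) b hb]
    simp
  rw [e2, ← hm.sub (hψ.mul hwΓ) (hΦΓ.mul hwΓ)]
  have h3 : IsAutomorphic A Γ (fun a => ((3 * ε * w a : ℝ) : ℂ)) := by
    simpa using hwΓ.const_mul (3 * ε : ℂ)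
  have h4 : (m fun a => ((3 * ε * w a : ℝ) : ℂ)).re = 3 * ε * (m fun a => (w a : ℂ)).re := by
    have h5 := hm.smul ((3 * ε : ℝ) : ℂ) _ hwΓ
    have h6 : (fun a => ((3 * ε * w a : ℝ) : ℂ)) = fun a => ((3 * ε : ℝ) : ℂ) * (w a : ℂ) := by
      funext a; push_cast; rfl
    rw [h6, h5, Complex.re_ofReal_mul]
  rw [← h4]
  refine hm.bound _ _ ((hψ.mul hwΓ).sub (hΦΓ.mul hwΓ)) h3 fun a ha => ?_
  rw [← sub_mul, norm_mul, Complex.norm_real, Real.norm_of_nonneg (hw0 a ha)]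
  by_cases hwa : w a = 0
  · simp [hwa]
  · exact mul_le_mul_of_nonneg_right (hclose a ha hwa) (hw0 a ha)

/-- Fubini's theorem for an arbitrary mean on `Γ\A`: it is determined by its restriction to the
functions on `ΓC\A`. A partition of unity on the compact space `A/ΓC` reduces this to the local
estimate `exists_nhds_local`. -/
theorem mean_eq_mean_fibreMean (h : IsAbelianExtension A C Γ) (hs : IsSeparated A (Γ ⊔ C))
    (hm : IsMean A Γ m) (hmC : IsErgodicMean C (Γ ⊓ C) mC) (hφ : IsAutomorphic A Γ φ) :
    m φ = m (fibreMean mC φ) := by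
  have hN := normal_of_commutator h.comm_sup
  have hT2 := h.t2Space_quotient hs
  have hcpt := compactSpace_quotient hN h.cocompact_sup
  have hΓs : Γ ≤ Γ ⊔ C := le_sup_left
  have hΦ := (h.isAutomorphic_fibreMean hmC hφ).mono hΓs
  refine sub_eq_zero.1 (norm_le_zero_iff.1 (le_of_forall_pos_le_add fun δ hδ => ?_))
  have hε : 0 < δ / 3 := by positivity
  choose! W hW hloc using fun a₀ (ha₀ : a₀ ∈ A) => h.exists_nhds_local hm hmC hφ hε ha₀
  let O : A → Set (A ⧸ (Γ ⊔ C).subgroupOf A) := fun a =>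
    QuotientGroup.mk '' {x : A | (a : G)⁻¹ * x ∈ interior (W a)}
  have hOo : ∀ a, IsOpen (O a) := fun a =>
    QuotientGroup.isOpenMap_coe _ (isOpen_interior.preimage (by fun_prop))
  have hOc : (Set.univ : Set (A ⧸ (Γ ⊔ C).subgroupOf A)) ⊆ ⋃ a, O a := fun t _ => by
    obtain ⟨a, rfl⟩ := QuotientGroup.mk_surjective t
    exact Set.mem_iUnion.2 ⟨a, a, by simpa using mem_interior_iff_mem_nhds.2 (hW a a.2), rfl⟩
  obtain ⟨s, hs⟩ := isCompact_univ.elim_finite_subcover O hOo hOc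
  let p : Fin s.card → A := fun i => s.equivFin.symm i
  have hp : (Set.univ : Set (A ⧸ (Γ ⊔ C).subgroupOf A)) ⊆ ⋃ i, O (p i) := fun t ht => by
    obtain ⟨a, ha, hta⟩ := Set.mem_iUnion₂.1 (hs ht)
    exact Set.mem_iUnion.2 ⟨s.equivFin ⟨a, ha⟩, by simpa [p] using hta⟩
  obtain ⟨f, hf, hf1, hf0, -⟩ := exists_continuous_sum_one_of_isOpen_isCompact
    (fun i => hOo (p i)) isCompact_univ hp
  let w : Fin s.card → G → ℝ := fun i => liftFun A (Γ ⊔ C) (f i)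
  have hw : ∀ i, IsAutomorphic A (Γ ⊔ C) (fun a => (w i a : ℂ)) := fun i =>
    (isAutomorphic_liftFun h.sup_le hN (F := fun t => (f i t : ℂ)) (by fun_prop)).congr h.sup_le
      fun a ha => by rw [liftFun_apply _ ha, ← liftFun_apply (f i) ha]
  have hwΓ := fun i => (hw i).mono hΓs
  have hw0 : ∀ i, ∀ a ∈ A, 0 ≤ w i a := fun i a ha => by
    simp only [w, liftFun_apply _ ha]
    exact (hf0 i _).1
  have hw1 : ∀ a ∈ A, ∑ i, (w i a : ℂ) = 1 := fun a ha => by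
    have h1 := hf1 (Set.mem_univ (QuotientGroup.mk ⟨a, ha⟩))
    simp only [Finset.sum_apply, Pi.one_apply] at h1
    simp only [w, liftFun_apply _ ha]
    exact_mod_cast h1
  have hbound : ∀ i, ‖m (fun a => φ a * w i a) - m (fun a => fibreMean mC φ a * w i a)‖
      ≤ δ * (m fun a => (w i a : ℂ)).re := by
    intro i
    have h2 : δ = 3 * (δ / 3) := by ring
    rw [h2]
    refine hloc (p i) (p i).2 (w i) (hw i) (hw0 i) fun a ha hwa => ?_
    have hwa' : f i (QuotientGroup.mk ⟨a, ha⟩) ≠ 0 := by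
      simpa only [w, liftFun_apply _ ha] using hwa
    obtain ⟨x, hx, hxa⟩ := hf i (subset_tsupport _ hwa')
    rw [QuotientGroup.eq] at hxa
    refine ⟨_, hN.conj_mem _ hxa x, (p i : G)⁻¹ * x, interior_subset hx,
      A.mul_mem (A.inv_mem (p i).2) x.2, ?_⟩
    simp
  have hsum : ∀ η, IsAutomorphic A Γ η → m η = ∑ i, m (fun a => η a * w i a) := fun η hη => by
    have h1 := hm.sum fun i => hη.mul (hwΓ i)
    rw [← h1.2]
    refine hm.congr hη h1.1 fun a ha => ?_
    rw [← Finset.mul_sum, hw1 a ha, mul_one]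
  have hone : ∑ i, (m fun a => (w i a : ℂ)).re = 1 := by
    have h1 := hsum _ (IsAutomorphic.const 1)
    rw [hm.one] at h1
    have h2 := congrArg Complex.re h1
    simpa using h2.symm
  rw [hsum φ hφ, hsum _ hΦ, ← Finset.sum_sub_distrib]
  calc _ ≤ ∑ i, δ * (m fun a => (w i a : ℂ)).re := norm_sum_le_of_le _ fun i _ => hbound i
    _ = 0 + δ := by rw [← Finset.mul_sum, hone, mul_one, zero_add]

end IsAbelianExtension

end Extension

/-! ### Exchange of roots -/

section Exchange

variable {G : Type*} [Group G] {A C Γ S : Subgroup G}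
  {m mC : (G → ℂ) → ℂ} {ψ : G → Circle} {f : G → ℂ}

/-- The group `S` acts by conjugation on `A`, `C`, `Γ`, trivially on `A/C`, and fixes the
restriction to `C` of the character `ψ` of `A`. -/
structure IsExchanging (A C Γ S : Subgroup G) (ψ : G → Circle) : Prop where
  conj_A : ∀ x ∈ S, ∀ a ∈ A, x * a * x⁻¹ * a⁻¹ ∈ C
  conj_C : ∀ x ∈ S, ∀ c ∈ C, x * c * x⁻¹ ∈ C
  conj_Γ : ∀ x ∈ S, ∀ γ ∈ Γ, x * γ * x⁻¹ ∈ Γ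
  char : ∀ x ∈ S, ∀ c ∈ C, ψ (x * c * x⁻¹) = ψ c

/-- The integrand of the Fourier coefficient at `g`. -/
def twist (f : G → ℂ) (ψ : G → Circle) (g : G) : G → ℂ := fun u => f (u * g) * ((ψ u)⁻¹ : Circle)

/-- The character `a ↦ ψ([x, a])` of `A`. -/
def commChar (ψ : G → Circle) (x : G) : G → Circle := fun a => ψ (x * a * x⁻¹) * (ψ a)⁻¹

theorem IsExchanging.mem (hS : IsExchanging A C Γ S ψ) (hC : C ≤ A) {x a : G} (hx : x ∈ S)
    (ha : a ∈ A) : x * a * x⁻¹ ∈ A := by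
  have := A.mul_mem (hC (hS.conj_A x hx a ha)) ha
  simpa using this

theorem commChar_of_mem (hS : IsExchanging A C Γ S ψ) {x c : G} (hx : x ∈ S) (hc : c ∈ C) :
    commChar ψ x c = 1 := by
  rw [commChar, hS.char x hx c hc, mul_inv_cancel]

variable [TopologicalSpace G]

/-- `ψ` is a continuous unitary character of `A` that is trivial on `Γ`. -/
structure IsCharOn (A Γ : Subgroup G) (ψ : G → Circle) : Prop where
  cont : ContinuousOn ψ A
  mul : ∀ a ∈ A, ∀ b ∈ A, ψ (a * b) = ψ a * ψ b
  triv : ∀ γ ∈ Γ, ψ γ = 1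

theorem IsCharOn.one (hψ : IsCharOn A Γ ψ) : ψ 1 = 1 := hψ.triv 1 Γ.one_mem

theorem IsCharOn.mono {Γ' : Subgroup G} (hψ : IsCharOn A Γ ψ) (hC : C ≤ A) (hΓ : Γ' ≤ Γ) :
    IsCharOn C Γ' ψ :=
  ⟨hψ.cont.mono hC, fun a ha b hb => hψ.mul a (hC ha) b (hC hb), fun γ hγ => hψ.triv γ (hΓ hγ)⟩

theorem commChar_mul_right (hA : IsAbelianExtension A C Γ) (hψ : IsCharOn A Γ ψ)
    (hS : IsExchanging A C Γ S ψ) {x a b : G} (hx : x ∈ S) (ha : a ∈ A) (hb : b ∈ A) :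
    commChar ψ x (a * b) = commChar ψ x a * commChar ψ x b := by
  have e : x * (a * b) * x⁻¹ = (x * a * x⁻¹) * (x * b * x⁻¹) := by group
  rw [commChar, e, hψ.mul _ (hS.mem hA.le hx ha) _ (hS.mem hA.le hx hb), hψ.mul a ha b hb,
    mul_inv, mul_mul_mul_comm]
  rfl

theorem commChar_mul_left (hA : IsAbelianExtension A C Γ) (hψ : IsCharOn A Γ ψ)
    (hS : IsExchanging A C Γ S ψ) {x y a : G} (hx : x ∈ S) (hy : y ∈ S) (ha : a ∈ A) :
    commChar ψ (x * y) a = commChar ψ x a * commChar ψ y a := by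
  have hc := hS.conj_A y hy a ha
  have e : y * a * y⁻¹ = (y * a * y⁻¹ * a⁻¹) * a := by group
  have h1 : commChar ψ x (y * a * y⁻¹) = commChar ψ x a := by
    rw [e, commChar_mul_right hA hψ hS hx (hA.le hc) ha, commChar_of_mem hS hx hc, one_mul]
  rw [← h1, commChar, commChar, commChar, mul_assoc (ψ _), inv_mul_cancel_left]
  congr 2; group

theorem commChar_inv (hA : IsAbelianExtension A C Γ) (hψ : IsCharOn A Γ ψ)
    (hS : IsExchanging A C Γ S ψ) {x a : G} (hx : x ∈ S) (ha : a ∈ A) :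
    commChar ψ x⁻¹ a = (commChar ψ x a)⁻¹ := by
  have := commChar_mul_left hA hψ hS (S.inv_mem hx) hx ha
  rw [inv_mul_cancel, commChar, one_mul, inv_one, mul_one, mul_inv_cancel] at this
  exact eq_inv_of_mul_eq_one_left this.symm

variable [IsTopologicalGroup G]

theorem IsCharOn.isAutomorphic_twist (hψ : IsCharOn A Γ ψ) (hΓ : Γ ≤ A) (hf : Continuous f)
    (hfΓ : ∀ γ ∈ Γ, ∀ g, f (γ * g) = f g) (g : G) : IsAutomorphic A Γ (twist f ψ g) := by
  refine ⟨(hf.comp (continuous_mul_const g)).continuousOn.mul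
    (continuous_induced_dom.comp_continuousOn hψ.cont.inv), fun γ hγ a ha => ?_⟩
  rw [twist, twist, hψ.mul γ (hΓ hγ) a ha, hψ.triv γ hγ, one_mul, mul_assoc, hfΓ γ hγ]

theorem isAutomorphic_commChar (hA : IsAbelianExtension A C Γ) (hψ : IsCharOn A Γ ψ)
    (hS : IsExchanging A C Γ S ψ) {x : G} (hx : x ∈ S) :
    IsAutomorphic A (Γ ⊔ C) (fun a => (commChar ψ x a : ℂ)) := by
  have hc : ContinuousOn (fun a => (commChar ψ x a : ℂ)) A :=
    continuous_induced_dom.comp_continuousOn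
      ((hψ.cont.comp (by fun_prop) fun a ha => hS.mem hA.le hx ha).mul hψ.cont.inv)
  have key : ∀ b ∈ A, commChar ψ x b = 1 → ∀ a ∈ A,
      (commChar ψ x (b * a) : ℂ) = commChar ψ x a := fun b hb h a ha => by
    rw [commChar_mul_right hA hψ hS hx hb ha, h, one_mul]
  refine IsAutomorphic.sup ⟨hc, fun γ hγ => key γ (hA.le' hγ) ?_⟩
    ⟨hc, fun c hc => key c (hA.le hc) (commChar_of_mem hS hx hc)⟩ hA.le' hA.le
  rw [commChar, hψ.triv γ hγ, hψ.triv _ (hS.conj_Γ x hx γ hγ), mul_inv_cancel]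

theorem isSeparated_of_commChar (hA : IsAbelianExtension A C Γ) (hψ : IsCharOn A Γ ψ)
    (hS : IsExchanging A C Γ S ψ)
    (hsep : ∀ a ∈ A, (∀ x ∈ S, commChar ψ x a = 1) → a ∈ Γ ⊔ C) : IsSeparated A (Γ ⊔ C) := by
  intro a ha haN
  by_contra hcon
  refine haN (hsep a ha fun x hx => ?_)
  by_contra hne
  exact hcon ⟨_, isAutomorphic_commChar hA hψ hS hx,
    fun a ha b hb => commChar_mul_right hA hψ hS hx ha hb, hne⟩

/-- A function on the compact group `A/ΓC` that is orthogonal to all characters `ψ([x, ·])` is zero,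
because the linear combinations of these characters are dense. -/
theorem eq_zero_of_mean_commChar_mul_eq_zero (hA : IsAbelianExtension A C Γ) (hψ : IsCharOn A Γ ψ)
    (hS : IsExchanging A C Γ S ψ)
    (hsep : ∀ a ∈ A, (∀ x ∈ S, commChar ψ x a = 1) → a ∈ Γ ⊔ C) (hm : IsMean A (Γ ⊔ C) m)
    {Φ : G → ℂ} (hΦ : IsAutomorphic A (Γ ⊔ C) Φ)
    (h0 : ∀ x ∈ S, m (fun a => commChar ψ x a * Φ a) = 0) : ∀ a ∈ A, Φ a = 0 := by
  have hN := normal_of_commutator hA.comm_sup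
  have hcpt := compactSpace_quotient hN hA.cocompact_sup
  let T := A ⧸ (Γ ⊔ C).subgroupOf A
  let ξ : S → C(T, ℂ) := fun x => ⟨_, continuous_quotFun hN (isAutomorphic_commChar hA hψ hS x.2)⟩
  have hξ : ∀ (x : S) (a : A), ξ x (QuotientGroup.mk a) = commChar ψ x a := fun x a =>
    quotFun_mk hN (isAutomorphic_commChar hA hψ hS x.2) a
  have hξmul : ∀ x y : S, ξ (x * y) = ξ x * ξ y := fun x y => by
    ext t
    obtain ⟨a, rfl⟩ := QuotientGroup.mk_surjective t
    rw [ContinuousMap.mul_apply, hξ, hξ, hξ, Subgroup.coe_mul,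
      commChar_mul_left hA hψ hS x.2 y.2 a.2, Circle.coe_mul]
  have hξone : ξ 1 = 1 := by
    ext t
    obtain ⟨a, rfl⟩ := QuotientGroup.mk_surjective t
    rw [hξ, commChar]
    simp
  have hξstar : ∀ x : S, star (ξ x) = ξ x⁻¹ := fun x => by
    ext t
    obtain ⟨a, rfl⟩ := QuotientGroup.mk_surjective t
    rw [ContinuousMap.star_apply, hξ, hξ, Subgroup.coe_inv, commChar_inv hA hψ hS x.2 a.2,
      Circle.coe_inv_eq_conj]
    rfl
  let M : Submonoid C(T, ℂ) :=
    { carrier := Set.range ξ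
      one_mem' := ⟨1, hξone⟩
      mul_mem' := by
        rintro _ _ ⟨x, rfl⟩ ⟨y, rfl⟩
        exact ⟨x * y, hξmul x y⟩ }
  let 𝒜 : StarSubalgebra ℂ C(T, ℂ) :=
    { Algebra.adjoin ℂ (M : Set C(T, ℂ)) with
      star_mem' := by
        intro F hF
        induction hF using Algebra.adjoin_induction with
        | mem F hF =>
          obtain ⟨x, rfl⟩ := hF
          rw [hξstar]
          exact Algebra.subset_adjoin ⟨_, rfl⟩
        | algebraMap r =>
          rw [← algebraMap_star_comm]
          exact Subalgebra.algebraMap_mem _ _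
        | add F F' _ _ h h' => rw [star_add]; exact Subalgebra.add_mem _ h h'
        | mul F F' _ _ h h' => rw [star_mul]; exact Subalgebra.mul_mem _ h' h }
  have hsepA : 𝒜.SeparatesPoints := by
    intro s t hst
    obtain ⟨a, rfl⟩ := QuotientGroup.mk_surjective s
    obtain ⟨b, rfl⟩ := QuotientGroup.mk_surjective t
    rw [ne_eq, QuotientGroup.eq] at hst
    by_contra hcon
    refine hst (hsep _ (a⁻¹ * b : A).2 fun x hx => ?_)
    by_contra hne
    refine hcon ⟨_, ⟨ξ ⟨x, hx⟩, Algebra.subset_adjoin ⟨_, rfl⟩, rfl⟩, ?_⟩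
    beta_reduce
    rw [hξ, hξ]
    intro e
    refine hne ?_
    have e' : commChar ψ x a = commChar ψ x b := Circle.ext e
    have := commChar_mul_right hA hψ hS hx a.2 (a⁻¹ * b : A).2
    push_cast at this
    rw [mul_inv_cancel_left, ← e'] at this
    simpa using this.symm
  have hdense := ContinuousMap.starSubalgebra_topologicalClosure_eq_top_of_separatesPoints 𝒜 hsepA
  have hlift : ∀ F : C(T, ℂ), IsAutomorphic A (Γ ⊔ C) (liftFun A (Γ ⊔ C) F) := fun F =>
    isAutomorphic_liftFun hA.sup_le hN F.continuous
  have horth : ∀ F ∈ Submodule.span ℂ (M : Set C(T, ℂ)),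
      m (fun a => liftFun A (Γ ⊔ C) F a * Φ a) = 0 := by
    intro F hF
    induction hF using Submodule.span_induction with
    | mem F hF =>
      obtain ⟨x, rfl⟩ := hF
      rw [← h0 x x.2]
      refine hm.congr ((hlift _).mul hΦ) ((isAutomorphic_commChar hA hψ hS x.2).mul hΦ)
        fun a ha => ?_
      rw [liftFun_apply _ ha, hξ]
    | zero =>
      rw [hm.congr ((hlift _).mul hΦ) (IsAutomorphic.const 0) fun a ha => by
        rw [liftFun_apply _ ha]; simp, hm.const]
    | add F F' _ _ h h' =>
      rw [hm.congr ((hlift _).mul hΦ) (((hlift F).mul hΦ).add ((hlift F').mul hΦ)) fun a ha => by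
        rw [liftFun_apply _ ha, liftFun_apply _ ha, liftFun_apply _ ha, ContinuousMap.add_apply,
          add_mul], hm.add _ _ ((hlift F).mul hΦ) ((hlift F').mul hΦ), h, h', add_zero]
    | smul r F _ h =>
      rw [hm.congr ((hlift _).mul hΦ) (((hlift F).mul hΦ).const_mul r) fun a ha => by
        rw [liftFun_apply _ ha, liftFun_apply _ ha, ContinuousMap.smul_apply, smul_eq_mul,
          mul_assoc], hm.smul _ _ ((hlift F).mul hΦ), h, mul_zero]
  -- `conj Φ` is a uniform limit of combinations of characters, so that the mean of `|Φ|²` vanishes.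
  obtain ⟨B, hB⟩ := hΦ.bounded hA.cocompact_sup
  have hBpos : 0 < |B| + 1 := by positivity
  let F₀ : C(T, ℂ) := ⟨_, continuous_quotFun hN hΦ.conj⟩
  have hF₀ : ∀ a ∈ A, liftFun A (Γ ⊔ C) F₀ a = starRingEnd ℂ (Φ a) := fun a ha => by
    rw [liftFun_apply _ ha]
    exact quotFun_mk hN hΦ.conj ⟨a, ha⟩
  have hzero : m (fun a => liftFun A (Γ ⊔ C) F₀ a * Φ a) = 0 := by
    refine norm_le_zero_iff.1 (le_of_forall_pos_le_add fun ε hε => ?_)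
    have hF₀A : F₀ ∈ closure (𝒜 : Set C(T, ℂ)) := by
      have : F₀ ∈ 𝒜.topologicalClosure := hdense ▸ StarSubalgebra.mem_top
      exact this
    obtain ⟨F, hF, hd⟩ := Metric.mem_closure_iff.1 hF₀A (ε / (|B| + 1)) (by positivity)
    have hF' : F ∈ Submodule.span ℂ (M : Set C(T, ℂ)) := by
      have h1 : F ∈ Subalgebra.toSubmodule (Algebra.adjoin ℂ (M : Set C(T, ℂ))) := hF
      rwa [Algebra.adjoin_eq_span, Submonoid.closure_eq] at h1
    have := hm.dist_le ((hlift F₀).mul hΦ) ((hlift F).mul hΦ) (B := ε) fun a ha => by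
      rw [← sub_mul, norm_mul, liftFun_apply _ ha, liftFun_apply _ ha, ← dist_eq_norm]
      calc _ ≤ ε / (|B| + 1) * (|B| + 1) := by
            refine mul_le_mul ((ContinuousMap.dist_apply_le_dist _).trans hd.le)
              ((hB a ha).trans ((le_abs_self B).trans (by linarith))) (norm_nonneg _)
              (by positivity)
        _ = ε := by field_simp
    rwa [horth F hF', sub_zero, ← zero_add ε] at this
  obtain ⟨μ, hμ, hμpos⟩ := exists_isErgodicMean_quotient hA.comm_sup hA.cocompact_sup
  have hsq : IsAutomorphic A (Γ ⊔ C) (fun a => ((‖Φ a‖ ^ 2 : ℝ) : ℂ)) :=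
    (hΦ.norm.mul hΦ.norm).congr hA.sup_le fun a _ => by push_cast; ring
  have hsq0 : μ (fun a => ((‖Φ a‖ ^ 2 : ℝ) : ℂ)) = 0 := by
    rw [← hμ.unique hm hsq, ← hzero]
    refine hm.congr hsq ((hlift F₀).mul hΦ) fun a ha => ?_
    rw [hF₀ a ha, Complex.conj_mul']
    push_cast; rfl
  intro a ha
  have := hμpos _ hsq (fun a _ => by positivity) hsq0 a ha
  simpa using this

/-- **Root exchange.** The Fourier coefficients along `A` vanish if and only if those along `C` do.
Both the vanishing of all coefficients along `A` and that of the means on `C` are statements about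
the functions `a ↦ ∫_C f (c a g) ψ⁻¹ (c a) dc` on the compact abelian group `A/ΓC`; replacing `g` by
`x g` with `x ∈ S` multiplies such a function by the character `ψ([x⁻¹, a])`, and these characters
separate the points of `A/ΓC`. -/
theorem mean_twist_eq_zero_iff (hA : IsAbelianExtension A C Γ) (hψ : IsCharOn A Γ ψ)
    (hS : IsExchanging A C Γ S ψ)
    (hsep : ∀ a ∈ A, (∀ x ∈ S, commChar ψ x a = 1) → a ∈ Γ ⊔ C) (hm : IsMean A Γ m)
    (hmC : IsErgodicMean C (Γ ⊓ C) mC) (hf : Continuous f) (hfΓ : ∀ γ ∈ Γ, ∀ g, f (γ * g) = f g)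
    (hfS : ∀ x ∈ S, ∀ g, f (x * g) = f g) :
    (∀ g, m (twist f ψ g) = 0) ↔ ∀ g, mC (twist f ψ g) = 0 := by
  have hψC : IsCharOn C (Γ ⊓ C) ψ := hψ.mono hA.le inf_le_left
  have hfC : ∀ γ ∈ Γ ⊓ C, ∀ g, f (γ * g) = f g := fun γ hγ => hfΓ γ hγ.1
  have htA := hψ.isAutomorphic_twist hA.le' hf hfΓ
  have htC := hψC.isAutomorphic_twist inf_le_right hf hfC
  have hfib : ∀ g, ∀ a ∈ A, fibreMean mC (twist f ψ g) a
      = ((ψ a)⁻¹ : Circle) * mC (twist f ψ (a * g)) := fun g a ha => by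
    rw [← hmC.smul _ _ (htC _)]
    refine hmC.congr ((htA g).fibre hA.le inf_le_left ha) ((htC _).const_mul _) fun c hc => ?_
    rw [twist, twist, hψ.mul c (hA.le hc) a ha, mul_inv, Circle.coe_mul, mul_assoc c a g]
    ring
  have hequiv : ∀ c ∈ C, ∀ g, mC (twist f ψ (c * g)) = ψ c * mC (twist f ψ g) := fun c hc g => by
    rw [← hmC.right_inv _ (htC g) c hc, ← hmC.smul _ _ ((htC g).translate hc)]
    refine hmC.congr (htC _) (((htC g).translate hc).const_mul _) fun b hb => ?_
    rw [twist, twist, hψ.mul b (hA.le hb) c (hA.le hc), mul_inv, Circle.coe_mul, mul_assoc b c g,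
      Circle.coe_inv (ψ c)]
    have : (ψ c : ℂ) ≠ 0 := Circle.coe_ne_zero _
    field_simp
  have hinv : ∀ x ∈ S, ∀ g, mC (twist f ψ (x * g)) = mC (twist f ψ g) := fun x hx g => by
    have hx' := S.inv_mem hx
    rw [← hmC.conj_eq (s := x) (fun c hc => hS.conj_C x hx c hc)
      (fun c hc => by simpa using hS.conj_C x⁻¹ hx' c hc)
      (fun c hc => ⟨hS.conj_Γ x hx c hc.1, hS.conj_C x hx c hc.2⟩) (htC (x * g))]
    have e : ∀ c ∈ C, twist f ψ (x * g) (x * c * x⁻¹) = twist f ψ g c := fun c hc => by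
      rw [twist, twist, hS.char x hx c hc, ← hfS x hx (c * g)]
      congr 2; group
    exact hmC.congr ((htC g).congr inf_le_right e) (htC g) e
  have hmean := fun g => hA.mean_eq_mean_fibreMean (isSeparated_of_commChar hA hψ hS hsep) hm hmC
    (htA g)
  have hΦ := fun g => hA.isAutomorphic_fibreMean hmC (htA g)
  have hm' : IsMean A (Γ ⊔ C) m := hm.mono le_sup_left
  constructor
  · intro h g
    have h0 : ∀ x ∈ S, m (fun a => commChar ψ x a * fibreMean mC (twist f ψ g) a) = 0 := by
      intro x hx
      have hx' := S.inv_mem hx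
      rw [← h (x⁻¹ * g), hmean]
      refine hm'.congr ((isAutomorphic_commChar hA hψ hS hx).mul (hΦ g)) (hΦ _) fun a ha => ?_
      have hc := hS.conj_A x hx a ha
      have e1 : a * (x⁻¹ * g) = x⁻¹ * ((x * a * x⁻¹ * a⁻¹) * (a * g)) := by group
      have e2 : commChar ψ x a = ψ (x * a * x⁻¹ * a⁻¹) := by
        have := hψ.mul _ (hA.le hc) a ha
        rw [inv_mul_cancel_right] at this
        rw [commChar, this, mul_inv_cancel_right]
      rw [hfib _ a ha, hfib _ a ha, e1, hinv _ hx', hequiv _ hc, e2]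
      ring
    have := eq_zero_of_mean_commChar_mul_eq_zero hA hψ hS hsep hm' (hΦ g) h0 1 A.one_mem
    rw [hfib g 1 A.one_mem, hψ.one] at this
    simpa using this
  · intro h g
    rw [hmean, hm'.congr (hΦ g) (IsAutomorphic.const 0) fun a ha => by
      rw [hfib g a ha, h, mul_zero], hm'.const]

end Exchange

/-! ### Compactness and discreteness in the adele ring -/

section Adeles

open IsDedekindDomain HeightOneSpectrum WithZero
open scoped RestrictedProduct

variable {F : Type u} [Field F] [NumberField F]

/-- The integers of `F` are dense in the integers of the completion at `v`. -/
theorem exists_int_valued_sub_le (v : HeightOneSpectrum (𝓞 F)) (y : v.adicCompletion F)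
    (hy : Valued.v y ≤ 1) (n : ℕ) :
    ∃ a : 𝓞 F, Valued.v (y - ((algebraMap (𝓞 F) F a : F) : v.adicCompletion F)) ≤
      exp (-(n : ℤ)) := by
  obtain ⟨π, hπ⟩ := v.valuation_exists_uniformizer F
  have hπ0 : ((π ^ n : F) : v.adicCompletion F) ≠ 0 := by
    intro h
    have := congrArg Valued.v h
    rw [valuedAdicCompletion_eq_valuation', map_pow, hπ, map_zero] at this
    simp at this
  have hπv : Valued.v ((π ^ n : F) : v.adicCompletion F) = exp (-(n : ℤ)) := by
    rw [valuedAdicCompletion_eq_valuation', map_pow, hπ, ← WithZero.exp_nsmul]; simp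
  have hopen : IsOpen {z : v.adicCompletion F | Valued.v (y - z) ≤ exp (-(n : ℤ))} := by
    have h1 : IsOpen {z : v.adicCompletion F | Valued.v z ≤ 1} :=
      Valued.isOpen_valuationSubring (v.adicCompletion F)
    have h2 : Continuous fun z : v.adicCompletion F =>
        ((π ^ n : F) : v.adicCompletion F)⁻¹ * (y - z) := by fun_prop
    convert h1.preimage h2 using 1
    ext z
    have h0 : Valued.v ((π ^ n : F) : v.adicCompletion F) ≠ 0 :=
      (Valuation.ne_zero_iff _).2 hπ0
    simp only [Set.mem_ofPred_eq, Set.mem_preimage, map_mul, map_inv₀]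
    rw [inv_mul_le_one₀ (zero_lt_iff.2 h0), hπv]
  obtain ⟨k, hk⟩ := (denseRange_algebraMap (R := 𝓞 F) F v).exists_mem_open hopen
    ⟨y, by simp⟩
  have hk' : Valued.v (y - ((k : F) : v.adicCompletion F)) ≤ exp (-(n : ℤ)) := hk
  have hle : exp (-(n : ℤ)) ≤ (1 : ℤᵐ⁰) := by
    rw [← exp_zero, exp_le_exp]; omega
  have hk1 : v.valuation F k ≤ 1 := by
    rw [← valuedAdicCompletion_eq_valuation']
    have : ((k : F) : v.adicCompletion F) = y - (y - (k : F)) := by ring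
    rw [this]
    exact (Valuation.map_sub _ _ _).trans (max_le hy (hk'.trans hle))
  obtain ⟨a, ha⟩ := exists_valuation_sub_lt_of_integer v hk1
    (Units.mk0 (exp (-(n : ℤ))) exp_ne_zero)
  refine ⟨a, ?_⟩
  have : y - ((algebraMap (𝓞 F) F a : F) : v.adicCompletion F) =
      (y - (k : F)) - ((algebraMap (𝓞 F) F a - k : F) : v.adicCompletion F) := by
    have : ((algebraMap (𝓞 F) F a - k : F) : v.adicCompletion F) =
      ((algebraMap (𝓞 F) F a : F) : v.adicCompletion F) - (k : F) :=
      map_sub (algebraMap F (v.adicCompletion F)) _ _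
    rw [this]; ring
  rw [this]
  refine (Valuation.map_sub _ _ _).trans (max_le hk' ?_)
  rw [valuedAdicCompletion_eq_valuation']
  exact ha.le

instance compactSpace_adicCompletionIntegers (v : HeightOneSpectrum (𝓞 F)) :
    CompactSpace (v.adicCompletionIntegers F) := by
  have hiff :=
    Valued.integer.compactSpace_iff_completeSpace_and_isDiscreteValuationRing_and_finite_residueField
      (K := v.adicCompletion F)
  refine hiff.2 ⟨?_, ?_, ?_⟩
  · exact (Valued.isClosed_integer (v.adicCompletion F)).completeSpace_coe
  · exact inferInstanceAs (IsDiscreteValuationRing (v.adicCompletionIntegers F))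
  · have : Finite (𝓞 F ⧸ v.asIdeal) := Ideal.finiteQuotientOfFreeOfNeBot _ v.ne_bot
    let φ : 𝓞 F →+* Valued.integer (v.adicCompletion F) :=
      algebraMap (𝓞 F) (v.adicCompletionIntegers F)
    let ρ : 𝓞 F →+* IsLocalRing.ResidueField (Valued.integer (v.adicCompletion F)) :=
      (IsLocalRing.residue _).comp φ
    have hmem : ∀ z : Valued.integer (v.adicCompletion F),
        Valued.v (z : v.adicCompletion F) ≤ exp (-((1 : ℕ) : ℤ)) → IsLocalRing.residue _ z = 0 := by
      intro z hz
      rw [IsLocalRing.residue_eq_zero_iff, IsLocalRing.mem_maximalIdeal, mem_nonunits_iff]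
      intro hu
      have h1 : Valued.v (z : v.adicCompletion F) = 1 :=
        adicCompletionIntegers.isUnit_iff_valued_eq_one.1 hu
      rw [h1, ← exp_zero, exp_le_exp] at hz
      simp at hz
    let ρ' : 𝓞 F ⧸ v.asIdeal →+* _ := Ideal.Quotient.lift v.asIdeal ρ (by
      intro a ha
      apply hmem
      change Valued.v ((algebraMap (𝓞 F) F a : F) : v.adicCompletion F) ≤ _
      rw [valuedAdicCompletion_eq_valuation', valuation_of_algebraMap]
      refine (intValuation_le_pow_iff_mem v a 1).2 (by simpa using ha))
    refine Finite.of_surjective ρ' fun z => ?_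
    obtain ⟨z, rfl⟩ := IsLocalRing.residue_surjective z
    obtain ⟨a, ha⟩ := exists_int_valued_sub_le v z z.2 1
    refine ⟨Ideal.Quotient.mk _ a, ?_⟩
    have : IsLocalRing.residue _ (z - φ a) = 0 := hmem _ ha
    rw [map_sub, sub_eq_zero] at this
    exact this.symm

/-- Strong approximation for the additive group: after multiplication by a common denominator, the
finitely many relevant local conditions are met by the Chinese remainder theorem. -/
theorem exists_sub_mem_integers (a : FiniteAdeleRing (𝓞 F) F) :
    ∃ q : F, ∀ v, (a - algebraMap F (FiniteAdeleRing (𝓞 F) F) q) v ∈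
      v.adicCompletionIntegers F := by
  classical
  have hfin : {v | a v ∉ v.adicCompletionIntegers F}.Finite := a.2
  have hden := fun v : HeightOneSpectrum (𝓞 F) =>
    adicCompletion.mul_nonZeroDivisor_mem_adicCompletionIntegers (K := F) v (a v)
  choose d hd hda using hden
  set b : 𝓞 F := ∏ v ∈ hfin.toFinset, d v with hb
  have hb0 : b ≠ 0 := Finset.prod_ne_zero_iff.2 fun v _ => nonZeroDivisors.ne_zero (hd v)
  -- the element `b` clears the denominators of `a`
  have hab : ∀ v, a v * ((algebraMap (𝓞 F) F b : F) : v.adicCompletion F) ∈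
      v.adicCompletionIntegers F := by
    intro v
    by_cases hv : a v ∈ v.adicCompletionIntegers F
    · exact mul_mem hv (coe_algebraMap_mem _ _ v b)
    · have hv' : v ∈ hfin.toFinset := by simpa using hv
      rw [hb, ← Finset.mul_prod_erase _ _ hv', map_mul, adicCompletion.coe_mul, ← mul_assoc]
      exact mul_mem (hda v) (coe_algebraMap_mem _ _ v _)
  have hbv : ∀ v : HeightOneSpectrum (𝓞 F), ∃ n : ℕ,
      exp (-(n : ℤ)) ≤ v.valuation F (algebraMap (𝓞 F) F b) := by
    intro v
    rw [valuation_of_algebraMap, intValuation_if_neg v hb0]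
    exact ⟨_, le_rfl⟩
  choose n hn using hbv
  have hc := fun v : HeightOneSpectrum (𝓞 F) => exists_int_valued_sub_le v _ (hab v) (n v)
  choose c hc using hc
  have hT : {v : HeightOneSpectrum (𝓞 F) | v.asIdeal ∣ Ideal.span {b}}.Finite :=
    Ideal.finite_factors (by simpa using hb0)
  obtain ⟨y, hy⟩ := IsDedekindDomain.exists_forall_sub_mem_ideal (s := hT.toFinset)
    (fun v => v.asIdeal) n (fun v _ => v.prime)
    (fun v _ w _ hvw h => hvw (HeightOneSpectrum.ext h)) (fun v => c v)
  refine ⟨algebraMap (𝓞 F) F y / algebraMap (𝓞 F) F b, fun v => ?_⟩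
  have hbF : (algebraMap (𝓞 F) F b : F) ≠ 0 := by simpa using hb0
  have hbC : ((algebraMap (𝓞 F) F b : F) : v.adicCompletion F) ≠ 0 :=
    (map_ne_zero (algebraMap F (v.adicCompletion F))).2 hbF
  have h1 : (a - algebraMap F (FiniteAdeleRing (𝓞 F) F)
      (algebraMap (𝓞 F) F y / algebraMap (𝓞 F) F b)) v =
      (a v * ((algebraMap (𝓞 F) F b : F) : v.adicCompletion F) -
        ((algebraMap (𝓞 F) F y : F) : v.adicCompletion F)) /
        ((algebraMap (𝓞 F) F b : F) : v.adicCompletion F) := by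
    have : (a - algebraMap F (FiniteAdeleRing (𝓞 F) F)
      (algebraMap (𝓞 F) F y / algebraMap (𝓞 F) F b)) v = a v - algebraMap F (v.adicCompletion F)
      (algebraMap (𝓞 F) F y / algebraMap (𝓞 F) F b) := rfl
    rw [this, map_div₀, sub_div, mul_div_cancel_right₀ _ hbC]
    rfl
  rw [h1, mem_adicCompletionIntegers, map_div₀]
  refine div_le_one_of_le₀ ?_ zero_le
  rw [valuedAdicCompletion_eq_valuation' v (algebraMap (𝓞 F) F b)]
  by_cases hv : v.asIdeal ∣ Ideal.span {b}
  · refine le_trans ?_ (hn v)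
    have h2 := hy v (by simpa using hv)
    have h3 : a v * ((algebraMap (𝓞 F) F b : F) : v.adicCompletion F) -
        ((algebraMap (𝓞 F) F y : F) : v.adicCompletion F) =
        (a v * ((algebraMap (𝓞 F) F b : F) : v.adicCompletion F) -
          ((algebraMap (𝓞 F) F (c v) : F) : v.adicCompletion F)) -
        ((algebraMap (𝓞 F) F (y - c v) : F) : v.adicCompletion F) := by
      have : ((algebraMap (𝓞 F) F (y - c v) : F) : v.adicCompletion F) =
          (algebraMap (𝓞 F) F y : F) - (algebraMap (𝓞 F) F (c v) : F) := by
        rw [map_sub]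
        exact map_sub (algebraMap F (v.adicCompletion F)) _ _
      rw [this]; ring
    rw [h3]
    refine (Valuation.map_sub _ _ _).trans (max_le (hc v) ?_)
    rw [valuedAdicCompletion_eq_valuation', valuation_of_algebraMap]
    exact (intValuation_le_pow_iff_mem v _ (n v)).2 h2
  · have h2 : v.valuation F (algebraMap (𝓞 F) F b) = 1 := by
      refine le_antisymm (v.valuation_le_one b) (not_lt.1 fun h => hv ?_)
      exact (v.valuation_lt_one_iff_dvd b).1 h
    rw [h2]
    exact sub_mem (hab v) (coe_algebraMap_mem _ _ v y)

end Adeles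

section InfiniteAdeles

variable {F : Type u} [Field F]

theorem norm_ringEquiv_mixedSpace (x : InfiniteAdeleRing F) (w : InfinitePlace F) :
    (∀ h : w.IsReal, ‖(InfiniteAdeleRing.ringEquiv_mixedSpace F x).1 ⟨w, h⟩‖ = ‖x w‖) ∧
    (∀ h : w.IsComplex, ‖(InfiniteAdeleRing.ringEquiv_mixedSpace F x).2 ⟨w, h⟩‖ = ‖x w‖) := by
  rw [InfiniteAdeleRing.ringEquiv_mixedSpace_apply]
  exact ⟨fun h => (InfinitePlace.Completion.isometry_extensionEmbeddingOfIsReal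
      h).norm_map_of_map_zero (map_zero _) _,
    fun h => (InfinitePlace.Completion.isometry_extensionEmbedding w).norm_map_of_map_zero
      (map_zero _) _⟩

/-- The ring of integers is cocompact in the archimedean adeles. -/
theorem exists_int_norm_sub_le [NumberField F] : ∃ M : ℝ, ∀ x : InfiniteAdeleRing F, ∃ a : 𝓞 F, ∀ w,
    ‖(x - algebraMap F (InfiniteAdeleRing F) (algebraMap (𝓞 F) F a)) w‖ ≤ M := by
  classical
  refine ⟨∑ i, ‖mixedEmbedding.latticeBasis F i‖, fun x => ?_⟩
  set y := InfiniteAdeleRing.ringEquiv_mixedSpace F x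
  have h1 := (ZSpan.floor (mixedEmbedding.latticeBasis F) y).2
  rw [mixedEmbedding.mem_span_latticeBasis] at h1
  obtain ⟨a, ha⟩ := h1
  refine ⟨a, fun w => ?_⟩
  have ha' : mixedEmbedding F (algebraMap (𝓞 F) F a) =
    (ZSpan.floor (mixedEmbedding.latticeBasis F) y : mixedEmbedding.mixedSpace F) := ha
  have h2 : InfiniteAdeleRing.ringEquiv_mixedSpace F
      (x - algebraMap F (InfiniteAdeleRing F) (algebraMap (𝓞 F) F a)) =
      ZSpan.fract (mixedEmbedding.latticeBasis F) y := by
    rw [map_sub, ← InfiniteAdeleRing.mixedEmbedding_eq_algebraMap_comp, ZSpan.fract_apply, ha']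
  have h3 := ZSpan.norm_fract_le (mixedEmbedding.latticeBasis F) y
  rw [← h2] at h3
  refine le_trans ?_ h3
  obtain ⟨hr, hc⟩ := norm_ringEquiv_mixedSpace
    (x - algebraMap F (InfiniteAdeleRing F) (algebraMap (𝓞 F) F a)) w
  rcases w.isReal_or_isComplex with h | h
  · rw [← hr h]
    exact (norm_le_pi_norm _ _).trans (norm_fst_le _)
  · rw [← hc h]
    exact (norm_le_pi_norm _ _).trans (norm_snd_le _)

theorem isCompact_completion_closedBall (w : InfinitePlace F) (M : ℝ) :
    IsCompact (Metric.closedBall (0 : w.Completion) M) := by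
  have h := (InfinitePlace.Completion.isometry_extensionEmbedding w)
  have h2 : IsClosedEmbedding (InfinitePlace.Completion.extensionEmbedding w) := h.isClosedEmbedding
  have h3 := h2.isCompact_preimage (isCompact_closedBall (0 : ℂ) M)
  rwa [← map_zero (InfinitePlace.Completion.extensionEmbedding w), h.preimage_closedBall] at h3

end InfiniteAdeles

section Adeles

open IsDedekindDomain HeightOneSpectrum WithZero
open scoped RestrictedProduct
variable {F : Type u} [Field F] [NumberField F]

/-- The quotient of the adele ring by `F` is compact. A finite adele is made integral by strong
approximation; then the archimedean component is made bounded by subtracting an integer of `F`,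
which keeps the finite component integral. -/
theorem exists_isCompact_add_rational :
    ∃ K : Set (Adele F), IsCompact K ∧ ∀ x, ∃ q : F, x - algebraMap F (Adele F) q ∈ K := by
  obtain ⟨M, hM⟩ := exists_int_norm_sub_le (F := F)
  have h1 : IsCompact {x : InfiniteAdeleRing F | ∀ w, ‖x w‖ ≤ M} := by
    have h : IsCompact (Set.pi Set.univ fun w : InfinitePlace F =>
      Metric.closedBall (0 : w.Completion) M) :=
      isCompact_univ_pi fun w => isCompact_completion_closedBall w M
    have h' : (Set.pi Set.univ fun w : InfinitePlace F =>
        Metric.closedBall (0 : w.Completion) M) = {x | ∀ w, ‖x w‖ ≤ M} := by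
      ext x
      simp [Set.mem_pi]
    rw [h'] at h
    exact h
  have h2 : IsCompact {x : FiniteAdeleRing (𝓞 F) F | ∀ v, x v ∈ v.adicCompletionIntegers F} := by
    have : {x : FiniteAdeleRing (𝓞 F) F | ∀ v, x v ∈ v.adicCompletionIntegers F} =
      Set.range (RestrictedProduct.structureMap
        (fun v : HeightOneSpectrum (𝓞 F) => v.adicCompletion F)
        (fun v => (v.adicCompletionIntegers F : Set (v.adicCompletion F))) Filter.cofinite) :=
      (RestrictedProduct.range_structureMap _ _).symm
    rw [this]
    have : ∀ v : HeightOneSpectrum (𝓞 F),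
      CompactSpace (v.adicCompletionIntegers F : Set (v.adicCompletion F)) :=
      fun v => compactSpace_adicCompletionIntegers v
    exact isCompact_range RestrictedProduct.isEmbedding_structureMap.continuous
  refine ⟨_, h1.prod h2, fun x => ?_⟩
  obtain ⟨q, hq⟩ := exists_sub_mem_integers x.2
  obtain ⟨a, ha⟩ := hM (x.1 - algebraMap F (InfiniteAdeleRing F) q)
  refine ⟨q + algebraMap (𝓞 F) F a, ?_, fun v => ?_⟩
  · intro w
    have := ha w
    rwa [sub_sub, ← map_add] at this
  · have h3 : (x - algebraMap F (Adele F) (q + algebraMap (𝓞 F) F a)).2 v =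
      (x.2 - algebraMap F (FiniteAdeleRing (𝓞 F) F) q) v -
        ((algebraMap (𝓞 F) F a : F) : v.adicCompletion F) := by
      rw [map_add, ← sub_sub]
      rfl
    rw [h3]
    exact sub_mem (hq v) (coe_algebraMap_mem _ _ v a)

/-- `F` is discrete in the adele ring: an element that is integral at all finite places and has
absolute value less than `1` at all archimedean ones is zero, since the norm of an algebraic integer
is an integer. -/
theorem exists_nhds_rational_eq_zero :
    ∃ U ∈ 𝓝 (0 : Adele F), ∀ q : F, algebraMap F (Adele F) q ∈ U → q = 0 := by
  have h1 : IsOpen {x : InfiniteAdeleRing F | ∀ w, ‖x w‖ < 1} := by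
    have h : IsOpen (Set.pi Set.univ fun w : InfinitePlace F =>
      Metric.ball (0 : w.Completion) 1) :=
      isOpen_set_pi Set.finite_univ fun w _ => Metric.isOpen_ball
    have h' : (Set.pi Set.univ fun w : InfinitePlace F =>
        Metric.ball (0 : w.Completion) 1) = {x | ∀ w, ‖x w‖ < 1} := by
      ext x
      simp [Set.mem_pi]
    rw [h'] at h
    exact h
  have h2 : IsOpen {x : FiniteAdeleRing (𝓞 F) F | ∀ v, x v ∈ v.adicCompletionIntegers F} :=
    RestrictedProduct.isOpen_forall_mem fun v => Valued.isOpen_valuationSubring _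
  refine ⟨_, (h1.prod h2).mem_nhds ⟨fun w => ?_, fun v => ?_⟩, fun q hq => ?_⟩
  · change ‖(0 : w.Completion)‖ < 1
    simp
  · exact zero_mem (v.adicCompletionIntegers F)
  · obtain ⟨hq1, hq2⟩ := hq
    by_contra h0
    obtain ⟨a, rfl⟩ := mem_integers_of_valuation_le_one (R := 𝓞 F) F q fun v => by
      rw [← valuedAdicCompletion_eq_valuation']
      exact hq2 v
    have ha : a ≠ 0 := by rintro rfl; simp at h0
    obtain ⟨w⟩ : Nonempty (InfinitePlace F) := inferInstance
    have hlt : ∀ w : InfinitePlace F, w (algebraMap (𝓞 F) F a) < 1 := fun w => by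
      have := hq1 w
      change ‖((algebraMap (𝓞 F) F a : F) : w.Completion)‖ < 1 at this
      exact (InfinitePlace.Completion.norm_coe w
        (WithAbs.toAbs _ (algebraMap (𝓞 F) F a))).symm.trans_lt this
    exact absurd (hlt w) (not_lt.2 (InfinitePlace.one_le_of_lt_one ha fun z _ => hlt z))

instance : T2Space (Adele F) := by
  have h1 : T2Space (InfiniteAdeleRing F) :=
    inferInstanceAs (T2Space ((w : InfinitePlace F) → w.Completion))
  have h2 : T2Space (FiniteAdeleRing (𝓞 F) F) :=
    inferInstanceAs (T2Space (Πʳ v : HeightOneSpectrum (𝓞 F),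
      [v.adicCompletion F, v.adicCompletionIntegers F]))
  exact inferInstanceAs (T2Space (InfiniteAdeleRing F × FiniteAdeleRing (𝓞 F) F))

end Adeles

/-! ### Equations and extension of scalars -/

section ScalarExt

variable {F : Type u} [Field F] {ι : Type}

/-- The space of matrices over `R` obtained from a space `W` of matrices over `F` by extension of
scalars, described by the condition that all its `F`-linear images lie in `W`. -/
def scalarExt (W : Submodule F (Matrix ι ι F)) (R : Type u) [CommRing R] [Algebra F R] :
    Submodule R (Matrix ι ι R) where
  carrier := {M | ∀ f : Module.Dual F R, M.map f ∈ W}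
  zero_mem' f := by
    rw [Matrix.map_zero _ (map_zero f)]
    exact W.zero_mem
  add_mem' {M N} hM hN f := by
    rw [Matrix.map_add _ (map_add f)]
    exact W.add_mem (hM f) (hN f)
  smul_mem' c M hM f := hM (f ∘ₗ LinearMap.mulLeft F c)

theorem scalarExt_inf (V W : Submodule F (Matrix ι ι F)) (R : Type u) [CommRing R] [Algebra F R] :
    scalarExt (V ⊓ W) R = scalarExt V R ⊓ scalarExt W R := by
  ext M
  exact forall_and

theorem scalarExt_mono {V W : Submodule F (Matrix ι ι F)} (h : V ≤ W) (R : Type u) [CommRing R]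
    [Algebra F R] : scalarExt V R ≤ scalarExt W R :=
  fun _ hM f => h (hM f)

theorem map_mem_scalarExt {W : Submodule F (Matrix ι ι F)} {R : Type u} [CommRing R] [Algebra F R]
    {N : Matrix ι ι F} (hN : N ∈ W) : N.map (algebraMap F R) ∈ scalarExt W R := by
  intro f
  have : (N.map (algebraMap F R)).map f = f 1 • N := by
    ext i j
    simp only [Matrix.map_apply, Matrix.smul_apply, smul_eq_mul]
    rw [Algebra.algebraMap_eq_smul_one, map_smul, smul_eq_mul, mul_comm]
  rw [this]
  exact W.smul_mem _ hN

/-- A basis of `W` spans `scalarExt W R` over `R`. -/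
theorem exists_eq_sum_of_mem_scalarExt [Fintype ι] {W : Submodule F (Matrix ι ι F)} {κ : Type*}
    [Fintype κ] (b : Module.Basis κ F W) {R : Type u} [CommRing R] [Algebra F R] {M : Matrix ι ι R}
    (hM : M ∈ scalarExt W R) :
    ∃ a : κ → R, M = ∑ i, a i • (b i : Matrix ι ι F).map (algebraMap F R) := by
  classical
  let β := Module.Basis.ofVectorSpace F R
  let T : Finset (Module.Basis.ofVectorSpaceIndex F R) :=
    Finset.univ.biUnion fun ij : ι × ι => (β.repr (M ij.1 ij.2)).support
  have hexp : ∀ i j, M i j = ∑ s ∈ T, β s * algebraMap F R (β.coord s (M i j)) := by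
    intro i j
    conv_lhs => rw [← β.linearCombination_repr (M i j), Finsupp.linearCombination_apply,
      Finsupp.sum_of_support_subset (s := T) _
        (fun s hs => Finset.mem_biUnion.2 ⟨(i, j), Finset.mem_univ _, hs⟩) _ (by simp)]
    refine Finset.sum_congr rfl fun s _ => ?_
    rw [Algebra.smul_def, mul_comm]
    rfl
  refine ⟨fun k => ∑ s ∈ T, β s * algebraMap F R (b.repr ⟨_, hM (β.coord s)⟩ k), ?_⟩
  ext i j
  have h2 : ∀ s, β.coord s (M i j) =
      ∑ k, b.repr ⟨_, hM (β.coord s)⟩ k * (b k : Matrix ι ι F) i j := by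
    intro s
    have h3 := congrArg (fun z : W => (z : Matrix ι ι F) i j)
      (b.sum_repr ⟨_, hM (β.coord s)⟩)
    simp only [Submodule.coe_sum, Matrix.sum_apply, Submodule.coe_smul, Matrix.smul_apply,
      smul_eq_mul] at h3
    exact h3.symm
  rw [hexp]
  simp only [h2, Matrix.sum_apply, Matrix.smul_apply, Matrix.map_apply, smul_eq_mul, map_sum,
    map_mul, Finset.sum_mul, Finset.mul_sum]
  rw [Finset.sum_comm]
  simp only [mul_assoc]

theorem mul_mem_scalarExt [Fintype ι] {V W Z : Submodule F (Matrix ι ι F)}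
    (h : ∀ x ∈ V, ∀ y ∈ W, x * y ∈ Z) {R : Type u} [CommRing R] [Algebra F R] {M N : Matrix ι ι R}
    (hM : M ∈ scalarExt V R) (hN : N ∈ scalarExt W R) : M * N ∈ scalarExt Z R := by
  obtain ⟨a, rfl⟩ := exists_eq_sum_of_mem_scalarExt (Module.finBasis F V) hM
  obtain ⟨b, rfl⟩ := exists_eq_sum_of_mem_scalarExt (Module.finBasis F W) hN
  rw [Finset.sum_mul_sum]
  refine Submodule.sum_mem _ fun i _ => Submodule.sum_mem _ fun j _ => ?_
  rw [smul_mul_assoc, mul_smul_comm, ← Matrix.map_mul]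
  exact Submodule.smul_mem _ _ (Submodule.smul_mem _ _
    (map_mem_scalarExt (h _ (Subtype.coe_prop _) _ (Subtype.coe_prop _))))

theorem scalarExt_bot (R : Type u) [CommRing R] [Algebra F R] :
    scalarExt (⊥ : Submodule F (Matrix ι ι F)) R = ⊥ := by
  refine (Submodule.eq_bot_iff _).2 fun M hM => ?_
  ext i j
  have h : ∀ f : Module.Dual F R, f (M i j) = 0 := fun f =>
    congrFun (congrFun ((Submodule.mem_bot F (x := M.map f)).1 (hM f)) i) j
  exact (Module.forall_dual_apply_eq_zero_iff F _).1 h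

theorem aeval_entries_map {R R' : Type u} [CommRing R] [CommRing R'] [Algebra F R] [Algebra F R']
    (φ : R →ₐ[F] R') (M : Matrix ι ι R) (p : MvPolynomial (ι × ι) F) :
    MvPolynomial.aeval (fun ij : ι × ι => M.map φ ij.1 ij.2) p =
      φ (MvPolynomial.aeval (fun ij : ι × ι => M ij.1 ij.2) p) := by
  rw [← AlgHom.comp_apply, MvPolynomial.comp_aeval]
  rfl

end ScalarExt

section Points

variable {F : Type u} [Field F] {ι : Type} [Fintype ι] [DecidableEq ι]

/-- `S` is a set of equations of the group functor `U`. -/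
def IsEquations (U : MatGroup F ι) (S : Set (MvPolynomial (ι × ι) F)) : Prop :=
  ∀ (R : Type u) [CommRing R] [Algebra F R] (g : GL ι R),
    g ∈ U R ↔ ∀ p ∈ S, MvPolynomial.aeval (fun ij : ι × ι => (g : Matrix ι ι R) ij.1 ij.2) p = 0

variable {U : MatGroup F ι} {S : Set (MvPolynomial (ι × ι) F)}

theorem IsEquations.map_mem (hS : IsEquations U S) {R R' : Type u} [CommRing R] [CommRing R']
    [Algebra F R] [Algebra F R'] (φ : R →ₐ[F] R') {g : GL ι R} (hg : g ∈ U R) :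
    GeneralLinearGroup.map (φ : R →+* R') g ∈ U R' := by
  rw [hS]
  intro p hp
  refine (aeval_entries_map φ (g : Matrix ι ι R) p).trans ?_
  rw [(hS R g).1 hg p hp, map_zero]

theorem IsEquations.mem_of_map_mem (hS : IsEquations U S) {R R' : Type u} [CommRing R]
    [CommRing R'] [Algebra F R] [Algebra F R'] (φ : R →ₐ[F] R') (hφ : Function.Injective φ)
    {g : GL ι R} (hg : GeneralLinearGroup.map (φ : R →+* R') g ∈ U R') : g ∈ U R := by
  rw [hS]
  intro p hp
  apply hφ
  rw [map_zero, ← aeval_entries_map]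
  exact (hS R' _).1 hg p hp

/-! ### Tangent vectors -/

/-- Taylor's formula of order one, `p (x + ε y) = p (x) + ε ∑ ∂ᵢp (x) yᵢ`. -/
theorem eval₂_add_inr {k R σ : Type*} [CommRing k] [CommRing R] [Fintype σ] (φ : k →+* R)
    (x y : σ → R) (p : MvPolynomial σ k) :
    p.eval₂ ((TrivSqZeroExt.inlHom R R).comp φ)
      (fun i => (TrivSqZeroExt.inl (x i) + TrivSqZeroExt.inr (y i) : TrivSqZeroExt R R)) =
      TrivSqZeroExt.inl (p.eval₂ φ x) +
        TrivSqZeroExt.inr (∑ i, (MvPolynomial.pderiv i p).eval₂ φ x * y i) := by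
  classical
  induction p using MvPolynomial.induction_on with
  | C a => simp
  | add p q hp hq =>
    simp only [MvPolynomial.eval₂_add, hp, hq, map_add, add_mul, Finset.sum_add_distrib,
      TrivSqZeroExt.inl_add, TrivSqZeroExt.inr_add]
    ring
  | mul_X p j hp =>
    simp only [MvPolynomial.eval₂_mul, hp, MvPolynomial.eval₂_X, MvPolynomial.pderiv_mul,
      MvPolynomial.pderiv_X, MvPolynomial.eval₂_add, add_mul, Finset.sum_add_distrib]
    have h1 : ∑ i, p.eval₂ φ x *
        (Pi.single (M := fun _ => MvPolynomial σ k) i 1 j).eval₂ φ x * y i =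
        p.eval₂ φ x * y j := by
      rw [Finset.sum_eq_single j]
      · simp
      · intro b _ hb
        simp [Pi.single_eq_of_ne hb.symm]
      · simp
    have h2 : ∑ i, (MvPolynomial.pderiv i p).eval₂ φ x * x j * y i =
        (∑ i, (MvPolynomial.pderiv i p).eval₂ φ x * y i) * x j := by
      rw [Finset.sum_mul]
      exact Finset.sum_congr rfl fun i _ => by ring
    rw [h1, h2]
    ext
    · simp
    · simp
      ring

theorem derivation_eval₂ {k B σ : Type*} [CommRing k] [CommRing B] [Algebra k B] [Fintype σ]
    (d : Derivation k B B) (x : σ → B) (p : MvPolynomial σ k) :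
    d (p.eval₂ (algebraMap k B) x) =
      ∑ i, (MvPolynomial.pderiv i p).eval₂ (algebraMap k B) x * d (x i) := by
  classical
  induction p using MvPolynomial.induction_on with
  | C a => simp
  | add p q hp hq =>
    simp only [MvPolynomial.eval₂_add, hp, hq, map_add, add_mul, Finset.sum_add_distrib]
  | mul_X p j hp =>
    simp only [MvPolynomial.eval₂_mul, MvPolynomial.eval₂_X, MvPolynomial.pderiv_mul,
      MvPolynomial.pderiv_X, MvPolynomial.eval₂_add, add_mul, Finset.sum_add_distrib]
    have h1 : ∑ i, p.eval₂ (algebraMap k B) x *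
        (Pi.single (M := fun _ => MvPolynomial σ k) i 1 j).eval₂ (algebraMap k B) x * d (x i) =
        p.eval₂ (algebraMap k B) x * d (x j) := by
      rw [Finset.sum_eq_single j]
      · simp
      · intro b _ hb
        simp [Pi.single_eq_of_ne hb.symm]
      · simp
    have h2 : ∑ i, (MvPolynomial.pderiv i p).eval₂ (algebraMap k B) x * x j * d (x i) =
        x j * ∑ i, (MvPolynomial.pderiv i p).eval₂ (algebraMap k B) x * d (x i) := by
      rw [Finset.mul_sum]
      exact Finset.sum_congr rfl fun i _ => by ring
    rw [h1, h2, Derivation.leibniz, hp, smul_eq_mul, smul_eq_mul, add_comm]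

/-- The matrix `1 + ε N` over the dual numbers. -/
def dualMatrix {R : Type u} [CommRing R] (N : Matrix ι ι R) : Matrix ι ι (TrivSqZeroExt R R) :=
  1 + N.map TrivSqZeroExt.inr

theorem dualMatrix_mul {R : Type u} [CommRing R] (M N : Matrix ι ι R) :
    dualMatrix M * dualMatrix N = dualMatrix (M + N) := by
  have h1 : (M.map TrivSqZeroExt.inr : Matrix ι ι (TrivSqZeroExt R R)) *
      (N.map TrivSqZeroExt.inr : Matrix ι ι (TrivSqZeroExt R R)) = 0 := by
    refine Matrix.ext fun i j => ?_
    rw [Matrix.mul_apply]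
    exact Finset.sum_eq_zero fun k _ => TrivSqZeroExt.inr_mul_inr R _ _
  have h2 : (M + N).map TrivSqZeroExt.inr =
      (M.map TrivSqZeroExt.inr + N.map TrivSqZeroExt.inr : Matrix ι ι (TrivSqZeroExt R R)) :=
    Matrix.map_add _ (TrivSqZeroExt.inr_add R) M N
  rw [dualMatrix, dualMatrix, dualMatrix, add_mul, mul_add, mul_add, h1, h2]
  simp only [mul_one, one_mul, add_zero]
  abel

theorem dualMatrix_zero {R : Type u} [CommRing R] : dualMatrix (0 : Matrix ι ι R) = 1 := by
  rw [dualMatrix, Matrix.map_zero _ (TrivSqZeroExt.inr_zero R), add_zero]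

/-- The matrix `1 + ε N` as an invertible matrix. -/
def dualGL {R : Type u} [CommRing R] (N : Matrix ι ι R) : GL ι (TrivSqZeroExt R R) where
  val := dualMatrix N
  inv := dualMatrix (-N)
  val_inv := by rw [dualMatrix_mul, add_neg_cancel, dualMatrix_zero]
  inv_val := by rw [dualMatrix_mul, neg_add_cancel, dualMatrix_zero]

/-- The Lie algebra of the group defined by the equations `S`: the tangent space at `1`. -/
def lieSpace (S : Set (MvPolynomial (ι × ι) F)) : Submodule F (Matrix ι ι F) where
  carrier := {N | ∀ p ∈ S, ∑ ij : ι × ι, (MvPolynomial.pderiv ij p).eval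
    (fun ij => (1 : Matrix ι ι F) ij.1 ij.2) * N ij.1 ij.2 = 0}
  zero_mem' p _ := by simp
  add_mem' {M N} hM hN p hp := by
    simp only [Matrix.add_apply, mul_add, Finset.sum_add_distrib]
    rw [hM p hp, hN p hp, add_zero]
  smul_mem' c M hM p hp := by
    simp only [Matrix.smul_apply, smul_eq_mul, mul_left_comm _ c]
    rw [← Finset.mul_sum, hM p hp, mul_zero]

theorem mem_scalarExt_lieSpace {R : Type u} [CommRing R] [Algebra F R] {N : Matrix ι ι R} :
    N ∈ scalarExt (lieSpace S) R ↔ ∀ p ∈ S, ∑ ij : ι × ι, algebraMap F R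
      ((MvPolynomial.pderiv ij p).eval (fun ij => (1 : Matrix ι ι F) ij.1 ij.2)) *
        N ij.1 ij.2 = 0 := by
  have key : ∀ (f : Module.Dual F R) (p : MvPolynomial (ι × ι) F),
      f (∑ ij : ι × ι, algebraMap F R ((MvPolynomial.pderiv ij p).eval
        (fun ij => (1 : Matrix ι ι F) ij.1 ij.2)) * N ij.1 ij.2) =
      ∑ ij : ι × ι, (MvPolynomial.pderiv ij p).eval
        (fun ij => (1 : Matrix ι ι F) ij.1 ij.2) * (N.map f) ij.1 ij.2 := by
    intro f p
    rw [map_sum]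
    refine Finset.sum_congr rfl fun ij _ => ?_
    rw [← Algebra.smul_def, map_smul]
    rfl
  constructor
  · intro h p hp
    refine (Module.forall_dual_apply_eq_zero_iff F _).1 fun f => ?_
    rw [key]
    exact h f p hp
  · intro h f p hp
    rw [← key, h p hp, map_zero]

theorem aeval_map_inl_add {R : Type u} [CommRing R] [Algebra F R] (g M : Matrix ι ι R)
    (p : MvPolynomial (ι × ι) F) :
    MvPolynomial.aeval (fun ij : ι × ι => (g.map TrivSqZeroExt.inl + M.map TrivSqZeroExt.inr :
      Matrix ι ι (TrivSqZeroExt R R)) ij.1 ij.2) p =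
      TrivSqZeroExt.inl (MvPolynomial.aeval (fun ij : ι × ι => g ij.1 ij.2) p) +
      TrivSqZeroExt.inr (∑ ij : ι × ι, MvPolynomial.aeval (fun ij : ι × ι => g ij.1 ij.2)
        (MvPolynomial.pderiv ij p) * M ij.1 ij.2) :=
  eval₂_add_inr (algebraMap F R) (fun ij : ι × ι => g ij.1 ij.2) (fun ij => M ij.1 ij.2) p

/-- Tangent vectors are the matrices `N` for which `1 + ε N` is a point of the group over the dual
numbers. -/
theorem IsEquations.dualGL_mem_iff (hS : IsEquations U S) {R : Type u} [CommRing R] [Algebra F R]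
    {N : Matrix ι ι R} : dualGL N ∈ U (TrivSqZeroExt R R) ↔ N ∈ scalarExt (lieSpace S) R := by
  rw [hS, mem_scalarExt_lieSpace]
  refine forall₂_congr fun p hp => ?_
  have h1 : ((dualGL N : GL ι (TrivSqZeroExt R R)) : Matrix ι ι (TrivSqZeroExt R R)) =
      (1 : Matrix ι ι R).map TrivSqZeroExt.inl + N.map TrivSqZeroExt.inr := by
    rw [Matrix.map_one _ (TrivSqZeroExt.inl_zero R) (TrivSqZeroExt.inl_one R)]
    rfl
  have h2 : MvPolynomial.aeval (fun ij : ι × ι => (1 : Matrix ι ι R) ij.1 ij.2) p = 0 :=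
    (hS R 1).1 (one_mem _) p hp
  have h3 : ∀ q : MvPolynomial (ι × ι) F,
      MvPolynomial.aeval (fun ij : ι × ι => (1 : Matrix ι ι R) ij.1 ij.2) q =
      algebraMap F R (q.eval (fun ij => (1 : Matrix ι ι F) ij.1 ij.2)) := by
    intro q
    have := aeval_entries_map (Algebra.ofId F R) (1 : Matrix ι ι F) q
    rw [Matrix.map_one _ (map_zero _) (map_one _)] at this
    exact this
  rw [h1, aeval_map_inl_add, h2, TrivSqZeroExt.inl_zero, zero_add]
  simp only [h3]
  rw [← TrivSqZeroExt.inr_zero R]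
  exact TrivSqZeroExt.inr_injective.eq_iff

theorem scalarExt_lieSpace_map {R R' : Type u} [CommRing R] [CommRing R'] [Algebra F R]
    [Algebra F R'] (φ : R →ₐ[F] R') {N : Matrix ι ι R} (hN : N ∈ scalarExt (lieSpace S) R) :
    N.map φ ∈ scalarExt (lieSpace S) R' := by
  rw [mem_scalarExt_lieSpace] at hN ⊢
  intro p hp
  have := congrArg φ (hN p hp)
  simpa [map_sum] using this

/-! ### The exponential map -/

/-- The derivative of a function of the matrix `g` along the vector field `g ↦ g N`. -/
def rightDeriv {R : Type u} [CommRing R] (N : Matrix ι ι R) (p : MvPolynomial (ι × ι) R) :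
    MvPolynomial (ι × ι) R :=
  ∑ ij : ι × ι, MvPolynomial.pderiv ij p *
    ∑ k, MvPolynomial.X (ij.1, k) * MvPolynomial.C (N k ij.2)

theorem eval₂_rightDeriv {R B : Type u} [CommRing R] [CommRing B] (φ : R →+* B) (N : Matrix ι ι R)
    (g : Matrix ι ι B) (p : MvPolynomial (ι × ι) R) :
    (rightDeriv N p).eval₂ φ (fun ij => g ij.1 ij.2) = ∑ ij : ι × ι,
      (MvPolynomial.pderiv ij p).eval₂ φ (fun ij => g ij.1 ij.2) * (g * N.map φ) ij.1 ij.2 := by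
  rw [rightDeriv, MvPolynomial.eval₂_sum]
  refine Finset.sum_congr rfl fun ij _ => ?_
  rw [MvPolynomial.eval₂_mul, MvPolynomial.eval₂_sum, Matrix.mul_apply]
  simp [MvPolynomial.eval₂_mul]

/-- The polynomial `p` over `R` vanishes on all points of `U` over `F`-algebras over `R`. -/
def VanishesOn (U : MatGroup F ι) {R : Type u} [CommRing R] [Algebra F R]
    (p : MvPolynomial (ι × ι) R) : Prop :=
  ∀ (R' : Type u) [CommRing R'] [Algebra F R'] (φ : R →ₐ[F] R') (g : GL ι R'), g ∈ U R' →
    p.eval₂ (φ : R →+* R') (fun ij => (g : Matrix ι ι R') ij.1 ij.2) = 0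

/-- The ideal of a group is stable under its left invariant vector fields, since `g (1 + ε N)` is
again a point of the group. -/
theorem IsEquations.vanishesOn_rightDeriv (hS : IsEquations U S) {R : Type u} [CommRing R]
    [Algebra F R] {N : Matrix ι ι R} (hN : N ∈ scalarExt (lieSpace S) R)
    {p : MvPolynomial (ι × ι) R} (hp : VanishesOn U p) : VanishesOn U (rightDeriv N p) := by
  intro R' _ _ φ g hg
  have h1 : dualGL (N.map φ) ∈ U (TrivSqZeroExt R' R') :=
    hS.dualGL_mem_iff.2 (scalarExt_lieSpace_map φ hN)
  have h2 := hS.map_mem (TrivSqZeroExt.inlAlgHom F R' R') hg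
  have h3 := hp _ ((TrivSqZeroExt.inlAlgHom F R' R').comp φ) _ (mul_mem h2 h1)
  have h4 : ((GeneralLinearGroup.map (TrivSqZeroExt.inlAlgHom F R' R' : R' →+* _) g *
      dualGL (N.map φ) : GL ι (TrivSqZeroExt R' R')) : Matrix ι ι (TrivSqZeroExt R' R')) =
      (g : Matrix ι ι R').map TrivSqZeroExt.inl +
        ((g : Matrix ι ι R') * N.map φ).map TrivSqZeroExt.inr := by
    change (g : Matrix ι ι R').map TrivSqZeroExt.inl *
      (1 + (N.map φ).map TrivSqZeroExt.inr) = _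
    rw [mul_add, mul_one]
    congr 1
    refine Matrix.ext fun i j => ?_
    rw [Matrix.mul_apply, Matrix.map_apply, Matrix.mul_apply, TrivSqZeroExt.inr_sum]
    exact Finset.sum_congr rfl fun k _ => TrivSqZeroExt.inl_mul_inr _ _
  rw [h4] at h3
  have h5 := eval₂_add_inr (φ : R →+* R') (fun ij : ι × ι => (g : Matrix ι ι R') ij.1 ij.2)
    (fun ij => ((g : Matrix ι ι R') * N.map φ) ij.1 ij.2) p
  have h6 := h5.symm.trans h3
  have h7 := congrArg TrivSqZeroExt.snd h6
  rw [TrivSqZeroExt.snd_add, TrivSqZeroExt.snd_inl, TrivSqZeroExt.snd_inr, zero_add] at h7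
  rw [eval₂_rightDeriv]
  exact h7

/-- The power series `exp (t N)`. -/
def expSeries (F : Type u) [Field F] {R : Type u} [CommRing R] [Algebra F R] (N : Matrix ι ι R) :
    Matrix ι ι (PowerSeries R) :=
  Matrix.of fun i j => PowerSeries.mk fun k => ((k.factorial : F)⁻¹) • (N ^ k) i j

theorem derivative_expSeries [CharZero F] {R : Type u} [CommRing R] [Algebra F R]
    (N : Matrix ι ι R) (i j : ι) :
    PowerSeries.derivative R (expSeries F N i j) =
      (expSeries F N * N.map (PowerSeries.C (R := R))) i j := by
  ext k
  rw [PowerSeries.coeff_derivative, Matrix.mul_apply, map_sum]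
  simp only [expSeries, Matrix.of_apply, PowerSeries.coeff_mk, Matrix.map_apply,
    PowerSeries.coeff_mul_C]
  have h1 : ((k + 1).factorial : F)⁻¹ * ((k : F) + 1) = (k.factorial : F)⁻¹ := by
    have : ((k : F) + 1) ≠ 0 := by exact_mod_cast Nat.succ_ne_zero k
    rw [Nat.factorial_succ]
    push_cast
    field_simp
  have h2 : ((k : R) + 1) = algebraMap F R ((k : F) + 1) := by simp
  rw [h2, mul_comm, ← Algebra.smul_def, smul_smul, mul_comm, h1, pow_succ, Matrix.mul_apply,
    Finset.smul_sum]
  exact Finset.sum_congr rfl fun l _ => (smul_mul_assoc _ _ _).symm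

/-- Every coefficient of `p (exp (t N))` vanishes if `p` vanishes on the group, because the derivative
of this series is the series for `rightDeriv N p`, which vanishes on the group as well. -/
theorem IsEquations.coeff_eval₂_expSeries [CharZero F] (hS : IsEquations U S) {R : Type u}
    [CommRing R] [Algebra F R] {N : Matrix ι ι R} (hN : N ∈ scalarExt (lieSpace S) R) (k : ℕ) :
    ∀ {p : MvPolynomial (ι × ι) R}, VanishesOn U p →
      PowerSeries.coeff k (p.eval₂ (PowerSeries.C (R := R))
        (fun ij => expSeries F N ij.1 ij.2)) = 0 := by
  induction k with
  | zero =>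
    intro p hp
    rw [PowerSeries.coeff_zero_eq_constantCoeff_apply, MvPolynomial.hom_eval₂]
    have h1 : (PowerSeries.constantCoeff (R := R)).comp PowerSeries.C = RingHom.id R := by
      ext; simp
    have h2 : (fun ij : ι × ι => PowerSeries.constantCoeff (R := R)
        (expSeries F N ij.1 ij.2)) = fun ij => ((1 : GL ι R) : Matrix ι ι R) ij.1 ij.2 := by
      ext ij
      simp [expSeries, ← PowerSeries.coeff_zero_eq_constantCoeff_apply]
    rw [h1, h2]
    exact hp R (AlgHom.id F R) 1 (one_mem _)
  | succ k ih =>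
    intro p hp
    have h1 := ih (hS.vanishesOn_rightDeriv hN hp)
    have h2 := derivation_eval₂ (PowerSeries.derivative R)
      (fun ij : ι × ι => expSeries F N ij.1 ij.2) p
    simp only [derivative_expSeries] at h2
    rw [eval₂_rightDeriv] at h1
    have h3 := congrArg (PowerSeries.coeff k) h2
    rw [PowerSeries.coeff_derivative] at h3
    have h4 := h3.trans h1
    have h5 : ((k : R) + 1) = algebraMap F R ((k : F) + 1) := by simp
    have h6 : IsUnit ((k : R) + 1) := by
      rw [h5]
      exact (IsUnit.mk0 _ (by exact_mod_cast Nat.succ_ne_zero k)).map _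
    exact (h6.mul_left_eq_zero).1 h4

/-- In characteristic zero the one-parameter groups defined by tangent vectors lie in the group. -/
theorem IsEquations.aeval_expSeries [CharZero F] (hS : IsEquations U S) {R : Type u} [CommRing R]
    [Algebra F R] {N : Matrix ι ι R} (hN : N ∈ scalarExt (lieSpace S) R)
    {p : MvPolynomial (ι × ι) F} (hp : p ∈ S) :
    MvPolynomial.aeval (fun ij : ι × ι => expSeries F N ij.1 ij.2) p = 0 := by
  have h1 : VanishesOn U (p.map (algebraMap F R)) := by
    intro R' _ _ φ g hg
    rw [MvPolynomial.eval₂_map]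
    have : ((φ : R →+* R').comp (algebraMap F R)) = algebraMap F R' := φ.comp_algebraMap
    rw [this]
    exact (hS R' g).1 hg p hp
  ext k
  have h2 := hS.coeff_eval₂_expSeries hN k h1
  rw [MvPolynomial.eval₂_map] at h2
  have h3 : algebraMap F (PowerSeries R) = (PowerSeries.C (R := R)).comp (algebraMap F R) :=
    RingHom.ext fun _ => PowerSeries.algebraMap_apply
  rw [map_zero, MvPolynomial.aeval_def, h3]
  exact h2

end Points

/-! ### Exponentials and logarithms in unipotent groups -/

section Exponential

variable {F : Type u} [Field F] {ι : Type} [Fintype ι] [DecidableEq ι]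
variable {U : MatGroup F ι} {S : Set (MvPolynomial (ι × ι) F)}

theorem map_constantCoeff_expSeries {R : Type u} [CommRing R] [Algebra F R] (N : Matrix ι ι R) :
    (expSeries F N).map (PowerSeries.constantCoeff (R := R)) = 1 := by
  ext i j
  simp [expSeries, ← PowerSeries.coeff_zero_eq_constantCoeff_apply]

/-- Tangent vectors `N` of a unipotent group are nilpotent: over the ring of power series the matrix
`exp (t N) - 1` is nilpotent, hence so is `(exp (t N) - 1) / t`, and its constant term is `N`. -/
theorem IsEquations.isNilpotent_of_mem_lieSpace [CharZero F] (hS : IsEquations U S)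
    (hU : ∀ (R : Type u) [CommRing R] [Algebra F R], ∀ g ∈ U R,
      IsNilpotent ((g : Matrix ι ι R) - 1))
    {R : Type u} [CommRing R] [Algebra F R] {N : Matrix ι ι R}
    (hN : N ∈ scalarExt (lieSpace S) R) : IsNilpotent N := by
  have hdet : IsUnit (expSeries F N).det := by
    rw [PowerSeries.isUnit_iff_constantCoeff, RingHom.map_det, RingHom.mapMatrix_apply,
      map_constantCoeff_expSeries, Matrix.det_one]
    exact isUnit_one
  let g : GL ι (PowerSeries R) := GeneralLinearGroup.mk'' (expSeries F N) hdet
  obtain ⟨k, hk⟩ := hU _ g ((hS _ g).2 fun p hp => hS.aeval_expSeries hN hp)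
  -- the quotient `(exp (t N) - 1) / t` has constant term `N`
  let M : Matrix ι ι (PowerSeries R) :=
    Matrix.of fun i j => PowerSeries.mk fun k => (((k + 1).factorial : F)⁻¹) • (N ^ (k + 1)) i j
  have h1 : (g : Matrix ι ι (PowerSeries R)) - 1 = (PowerSeries.X : PowerSeries R) • M := by
    ext i j n
    change PowerSeries.coeff n (expSeries F N i j - (1 : Matrix ι ι (PowerSeries R)) i j) =
      PowerSeries.coeff n (PowerSeries.X * M i j)
    cases n with
    | zero =>
      rw [map_sub, PowerSeries.coeff_zero_X_mul]
      by_cases hij : i = j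
      · subst hij; simp [expSeries]
      · simp [expSeries, Matrix.one_apply_ne hij]
    | succ n =>
      rw [map_sub, PowerSeries.coeff_succ_X_mul]
      by_cases hij : i = j
      · subst hij; simp [expSeries, M, PowerSeries.coeff_one]
      · simp [expSeries, M, Matrix.one_apply_ne hij]
  refine ⟨k, ?_⟩
  rw [h1, smul_pow] at hk
  have h2 : M ^ k = 0 := by
    ext i j n
    have := congrArg (PowerSeries.coeff (n + k)) (congrFun (congrFun hk i) j)
    rw [Matrix.smul_apply, smul_eq_mul, PowerSeries.coeff_X_pow_mul] at this
    simpa using this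
  have h3 : M.map (PowerSeries.constantCoeff (R := R)) = N := by
    ext i j
    simp [M, ← PowerSeries.coeff_zero_eq_constantCoeff_apply]
  have h4 := congrArg (RingHom.mapMatrix (PowerSeries.constantCoeff (R := R))) h2
  rw [map_pow, RingHom.mapMatrix_apply, h3, map_zero] at h4
  exact h4

/-- The exponential of a matrix `N` with `N ^ m = 0`. -/
def expMatrix (F : Type u) [Field F] (m : ℕ) {R : Type u} [CommRing R] [Algebra F R]
    (N : Matrix ι ι R) : Matrix ι ι R :=
  ∑ k ∈ Finset.range m, ((k.factorial : F)⁻¹) • N ^ k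

/-- If `N` is nilpotent, `exp (t N)` is a polynomial in `t`, so that one may put `t = 1`. -/
theorem IsEquations.aeval_expMatrix [CharZero F] (hS : IsEquations U S) {R : Type u} [CommRing R]
    [Algebra F R] {N : Matrix ι ι R} (hN : N ∈ scalarExt (lieSpace S) R) {m : ℕ} (hm : N ^ m = 0)
    {p : MvPolynomial (ι × ι) F} (hp : p ∈ S) :
    MvPolynomial.aeval (fun ij : ι × ι => expMatrix F m N ij.1 ij.2) p = 0 := by
  let P : Matrix ι ι (Polynomial R) := Matrix.of fun i j =>
    ∑ k ∈ Finset.range m, Polynomial.C (((k.factorial : F)⁻¹) • (N ^ k) i j) * Polynomial.X ^ k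
  have h1 : P.map (Polynomial.coeToPowerSeries.algHom (R := R) R : Polynomial R → PowerSeries R) =
      expSeries F N := by
    ext i j n
    simp only [Matrix.map_apply, Polynomial.coeToPowerSeries.algHom_apply, expSeries,
      Matrix.of_apply, PowerSeries.coeff_mk, P, Algebra.algebraMap_self, PowerSeries.map_id, id]
    rw [Polynomial.coeff_coe, Polynomial.finsetSum_coeff]
    simp only [Polynomial.coeff_C_mul_X_pow]
    rw [Finset.sum_ite_eq]
    split_ifs with hn
    · rfl
    · rw [pow_eq_zero_of_le (by simpa using hn) hm]
      simp
  let φ : Polynomial R →ₐ[F] PowerSeries R :=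
    (Polynomial.coeToPowerSeries.algHom (R := R) R).restrictScalars F
  have hφ : Function.Injective φ := by
    intro x y hxy
    have : (Polynomial.coeToPowerSeries.algHom (R := R) R) x =
      (Polynomial.coeToPowerSeries.algHom (R := R) R) y := hxy
    simpa [Polynomial.coeToPowerSeries.algHom_apply] using this
  have h2 : MvPolynomial.aeval (fun ij : ι × ι => P ij.1 ij.2) p = 0 := by
    apply hφ
    rw [map_zero, ← aeval_entries_map]
    have : P.map φ = expSeries F N := h1
    rw [this]
    exact hS.aeval_expSeries hN hp
  let e : Polynomial R →ₐ[F] R := (Polynomial.aeval (1 : R)).restrictScalars F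
  have h3 : P.map e = expMatrix F m N := by
    ext i j
    change Polynomial.aeval (1 : R) (P i j) = _
    simp [P, expMatrix, Matrix.sum_apply, map_sum]
  rw [← h3, aeval_entries_map, h2, map_zero]

/-- The binomial coefficient `t (t - 1) ⋯ (t - j + 1) / j!` as a polynomial in `t`. -/
def binomPoly (F : Type u) [Field F] (j : ℕ) : Polynomial F :=
  Polynomial.C ((j.factorial : F)⁻¹) * descPochhammer F j

theorem binomPoly_eval [CharZero F] (j k : ℕ) :
    (binomPoly F j).eval (k : F) = (k.choose j : F) := by
  rw [binomPoly, Polynomial.eval_mul, Polynomial.eval_C, descPochhammer_eval_eq_descFactorial,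
    Nat.descFactorial_eq_factorial_mul_choose, Nat.cast_mul,
    inv_mul_cancel_left₀ (by exact_mod_cast Nat.factorial_ne_zero j)]

/-- The ring `R` need not be a domain: it is enough that differences of distinct natural numbers are
units of `R`. -/
theorem polynomial_eq_zero_of_forall_eval_natCast {R : Type u} [CommRing R] [CharZero F]
    [Algebra F R] (d : ℕ) : ∀ (q : Polynomial R) (a : ℕ), q.natDegree < d →
      (∀ k : ℕ, a ≤ k → q.eval (k : R) = 0) → q = 0 := by
  induction d with
  | zero => intro q a h; omega
  | succ d ih =>
    intro q a hd hq
    nontriviality R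
    obtain ⟨s, rfl⟩ := Polynomial.dvd_iff_isRoot.2 (show q.IsRoot (a : R) from hq a le_rfl)
    by_cases hs : s = 0
    · rw [hs, mul_zero]
    have hdeg : ((Polynomial.X - Polynomial.C (a : R)) * s).natDegree = s.natDegree + 1 := by
      rw [Polynomial.Monic.natDegree_mul' (Polynomial.monic_X_sub_C _) hs,
        Polynomial.natDegree_X_sub_C, add_comm]
    refine absurd (ih s (a + 1) (by omega) fun k hk => ?_) hs
    have h1 := hq k (by omega)
    rw [Polynomial.eval_mul, Polynomial.eval_sub, Polynomial.eval_X, Polynomial.eval_C] at h1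
    have h2 : (k : R) - (a : R) = algebraMap F R ((k : F) - (a : F)) := by simp
    have h3 : IsUnit ((k : R) - (a : R)) := by
      rw [h2]
      refine (IsUnit.mk0 _ (sub_ne_zero.2 ?_)).map _
      exact_mod_cast (show k ≠ a by omega)
    exact (h3.mul_right_eq_zero).1 h1

/-- The logarithm of `1 + n` for a matrix `n` with `n ^ m = 0`, as the derivative at `t = 0` of
`(1 + n) ^ t = ∑ binom(t, j) n ^ j`. -/
def logMatrix (F : Type u) [Field F] (m : ℕ) {R : Type u} [CommRing R] [Algebra F R]
    (n : Matrix ι ι R) : Matrix ι ι R :=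
  ∑ j ∈ Finset.range m, (binomPoly F j).coeff 1 • n ^ j

theorem binomPoly_zero : binomPoly F 0 = 1 := by simp [binomPoly]

theorem binomPoly_one : binomPoly F 1 = Polynomial.X := by simp [binomPoly]

/-- The value of a polynomial at `ε`. -/
theorem aeval_eps {R : Type u} [CommRing R] (q : Polynomial R) :
    Polynomial.aeval (TrivSqZeroExt.inr 1 : TrivSqZeroExt R R) q =
      TrivSqZeroExt.inl (q.coeff 0) + TrivSqZeroExt.inr (q.coeff 1) := by
  induction q using Polynomial.induction_on' with
  | add p q hp hq =>
    rw [map_add, hp, hq, Polynomial.coeff_add, Polynomial.coeff_add, TrivSqZeroExt.inl_add,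
      TrivSqZeroExt.inr_add]
    abel
  | monomial n a =>
    rw [Polynomial.aeval_monomial]
    match n with
    | 0 => simp [TrivSqZeroExt.algebraMap_eq_inl]
    | 1 =>
      rw [pow_one, TrivSqZeroExt.algebraMap_eq_inl, TrivSqZeroExt.inl_mul_inr]
      simp [Polynomial.coeff_monomial]
    | k + 2 =>
      rw [pow_add, pow_two, TrivSqZeroExt.inr_mul_inr]
      simp [Polynomial.coeff_monomial]

/-- The logarithm of a unipotent element is a tangent vector: the polynomial relations satisfied
by all powers `g ^ k`, `k ∈ ℕ`, hold for `g ^ t` with an indeterminate exponent `t`, and hence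
for `t = ε`. -/
theorem IsEquations.logMatrix_mem [CharZero F] (hS : IsEquations U S) {R : Type u} [CommRing R]
    [Algebra F R] {g : GL ι R} (hg : g ∈ U R) {m : ℕ} (hm : ((g : Matrix ι ι R) - 1) ^ m = 0) :
    logMatrix F m ((g : Matrix ι ι R) - 1) ∈ scalarExt (lieSpace S) R := by
  set n : Matrix ι ι R := (g : Matrix ι ι R) - 1 with hn
  let G : Matrix ι ι (Polynomial R) := Matrix.of fun i j =>
    ∑ l ∈ Finset.range m, (binomPoly F l).map (algebraMap F R) * Polynomial.C ((n ^ l) i j)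
  have heval : ∀ k : ℕ, G.map (Polynomial.eval (k : R)) = ((g ^ k : GL ι R) : Matrix ι ι R) := by
    intro k
    have h1 : G.map (Polynomial.eval (k : R)) =
        ∑ l ∈ Finset.range m, (k.choose l : R) • n ^ l := by
      ext i j
      have h2 : ∀ l, ((binomPoly F l).map (algebraMap F R)).eval (k : R) = (k.choose l : R) := by
        intro l
        have := Polynomial.eval_map_apply (algebraMap F R) (p := binomPoly F l) (k : F)
        rw [map_natCast, binomPoly_eval, map_natCast] at this
        exact this
      simp [G, Matrix.sum_apply, Polynomial.eval_finsetSum, h2]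
    have h3 : (g : Matrix ι ι R) = n + 1 := by rw [hn, sub_add_cancel]
    rw [h1, Units.val_pow_eq_pow_val, h3, Commute.add_pow (Commute.one_right n)]
    have h4 : ∑ l ∈ Finset.range m, (k.choose l : R) • n ^ l =
        ∑ l ∈ Finset.range (m + (k + 1)), (k.choose l : R) • n ^ l := by
      refine Finset.sum_subset (Finset.range_mono (by omega)) fun l _ hl => ?_
      rw [pow_eq_zero_of_le (by simpa using hl) hm, smul_zero]
    have h5 : ∑ l ∈ Finset.range (k + 1), (k.choose l : R) • n ^ l =
        ∑ l ∈ Finset.range (m + (k + 1)), (k.choose l : R) • n ^ l := by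
      refine Finset.sum_subset (Finset.range_mono (by omega)) fun l _ hl => ?_
      rw [Nat.choose_eq_zero_of_lt (by simpa using hl), Nat.cast_zero, zero_smul]
    rw [h4, ← h5]
    refine Finset.sum_congr rfl fun l _ => ?_
    rw [one_pow, mul_one, Nat.cast_smul_eq_nsmul, nsmul_eq_mul, Nat.cast_comm]
  have hG : ∀ p ∈ S, MvPolynomial.aeval (fun ij : ι × ι => G ij.1 ij.2) p = 0 := by
    intro p hp
    refine polynomial_eq_zero_of_forall_eval_natCast (F := F) _ _ 0 (Nat.lt_succ_self _)
      fun k _ => ?_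
    let e : Polynomial R →ₐ[F] R := (Polynomial.aeval (k : R)).restrictScalars F
    have he : ∀ q, e q = q.eval (k : R) := fun q => by
      change Polynomial.aeval (k : R) q = _
      rw [Polynomial.coe_aeval_eq_eval]
    rw [← he, ← aeval_entries_map]
    have : G.map e = ((g ^ k : GL ι R) : Matrix ι ι R) := by
      rw [← heval k]
      ext i j
      exact he _
    rw [this]
    exact (hS R _).1 (pow_mem hg k) p hp
  rw [← hS.dualGL_mem_iff, hS]
  intro p hp
  let e : Polynomial R →ₐ[F] TrivSqZeroExt R R :=
    (Polynomial.aeval (TrivSqZeroExt.inr 1 : TrivSqZeroExt R R)).restrictScalars F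
  have h1 : G.map e = ((dualGL (logMatrix F m n) : GL ι (TrivSqZeroExt R R)) :
      Matrix ι ι (TrivSqZeroExt R R)) := by
    refine Matrix.ext fun i j => ?_
    have h2 : e (G i j) = TrivSqZeroExt.inl ((G i j).coeff 0) +
        TrivSqZeroExt.inr ((G i j).coeff 1) := aeval_eps _
    have h3 : (G i j).coeff 1 = logMatrix F m n i j := by
      simp only [G, logMatrix, Matrix.sum_apply, Polynomial.finsetSum_coeff, Matrix.of_apply,
        Polynomial.coeff_mul_C, Polynomial.coeff_map, Matrix.smul_apply]
      exact Finset.sum_congr rfl fun l _ => (Algebra.smul_def _ _).symm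
    have h4 : (G i j).coeff 0 = (1 : Matrix ι ι R) i j := by
      have := congrFun (congrFun (heval 0) i) j
      rw [Polynomial.coeff_zero_eq_eval_zero]
      simpa using this
    rw [Matrix.map_apply, h2, h3, h4]
    change _ = (1 : Matrix ι ι (TrivSqZeroExt R R)) i j + _
    rw [← Matrix.map_one _ (TrivSqZeroExt.inl_zero R) (TrivSqZeroExt.inl_one R)]
    rfl
  rw [← h1, aeval_entries_map, hG p hp, map_zero]

/-! ### The Lie bracket -/

theorem map_inl_add_map_inr_mul {R : Type u} [CommRing R] (A B A' B' : Matrix ι ι R) :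
    (A.map TrivSqZeroExt.inl + B.map TrivSqZeroExt.inr : Matrix ι ι (TrivSqZeroExt R R)) *
      (A'.map TrivSqZeroExt.inl + B'.map TrivSqZeroExt.inr : Matrix ι ι (TrivSqZeroExt R R)) =
      (A * A').map TrivSqZeroExt.inl + (A * B' + B * A').map TrivSqZeroExt.inr := by
  refine Matrix.ext fun i j => TrivSqZeroExt.ext ?_ ?_
  · rw [Matrix.mul_apply, TrivSqZeroExt.fst_sum]
    simp [Matrix.mul_apply]
  · rw [Matrix.mul_apply, TrivSqZeroExt.snd_sum]
    simp [Matrix.mul_apply, Finset.sum_add_distrib, mul_comm]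

/-- The adjoint action of the group on its Lie algebra. -/
theorem IsEquations.conj_mem_lieSpace (hS : IsEquations U S) {R : Type u} [CommRing R]
    [Algebra F R] {g : GL ι R} (hg : g ∈ U R) {M : Matrix ι ι R}
    (hM : M ∈ scalarExt (lieSpace S) R) :
    (g : Matrix ι ι R) * M * ((g⁻¹ : GL ι R) : Matrix ι ι R) ∈ scalarExt (lieSpace S) R := by
  rw [← hS.dualGL_mem_iff] at hM ⊢
  have h2 := hS.map_mem (TrivSqZeroExt.inlAlgHom F R R) hg
  have h3 := mul_mem (mul_mem h2 hM) (inv_mem h2)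
  convert h3 using 1
  rw [← map_inv]
  ext1
  change 1 + ((g : Matrix ι ι R) * M * ((g⁻¹ : GL ι R) : Matrix ι ι R)).map TrivSqZeroExt.inr =
    (g : Matrix ι ι R).map TrivSqZeroExt.inl * (1 + M.map TrivSqZeroExt.inr) *
      ((g⁻¹ : GL ι R) : Matrix ι ι R).map TrivSqZeroExt.inl
  have h4 : (g : Matrix ι ι R).map TrivSqZeroExt.inl *
      ((g⁻¹ : GL ι R) : Matrix ι ι R).map TrivSqZeroExt.inl =
      (1 : Matrix ι ι (TrivSqZeroExt R R)) := by
    have h := congrArg (RingHom.mapMatrix (TrivSqZeroExt.inlHom R R)) g.mul_inv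
    rw [map_mul, map_one] at h
    exact h
  rw [mul_add, add_mul, mul_one, h4]
  congr 1
  refine Matrix.ext fun i j => ?_
  simp only [Matrix.mul_apply, Matrix.map_apply, TrivSqZeroExt.inr_sum, Finset.sum_mul]
  refine Finset.sum_congr rfl fun k _ => Finset.sum_congr rfl fun l _ => ?_
  rw [TrivSqZeroExt.inl_mul_inr, TrivSqZeroExt.inr_mul_inl]
  simp

/-- The bracket of `N` and `M` is the coefficient of `ε` in the conjugate of `M` by `1 + ε N`. -/
theorem IsEquations.commutator_mem_lieSpace (hS : IsEquations U S) {M N : Matrix ι ι F}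
    (hM : M ∈ lieSpace S) (hN : N ∈ lieSpace S) : N * M - M * N ∈ lieSpace S := by
  have h1 : dualGL N ∈ U (TrivSqZeroExt F F) := by
    rw [hS.dualGL_mem_iff]
    intro f
    have : N.map f = f 1 • N := by
      ext i j
      simp only [Matrix.map_apply, Matrix.smul_apply, smul_eq_mul]
      rw [mul_comm, ← smul_eq_mul, ← map_smul, smul_eq_mul, mul_one]
    rw [this]
    exact Submodule.smul_mem _ _ hN
  have h2 := hS.conj_mem_lieSpace h1
    (map_mem_scalarExt (R := TrivSqZeroExt F F) hM) (TrivSqZeroExt.sndHom F F)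
  convert h2 using 1
  have h3 : ((dualGL N : GL ι (TrivSqZeroExt F F)) : Matrix ι ι (TrivSqZeroExt F F)) =
      (1 : Matrix ι ι F).map TrivSqZeroExt.inl + N.map TrivSqZeroExt.inr := by
    rw [Matrix.map_one _ (TrivSqZeroExt.inl_zero F) (TrivSqZeroExt.inl_one F)]
    rfl
  have h4 : (((dualGL N)⁻¹ : GL ι (TrivSqZeroExt F F)) : Matrix ι ι (TrivSqZeroExt F F)) =
      (1 : Matrix ι ι F).map TrivSqZeroExt.inl + (-N).map TrivSqZeroExt.inr := by
    rw [Matrix.map_one _ (TrivSqZeroExt.inl_zero F) (TrivSqZeroExt.inl_one F)]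
    rfl
  have h5 : M.map (algebraMap F (TrivSqZeroExt F F)) =
      M.map TrivSqZeroExt.inl + (0 : Matrix ι ι F).map TrivSqZeroExt.inr := by
    rw [Matrix.map_zero _ (TrivSqZeroExt.inr_zero F), add_zero]
    rfl
  rw [h3, h4, h5, map_inl_add_map_inr_mul, map_inl_add_map_inr_mul]
  ext i j
  simp
  ring

end Exponential

/-! ### Filtrations of algebras of nilpotent matrices -/

section Filtration

variable {F : Type u} [Field F] {ι : Type} [Fintype ι] [DecidableEq ι]

attribute [local instance] LieRing.ofAssociativeRing LieAlgebra.ofAssociativeAlgebra in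
/-- Engel's theorem: a Lie algebra of nilpotent matrices is strictly triangular with respect to a
flag. -/
theorem exists_flag_of_isNilpotent (L : Submodule F (Matrix ι ι F))
    (hcomm : ∀ M ∈ L, ∀ N ∈ L, N * M - M * N ∈ L) (hnil : ∀ N ∈ L, IsNilpotent N) :
    ∃ (V : ℕ → Submodule F (ι → F)) (m : ℕ), V 0 = ⊤ ∧ V m = ⊥ ∧ Antitone V ∧
      ∀ N ∈ L, ∀ j, ∀ v ∈ V j, N *ᵥ v ∈ V (j + 1) := by
  let L' : LieSubalgebra F (Module.End F (ι → F)) :=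
    { L.map (Matrix.toLin' : Matrix ι ι F ≃ₗ[F] _).toLinearMap with
      lie_mem' := by
        rintro _ _ ⟨M, hM, rfl⟩ ⟨N, hN, rfl⟩
        refine ⟨M * N - N * M, hcomm N hN M hM, ?_⟩
        change Matrix.toLin' (M * N - N * M) = ⁅Matrix.toLin' M, Matrix.toLin' N⁆
        rw [Ring.lie_def, map_sub, Matrix.toLin'_mul, Matrix.toLin'_mul]
        rfl }
  have hn : LieModule.IsNilpotent L' (ι → F) := by
    rw [LieModule.isNilpotent_iff_forall' (R := F)]
    rintro ⟨_, M, hM, rfl⟩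
    obtain ⟨k, hk⟩ := hnil M hM
    refine ⟨k, ?_⟩
    have h1 : (LieModule.toEnd F L' (ι → F)) ⟨Matrix.toLin' M, M, hM, rfl⟩ = Matrix.toLin' M := rfl
    change ((LieModule.toEnd F L' (ι → F)) ⟨Matrix.toLin' M, M, hM, rfl⟩) ^ k = 0
    rw [h1, ← Matrix.toLin'_pow, hk, map_zero]
  obtain ⟨m, hm⟩ := (LieModule.isNilpotent_iff F L' (ι → F)).1 hn
  refine ⟨fun j => (LieModule.lowerCentralSeries F L' (ι → F) j : Submodule F (ι → F)), m, ?_, ?_,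
    ?_, ?_⟩
  · simp
  · simp [hm]
  · exact fun i j h => LieModule.antitone_lowerCentralSeries F L' (ι → F) h
  · intro N hN j v hv
    change N *ᵥ v ∈ LieModule.lowerCentralSeries F L' (ι → F) (j + 1)
    rw [LieModule.lowerCentralSeries_succ]
    exact LieSubmodule.lie_mem_lie (LieSubmodule.mem_top (⟨Matrix.toLin' N, N, hN, rfl⟩ : L')) hv

/-- A multiplicative filtration of the algebra of matrices that ends with `0`. The requirement
`2 ≤ m` ensures that the exponential and the logarithm truncated in degree `m` contain the linear
term. -/
structure IsNilpotentFiltration (𝔫 : ℕ → Submodule F (Matrix ι ι F)) (m : ℕ) : Prop where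
  mul : ∀ {k l x y}, x ∈ 𝔫 k → y ∈ 𝔫 l → x * y ∈ 𝔫 (k + l)
  anti : Antitone 𝔫
  bot : 𝔫 m = ⊥
  two_le : 2 ≤ m

/-- The filtration by the matrices that shift a given flag by `k` steps. -/
theorem exists_filtration_of_flag {V : ℕ → Submodule F (ι → F)} {m : ℕ} (h0 : V 0 = ⊤)
    (hm : V m = ⊥) (hV : Antitone V) : ∃ (𝔫 : ℕ → Submodule F (Matrix ι ι F)) (m' : ℕ),
      IsNilpotentFiltration 𝔫 m' ∧
      ∀ k M, M ∈ 𝔫 k ↔ ∀ j, ∀ v ∈ V j, M *ᵥ v ∈ V (j + k) := by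
  let 𝔫 : ℕ → Submodule F (Matrix ι ι F) := fun k =>
    { carrier := {M | ∀ j, ∀ v ∈ V j, M *ᵥ v ∈ V (j + k)}
      zero_mem' := fun j v _ => by rw [Matrix.zero_mulVec]; exact Submodule.zero_mem _
      add_mem' := fun hM hN j v hv => by
        rw [Matrix.add_mulVec]
        exact Submodule.add_mem _ (hM j v hv) (hN j v hv)
      smul_mem' := fun c M hM j v hv => by
        rw [Matrix.smul_mulVec]
        exact Submodule.smul_mem _ _ (hM j v hv) }
  refine ⟨𝔫, m + 2, ⟨?_, ?_, ?_, by omega⟩, fun k M => Iff.rfl⟩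
  · intro k l x y hx hy j v hv
    rw [← Matrix.mulVec_mulVec]
    have := hx _ _ (hy j v hv)
    rwa [add_assoc, add_comm l k] at this
  · intro k l hkl M hM j v hv
    exact hV (by omega) (hM j v hv)
  · refine (Submodule.eq_bot_iff _).2 fun M hM => ?_
    have h1 : ∀ v, M *ᵥ v = 0 := fun v => by
      have h2 := hV (show m ≤ 0 + (m + 2) by omega) (hM 0 v (by rw [h0]; trivial))
      rw [hm] at h2
      exact (Submodule.mem_bot F).1 h2
    apply Matrix.toLin'.injective
    ext1 i
    ext1
    simp [h1]

variable {𝔫 : ℕ → Submodule F (Matrix ι ι F)} {m : ℕ} {R : Type u} [CommRing R] [Algebra F R]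

theorem IsNilpotentFiltration.mul_mem (h : IsNilpotentFiltration 𝔫 m) {k l : ℕ}
    {x y : Matrix ι ι R} (hx : x ∈ scalarExt (𝔫 k) R) (hy : y ∈ scalarExt (𝔫 l) R) :
    x * y ∈ scalarExt (𝔫 (k + l)) R :=
  mul_mem_scalarExt (fun _ hx _ hy => h.mul hx hy) hx hy

theorem IsNilpotentFiltration.mem_of_le (h : IsNilpotentFiltration 𝔫 m) {k l : ℕ} (hkl : k ≤ l)
    {x : Matrix ι ι R} (hx : x ∈ scalarExt (𝔫 l) R) : x ∈ scalarExt (𝔫 k) R :=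
  scalarExt_mono (h.anti hkl) R hx

theorem IsNilpotentFiltration.pow_mem (h : IsNilpotentFiltration 𝔫 m) {k : ℕ}
    {x : Matrix ι ι R} (hx : x ∈ scalarExt (𝔫 k) R) (j : ℕ) :
    x ^ (j + 1) ∈ scalarExt (𝔫 (k * (j + 1))) R := by
  induction j with
  | zero => simpa using hx
  | succ j ih =>
    rw [pow_succ]
    exact h.mul_mem ih hx

theorem IsNilpotentFiltration.eq_zero (h : IsNilpotentFiltration 𝔫 m) {x : Matrix ι ι R} {k : ℕ}
    (hk : m ≤ k) (hx : x ∈ scalarExt (𝔫 k) R) : x = 0 := by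
  have := h.mem_of_le hk hx
  rw [h.bot, scalarExt_bot] at this
  exact (Submodule.mem_bot R).1 this

theorem IsNilpotentFiltration.pow_eq_zero (h : IsNilpotentFiltration 𝔫 m) {x : Matrix ι ι R}
    (hx : x ∈ scalarExt (𝔫 1) R) : x ^ m = 0 := by
  have h2 := h.two_le
  obtain ⟨m', rfl⟩ : ∃ m', m = m' + 1 := ⟨m - 1, by omega⟩
  have := h.pow_mem hx m'
  exact h.eq_zero (by omega) this

theorem IsNilpotentFiltration.pow_mem_succ (h : IsNilpotentFiltration 𝔫 m) {k : ℕ} (hk : 1 ≤ k)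
    {x : Matrix ι ι R} (hx : x ∈ scalarExt (𝔫 k) R) (j : ℕ) :
    x ^ (j + 2) ∈ scalarExt (𝔫 (k + 1)) R := by
  refine h.mem_of_le ?_ (h.pow_mem hx (j + 1))
  nlinarith

theorem smul_mem_scalarExt {W : Submodule F (Matrix ι ι F)} (c : F) {x : Matrix ι ι R}
    (hx : x ∈ scalarExt W R) : c • x ∈ scalarExt W R := by
  rw [algebra_compatible_smul R c x]
  exact Submodule.smul_mem _ _ hx

theorem IsNilpotentFiltration.expMatrix_sub_mem (h : IsNilpotentFiltration 𝔫 m) {k : ℕ}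
    (hk : 1 ≤ k) {x : Matrix ι ι R} (hx : x ∈ scalarExt (𝔫 k) R) :
    expMatrix F m x - 1 - x ∈ scalarExt (𝔫 (k + 1)) R := by
  have h2 := h.two_le
  obtain ⟨m', rfl⟩ : ∃ m', m = m' + 2 := ⟨m - 2, by omega⟩
  have h1 : expMatrix F (m' + 2) x - 1 - x =
      ∑ l ∈ Finset.range m', (((l + 2).factorial : F)⁻¹) • x ^ (l + 2) := by
    rw [expMatrix, Finset.sum_range_succ', Finset.sum_range_succ']
    simp only [Nat.factorial_zero, Nat.cast_one, inv_one, pow_zero, one_smul, zero_add,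
      Nat.factorial_one, pow_one]
    abel
  rw [h1]
  exact Submodule.sum_mem _ fun l _ => smul_mem_scalarExt _ (h.pow_mem_succ hk hx l)

theorem IsNilpotentFiltration.logMatrix_sub_mem (h : IsNilpotentFiltration 𝔫 m) {k : ℕ}
    (hk : 1 ≤ k) {x : Matrix ι ι R} (hx : x ∈ scalarExt (𝔫 k) R) :
    logMatrix F m x - x ∈ scalarExt (𝔫 (k + 1)) R := by
  have h2 := h.two_le
  obtain ⟨m', rfl⟩ : ∃ m', m = m' + 2 := ⟨m - 2, by omega⟩
  have h1 : logMatrix F (m' + 2) x - x =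
      ∑ l ∈ Finset.range m', (binomPoly F (l + 2)).coeff 1 • x ^ (l + 2) := by
    rw [logMatrix, Finset.sum_range_succ', Finset.sum_range_succ', binomPoly_zero, zero_add,
      binomPoly_one, Polynomial.coeff_X_one, Polynomial.coeff_one]
    simp
  rw [h1]
  exact Submodule.sum_mem _ fun l _ => smul_mem_scalarExt _ (h.pow_mem_succ hk hx l)

/-- A nilpotent matrix `n` is a polynomial without constant term in the logarithm of `1 + n`, so it
lies in every nonunital algebra `T` that contains this logarithm. -/
theorem mem_of_logMatrix_mem [CharZero F] {n : Matrix ι ι R} {m : ℕ} (hn : n ^ m = 0)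
    {T : Submodule R (Matrix ι ι R)} (hT : ∀ x ∈ T, ∀ y ∈ T, x * y ∈ T)
    (hlog : logMatrix F (m + 2) n ∈ T) : n ∈ T := by
  let Λ : Polynomial F := ∑ j ∈ Finset.range (m + 2),
    Polynomial.C ((binomPoly F j).coeff 1) * Polynomial.X ^ j
  have hΛ : Polynomial.aeval n Λ = logMatrix F (m + 2) n := by
    rw [map_sum, logMatrix]
    refine Finset.sum_congr rfl fun j _ => ?_
    rw [map_mul, Polynomial.aeval_C, map_pow, Polynomial.aeval_X, ← Algebra.smul_def]
  obtain ⟨v, hv⟩ : ∃ v : Polynomial F, Λ = Polynomial.X * (1 + Polynomial.X * v) := by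
    refine ⟨∑ j ∈ Finset.range m, Polynomial.C ((binomPoly F (j + 2)).coeff 1) *
      Polynomial.X ^ j, ?_⟩
    simp only [Λ]
    rw [Finset.sum_range_succ', Finset.sum_range_succ', binomPoly_zero, zero_add,
      binomPoly_one, Polynomial.coeff_X_one, Polynomial.coeff_one, mul_add, ← mul_assoc,
      Finset.mul_sum]
    simp only [one_ne_zero, if_false, map_zero, zero_mul, add_zero, map_one, one_mul, pow_one,
      mul_one]
    rw [add_comm]
    congr 1
    exact Finset.sum_congr rfl fun j _ => by ring
  have hpow : ∀ j, logMatrix F (m + 2) n ^ (j + 1) ∈ T := by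
    intro j
    induction j with
    | zero => simpa using hlog
    | succ j ih => rw [pow_succ]; exact hT _ ih _ hlog
  -- descending induction on the order of vanishing
  have key : ∀ d j : ℕ, 1 ≤ j → m ≤ j + d → ∀ q : Polynomial F,
      Polynomial.aeval n (Polynomial.X ^ j * q) ∈ T := by
    intro d
    induction d with
    | zero =>
      intro j _ hj q
      rw [map_mul, map_pow, Polynomial.aeval_X, pow_eq_zero_of_le (by simpa using hj) hn, zero_mul]
      exact T.zero_mem
    | succ d ih =>
      intro j hj hjm q
      obtain ⟨w, hw⟩ : Polynomial.X * v ∣ (1 + Polynomial.X * v) ^ j - 1 := by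
        have := sub_dvd_pow_sub_pow (1 + Polynomial.X * v) 1 j
        rwa [one_pow, add_sub_cancel_left] at this
      have h1 : (Polynomial.X ^ j * q : Polynomial F) =
          Polynomial.C (q.coeff 0) * Λ ^ j + Polynomial.X ^ (j + 1) *
            (q.divX - Polynomial.C (q.coeff 0) * (v * w)) := by
        have h2 : (1 + Polynomial.X * v) ^ j = 1 + Polynomial.X * v * w := by
          rw [← hw]; ring
        rw [hv, mul_pow, h2]
        conv_lhs => rw [← Polynomial.divX_mul_X_add q]
        ring
      rw [h1, map_add]
      refine T.add_mem ?_ (ih (j + 1) (by omega) (by omega) _)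
      rw [map_mul, Polynomial.aeval_C, map_pow, hΛ, ← Algebra.smul_def,
        algebra_compatible_smul R (q.coeff 0)]
      obtain ⟨j', rfl⟩ : ∃ j', j = j' + 1 := ⟨j - 1, by omega⟩
      exact T.smul_mem _ (hpow j')
  have := key m 1 le_rfl (by omega) 1
  simpa using this

/-- The exponential of `x`, an element of the first step of a filtration, as an invertible matrix. -/
def IsNilpotentFiltration.expGL (h : IsNilpotentFiltration 𝔫 m) (x : Matrix ι ι R)
    (hx : x ∈ scalarExt (𝔫 1) R) : GL ι R :=
  have hm : (1 - expMatrix F m x) ^ m = 0 := by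
    refine h.pow_eq_zero ?_
    have h1 := h.mem_of_le (show 1 ≤ 1 + 1 by omega) (h.expMatrix_sub_mem le_rfl hx)
    have h2 := Submodule.neg_mem _ (Submodule.add_mem _ h1 hx)
    convert h2 using 1
    abel
  { val := expMatrix F m x
    inv := ∑ i ∈ Finset.range m, (1 - expMatrix F m x) ^ i
    val_inv := by
      have := mul_neg_geom_sum (1 - expMatrix F m x) m
      rwa [hm, sub_zero, sub_sub_cancel] at this
    inv_val := by
      have := geom_sum_mul_neg (1 - expMatrix F m x) m
      rwa [hm, sub_zero, sub_sub_cancel] at this }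

variable {U : MatGroup F ι} {S : Set (MvPolynomial (ι × ι) F)}

theorem IsEquations.expGL_mem [CharZero F] (hS : IsEquations U S)
    (h : IsNilpotentFiltration 𝔫 m) {x : Matrix ι ι R} (hx : x ∈ scalarExt (𝔫 1) R)
    (hx' : x ∈ scalarExt (lieSpace S) R) : h.expGL x hx ∈ U R :=
  (hS _ _).2 fun _ hp => hS.aeval_expMatrix hx' (h.pow_eq_zero hx) hp

/-- The Lie algebra of a unipotent group lies in the first step of a nilpotent filtration, and `g - 1`
does so for all points `g` of the group. -/
theorem IsEquations.exists_filtration [CharZero F] (hS : IsEquations U S)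
    (hU : ∀ (R : Type u) [CommRing R] [Algebra F R], ∀ g ∈ U R,
      IsNilpotent ((g : Matrix ι ι R) - 1)) :
    ∃ (𝔫 : ℕ → Submodule F (Matrix ι ι F)) (m : ℕ), IsNilpotentFiltration 𝔫 m ∧
      lieSpace S ≤ 𝔫 1 ∧ ∀ (R : Type u) [CommRing R] [Algebra F R], ∀ g ∈ U R,
        (g : Matrix ι ι R) - 1 ∈ scalarExt (𝔫 1) R := by
  have hnil : ∀ N ∈ lieSpace S, IsNilpotent N := by
    intro N hN
    have h1 := hS.isNilpotent_of_mem_lieSpace hU (map_mem_scalarExt (R := F) hN)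
    rwa [show N.map (algebraMap F F) = N from by ext; simp] at h1
  obtain ⟨V, m, h0, hm, hV, hL⟩ := exists_flag_of_isNilpotent (lieSpace S)
    (fun M hM N hN => hS.commutator_mem_lieSpace hM hN) hnil
  obtain ⟨𝔫, m', h𝔫, hmem⟩ := exists_filtration_of_flag h0 hm hV
  have hle : lieSpace S ≤ 𝔫 1 := fun N hN => (hmem 1 N).2 (hL N hN)
  refine ⟨𝔫, m', h𝔫, hle, fun R _ _ g hg => ?_⟩
  obtain ⟨k, hk⟩ := hU R g hg
  refine mem_of_logMatrix_mem (F := F) hk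
    (fun x hx y hy => h𝔫.mem_of_le (by omega) (h𝔫.mul_mem hx hy)) ?_
  exact scalarExt_mono hle R (hS.logMatrix_mem hg (pow_eq_zero_of_le (by omega) hk))

theorem IsEquations.logMatrix_mem_inf [CharZero F] (hS : IsEquations U S)
    (h : IsNilpotentFiltration 𝔫 m) {k : ℕ} (hk : 1 ≤ k) {g : GL ι R} (hg : g ∈ U R)
    (hgk : (g : Matrix ι ι R) - 1 ∈ scalarExt (𝔫 k) R) :
    logMatrix F m ((g : Matrix ι ι R) - 1) ∈ scalarExt (lieSpace S ⊓ 𝔫 k) R := by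
  rw [scalarExt_inf]
  refine ⟨hS.logMatrix_mem hg (h.pow_eq_zero (h.mem_of_le hk hgk)), ?_⟩
  have h1 := h.mem_of_le (by omega) (h.logMatrix_sub_mem hk hgk) (k := k)
  simpa using Submodule.add_mem _ h1 hgk

end Filtration

/-! ### Compactness and means for unipotent groups -/

section CentralFiltration

open scoped Pointwise

variable {G : Type*} [Group G] [TopologicalSpace G] [IsTopologicalGroup G]

/-- A group with a central filtration whose steps are generated, up to the next step, by `Γ` and a
compact set is compact modulo `Γ` and has an ergodic mean. -/
theorem exists_isErgodicMean_of_filtration {A Γ : Subgroup G} (hΓ : Γ ≤ A) {u : ℕ → Subgroup G}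
    {m : ℕ} (h0 : u 0 = A) (hm : u m = ⊥) (hanti : ∀ k, u (k + 1) ≤ u k)
    (hcomm : ∀ k, ∀ a ∈ A, ∀ z ∈ u k, a * z * a⁻¹ * z⁻¹ ∈ u (k + 1))
    (hdec : ∀ k, ∃ K : Set G, IsCompact K ∧ K ⊆ u k ∧
      ∀ z ∈ u k, ∃ γ ∈ Γ ⊓ u k, ∃ κ ∈ K, ∃ w ∈ u (k + 1), z = γ * κ * w) :
    IsCocompact A Γ ∧ ∃ μ, IsErgodicMean A Γ μ := by
  have hle : ∀ k, u k ≤ A := fun k => by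
    induction k with
    | zero => exact h0.le
    | succ k ih => exact (hanti k).trans ih
  have hconj : ∀ k, ∀ a ∈ A, ∀ z ∈ u k, a * z * a⁻¹ ∈ u k := fun k a ha z hz => by
    have := (u k).mul_mem (hanti k (hcomm k a ha z hz)) hz
    simpa using this
  have hmem : ∀ k x, x ∈ Γ ⊔ u k ↔ ∃ γ ∈ Γ, ∃ c ∈ u k, x = γ * c := fun k x =>
    mem_sup_iff_exists_mul fun γ hγ c hc => hconj k γ (hΓ hγ) c hc
  have key : ∀ k, IsCocompact A (Γ ⊔ u k) ∧ ∃ μ, IsErgodicMean A (Γ ⊔ u k) μ := by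
    intro k
    induction k with
    | zero =>
      rw [h0, sup_eq_right.2 hΓ]
      exact ⟨⟨{1}, isCompact_singleton, by simp,
        fun a ha => ⟨a, ha, 1, rfl, (mul_one a).symm⟩⟩, _, isErgodicMean_self⟩
    | succ k ih =>
      obtain ⟨⟨K', hK', hK'A, hcov⟩, μ, hμ⟩ := ih
      obtain ⟨K, hK, hKu, hKd⟩ := hdec k
      have hsup : (Γ ⊔ u (k + 1)) ⊔ u k = Γ ⊔ u k := by
        rw [sup_assoc, sup_eq_right.2 (hanti k)]
      have hco : IsCocompact A (Γ ⊔ u (k + 1)) := by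
        refine ⟨K * K', hK.mul hK', ?_, fun a ha => ?_⟩
        · rintro _ ⟨x, hx, y, hy, rfl⟩
          exact A.mul_mem (hle k (hKu hx)) (hK'A hy)
        · obtain ⟨y, hy, κ', hκ', rfl⟩ := hcov a ha
          obtain ⟨γ, hγ, z, hz, rfl⟩ := (hmem k y).1 hy
          obtain ⟨γ', hγ', κ, hκ, w, hw, rfl⟩ := hKd z hz
          refine ⟨γ * γ' * (κ * w * κ⁻¹), (hmem (k + 1) _).2 ⟨γ * γ', Γ.mul_mem hγ hγ'.1,
            κ * w * κ⁻¹, hconj (k + 1) κ (hle k (hKu hκ)) w hw, rfl⟩, κ * κ',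
            ⟨κ, hκ, κ', hκ', rfl⟩, by group⟩
      refine ⟨hco, ?_⟩
      refine IsErgodicMean.of_central (A := A) (L := Γ ⊔ u (k + 1)) (Z := u k)
        (sup_le hΓ (hle _)) (hle k)
        (fun a ha z hz => le_sup_right (a := Γ) (hcomm k a ha z hz)) ?_ hco (hsup ▸ hμ)
      refine ⟨K, hK, hKu, fun z hz => ?_⟩
      obtain ⟨γ, hγ, κ, hκ, w, hw, rfl⟩ := hKd z hz
      have h1 := hconj (k + 1) κ (hle k (hKu hκ)) w hw
      exact ⟨γ * (κ * w * κ⁻¹), ⟨(hmem (k + 1) _).2 ⟨γ, hγ.1, _, h1, rfl⟩,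
        (u k).mul_mem hγ.2 (hanti k h1)⟩, κ, hκ, by group⟩
  have := key m
  rwa [hm, sup_bot_eq] at this

end CentralFiltration

section UnipotentMean

variable {F : Type u} [Field F] {ι : Type} [Fintype ι] [DecidableEq ι]
variable {U : MatGroup F ι} {S : Set (MvPolynomial (ι × ι) F)}
variable {𝔫 : ℕ → Submodule F (Matrix ι ι F)} {m : ℕ} {R : Type u} [CommRing R] [Algebra F R]

theorem expMatrix_map {R' : Type u} [CommRing R'] [Algebra F R'] (φ : R →ₐ[F] R')
    (x : Matrix ι ι R) : (expMatrix F m x).map φ = expMatrix F m (x.map φ) := by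
  have := map_sum φ.mapMatrix (fun k => ((k.factorial : F)⁻¹) • x ^ k) (Finset.range m)
  simp only [map_smul, map_pow, AlgHom.mapMatrix_apply] at this
  exact this

/-- The points of `U` that are congruent to `1` modulo the step `𝔫 k` of a filtration. -/
def levelSubgroup (h : IsNilpotentFiltration 𝔫 m) {G : Subgroup (GL ι R)}
    (hG : ∀ g ∈ G, (g : Matrix ι ι R) - 1 ∈ scalarExt (𝔫 1) R) (k : ℕ) : Subgroup (GL ι R) where
  carrier := {g | g ∈ G ∧ (g : Matrix ι ι R) - 1 ∈ scalarExt (𝔫 k) R}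
  one_mem' := ⟨one_mem _, by simp⟩
  mul_mem' := by
    rintro a b ⟨ha, ha'⟩ ⟨hb, hb'⟩
    refine ⟨mul_mem ha hb, ?_⟩
    have h1 := h.mem_of_le (by omega) (h.mul_mem ha' (hG b hb)) (k := k)
    have h2 := add_mem (add_mem h1 ha') hb'
    convert h2 using 1
    rw [Units.val_mul]
    noncomm_ring
  inv_mem' := by
    rintro a ⟨ha, ha'⟩
    refine ⟨inv_mem ha, ?_⟩
    have h1 := h.mem_of_le (by omega) (h.mul_mem ha' (hG _ (inv_mem ha))) (k := k)
    have h2 := neg_mem (add_mem h1 ha')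
    convert h2 using 1
    have h3 := a.mul_inv
    rw [sub_mul, mul_sub, h3]
    noncomm_ring

theorem mul_mem_of_sub_mem (h : IsNilpotentFiltration 𝔫 m) {k : ℕ} {x y : Matrix ι ι R}
    (hx : x ∈ scalarExt (𝔫 k) R) (hy : y - 1 ∈ scalarExt (𝔫 1) R) :
    x * y ∈ scalarExt (𝔫 k) R := by
  have h1 := h.mem_of_le (by omega) (h.mul_mem hx hy) (k := k)
  have h2 := add_mem h1 hx
  rwa [mul_sub, mul_one, sub_add_cancel] at h2

theorem mul_mem_of_sub_mem' (h : IsNilpotentFiltration 𝔫 m) {k : ℕ} {x y : Matrix ι ι R}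
    (hx : x - 1 ∈ scalarExt (𝔫 1) R) (hy : y ∈ scalarExt (𝔫 k) R) :
    x * y ∈ scalarExt (𝔫 k) R := by
  have h1 := h.mem_of_le (by omega) (h.mul_mem hx hy) (k := k)
  have h2 := add_mem h1 hy
  rwa [sub_mul, one_mul, sub_add_cancel] at h2

theorem commutator_mem_levelSubgroup (h : IsNilpotentFiltration 𝔫 m) {G : Subgroup (GL ι R)}
    (hG : ∀ g ∈ G, (g : Matrix ι ι R) - 1 ∈ scalarExt (𝔫 1) R) {k : ℕ} {a z : GL ι R}
    (ha : a ∈ G) (hz : z ∈ levelSubgroup h hG k) :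
    a * z * a⁻¹ * z⁻¹ ∈ levelSubgroup h hG (k + 1) := by
  refine ⟨mul_mem (mul_mem (mul_mem ha hz.1) (inv_mem ha)) (inv_mem hz.1), ?_⟩
  have h1 := h.mem_of_le (by omega) (h.mul_mem (hG a ha) hz.2) (k := k + 1)
  have h2 := h.mul_mem hz.2 (hG a ha)
  have h3 := mul_mem_of_sub_mem h (sub_mem h1 h2) (hG _ (mul_mem (inv_mem ha) (inv_mem hz.1)))
  convert h3 using 1
  have h4 : (z : Matrix ι ι R) * (a : Matrix ι ι R) *
      ((a⁻¹ * z⁻¹ : GL ι R) : Matrix ι ι R) = 1 := by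
    rw [← Units.val_mul, ← Units.val_mul, ← Units.val_one]
    congr 1
    group
  have h5 : ((a : Matrix ι ι R) - 1) * ((z : Matrix ι ι R) - 1) -
      ((z : Matrix ι ι R) - 1) * ((a : Matrix ι ι R) - 1) =
      (a : Matrix ι ι R) * z - (z : Matrix ι ι R) * a := by noncomm_ring
  rw [h5, sub_mul, h4, ← Units.val_mul, ← Units.val_mul]
  congr 2
  group

end UnipotentMean

section Adelic

variable {F : Type u} [Field F] [NumberField F] {ι : Type} [Fintype ι] [DecidableEq ι]
variable {H U : MatGroup F ι}

theorem continuous_expMatrix (m : ℕ) :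
    Continuous fun x : Matrix ι ι (Adele F) => expMatrix F m x := by
  refine continuous_finsetSum _ fun k _ => ?_
  have : (fun x : Matrix ι ι (Adele F) => ((k.factorial : F)⁻¹) • x ^ k) =
      fun x => algebraMap F (Adele F) ((k.factorial : F)⁻¹) • x ^ k :=
    funext fun x => algebra_compatible_smul (Adele F) _ _
  rw [this]
  fun_prop

theorem mem_adelic {g : H (Adele F)} : g ∈ adelic H U ↔ (g : GL ι (Adele F)) ∈ U (Adele F) :=
  Iff.rfl

theorem mem_rational {g : H (Adele F)} : g ∈ rational H U ↔
    ∃ γ ∈ U F, GeneralLinearGroup.map (algebraMap F (Adele F)) γ = g :=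
  Iff.rfl

theorem IsEquations.rational_le {S : Set (MvPolynomial (ι × ι) F)} (hS : IsEquations U S) :
    rational H U ≤ adelic H U := by
  rintro g ⟨γ, hγ, hg⟩
  rw [mem_adelic, ← Subgroup.coe_subtype, ← hg]
  exact hS.map_mem (Algebra.ofId F (Adele F)) hγ

theorem IsUnipotentSubgroup.rational_le (hU : IsUnipotentSubgroup H U) :
    rational H U ≤ adelic H U := by
  obtain ⟨S, hS⟩ := hU.closed
  exact IsEquations.rational_le hS

/-- The adelic points of a unipotent group are compact modulo the rational points, and have a
unique invariant mean. In each step of the filtration an element is, up to the next step, the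
exponential of a combination `∑ aᵢ eᵢ` of a rational basis `e` of the Lie algebra, and each `aᵢ` is
the sum of a rational number and an adele in a fixed compact set. -/
theorem IsUnipotentSubgroup.exists_isErgodicMean (hU : IsUnipotentSubgroup H U) :
    IsCocompact (adelic H U) (rational H U) ∧
      ∃ μ, IsErgodicMean (adelic H U) (rational H U) μ := by
  obtain ⟨S, hS⟩ := hU.closed
  replace hS : IsEquations U S := hS
  obtain ⟨𝔫, m, h, hL, h1⟩ := hS.exists_filtration hU.unipotent
  obtain ⟨K₀, hK₀, hcov⟩ := exists_isCompact_add_rational (F := F)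
  let u : ℕ → Subgroup (H (Adele F)) := fun k =>
    (levelSubgroup h (h1 (Adele F)) (k + 1)).subgroupOf (H (Adele F))
  refine exists_isErgodicMean_of_filtration (u := u) (m := m) hU.rational_le ?_ ?_ ?_ ?_ ?_
  · ext g
    exact ⟨fun hg => hg.1, fun hg => ⟨hg, h1 _ _ hg⟩⟩
  · refine (Subgroup.eq_bot_iff_forall _).2 fun g hg => ?_
    have := h.eq_zero (by omega) hg.2
    ext1
    ext1
    exact sub_eq_zero.1 this
  · exact fun k g hg => ⟨hg.1, h.mem_of_le (by omega) hg.2⟩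
  · exact fun k a ha z hz => commutator_mem_levelSubgroup h (h1 _) ha hz
  · intro k
    let W : Submodule F (Matrix ι ι F) := lieSpace S ⊓ 𝔫 (k + 1)
    let e := Module.finBasis F W
    let x : (Fin (Module.finrank F W) → Adele F) → Matrix ι ι (Adele F) := fun b =>
      ∑ i, b i • (e i : Matrix ι ι F).map (algebraMap F (Adele F))
    have hxW : ∀ b, x b ∈ scalarExt W (Adele F) := fun b =>
      Submodule.sum_mem _ fun i _ =>
        Submodule.smul_mem _ _ (map_mem_scalarExt (Subtype.coe_prop (e i)))
    have hxk : ∀ b, x b ∈ scalarExt (𝔫 (k + 1)) (Adele F) := fun b =>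
      scalarExt_mono inf_le_right _ (hxW b)
    have hx1 : ∀ b, x b ∈ scalarExt (𝔫 1) (Adele F) := fun b =>
      h.mem_of_le (by omega) (hxk b)
    have hxU : ∀ b, h.expGL (x b) (hx1 b) ∈ U (Adele F) := fun b =>
      hS.expGL_mem h (hx1 b) (scalarExt_mono inf_le_left _ (hxW b))
    have hxe : ∀ b, expMatrix F m (x b) - 1 - x b ∈ scalarExt (𝔫 (k + 2)) (Adele F) := fun b =>
      h.expMatrix_sub_mem (by omega) (hxk b)
    have hxe' : ∀ b, expMatrix F m (x b) - 1 ∈ scalarExt (𝔫 (k + 1)) (Adele F) := fun b => by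
      have := add_mem (h.mem_of_le (by omega) (hxe b)) (hxk b)
      rwa [sub_add_cancel] at this
    let κ : (Fin (Module.finrank F W) → Adele F) → H (Adele F) := fun b =>
      ⟨h.expGL (x b) (hx1 b), hU.le _ (hxU b)⟩
    have hκu : ∀ b, κ b ∈ u k := fun b => ⟨hxU b, hxe' b⟩
    have hκ : Continuous κ := by
      have hx : Continuous x := by fun_prop
      have hex : Continuous fun b => expMatrix F m (x b) := (continuous_expMatrix m).comp hx
      refine Continuous.subtype_mk (Units.continuous_iff.2 ⟨hex, ?_⟩) _
      change Continuous fun b => ∑ i ∈ Finset.range m, (1 - expMatrix F m (x b)) ^ i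
      fun_prop
    refine ⟨κ '' Set.pi Set.univ fun _ => K₀, (isCompact_univ_pi fun _ => hK₀).image hκ, ?_, ?_⟩
    · rintro _ ⟨b, -, rfl⟩
      exact hκu b
    · intro z hz
      obtain ⟨a, ha⟩ := exists_eq_sum_of_mem_scalarExt e
        (hS.logMatrix_mem_inf h (by omega) hz.1 hz.2)
      choose q hq using fun i => hcov (a i)
      let γ := κ fun i => algebraMap F (Adele F) (q i)
      let b : Fin (Module.finrank F W) → Adele F := fun i => a i - algebraMap F (Adele F) (q i)
      have hγ : γ ∈ rational H U := by
        have hy : ∑ i, q i • (e i : Matrix ι ι F) ∈ W :=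
          Submodule.sum_mem _ fun i _ => Submodule.smul_mem _ _ (Subtype.coe_prop (e i))
        have hid : ∀ {N : Matrix ι ι F} {V : Submodule F (Matrix ι ι F)}, N ∈ V →
            N ∈ scalarExt V F := fun {N V} hN => by
          have := map_mem_scalarExt (R := F) hN
          rwa [show N.map (algebraMap F F) = N from by ext; simp] at this
        have hy1 : ∑ i, q i • (e i : Matrix ι ι F) ∈ scalarExt (𝔫 1) F :=
          h.mem_of_le (by omega) (hid hy.2)
        refine mem_rational.2 ⟨h.expGL _ hy1, hS.expGL_mem h hy1 (hid hy.1), ?_⟩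
        ext1
        change (expMatrix F m _).map (Algebra.ofId F (Adele F)) = expMatrix F m _
        rw [expMatrix_map]
        congr 1
        have := map_sum (Algebra.ofId F (Adele F)).mapMatrix
          (fun i => q i • (e i : Matrix ι ι F)) Finset.univ
        simp only [map_smul, AlgHom.mapMatrix_apply] at this
        refine this.trans (Finset.sum_congr rfl fun i _ => ?_)
        rw [algebra_compatible_smul (Adele F)]
        rfl
      refine ⟨γ, ⟨hγ, hκu _⟩, κ b, ⟨b, fun i _ => hq i, rfl⟩, (γ * κ b)⁻¹ * z, ?_, by group⟩
      have hmem : γ * κ b ∈ u k := mul_mem (hκu _) (hκu _)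
      refine ⟨mul_mem (inv_mem hmem.1) hz.1, ?_⟩
      -- both factors are known modulo the next step of the filtration
      have h2 : ((z : GL ι (Adele F)) : Matrix ι ι (Adele F)) -
          ((γ * κ b : H (Adele F)) : GL ι (Adele F)) ∈
          scalarExt (𝔫 (k + 2)) (Adele F) := by
        have e1 := h.logMatrix_sub_mem (show 1 ≤ k + 1 by omega) hz.2
        have e2 := h.mem_of_le (by omega) (h.mul_mem (hxe' fun i => algebraMap F (Adele F) (q i))
          (hxe' b)) (k := k + 2)
        have e3 := hxe fun i => algebraMap F (Adele F) (q i)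
        have e4 := hxe b
        have e5 : logMatrix F m (((z : GL ι (Adele F)) : Matrix ι ι (Adele F)) - 1) =
            x (fun i => algebraMap F (Adele F) (q i)) + x b := by
          refine ha.trans ?_
          simp only [x, b, ← Finset.sum_add_distrib, ← add_smul, add_sub_cancel]
        have e6 := neg_mem (add_mem (add_mem (add_mem e1 e2) e3) e4)
        convert e6 using 1
        have e7 : (((γ * κ b : H (Adele F)) : GL ι (Adele F)) : Matrix ι ι (Adele F)) =
          expMatrix F m (x fun i => algebraMap F (Adele F) (q i)) * expMatrix F m (x b) := rfl
        change _ = -(logMatrix F m (((z : GL ι (Adele F)) : Matrix ι ι (Adele F)) - 1) -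
          (((z : GL ι (Adele F)) : Matrix ι ι (Adele F)) - 1) + _ + _ + _)
        rw [e5, e7]
        noncomm_ring
      have h3 := mul_mem_of_sub_mem' h (h1 _ _ (inv_mem hmem.1)) h2
      convert h3 using 1
      rw [mul_sub]
      congr 1
      exact (Units.inv_mul ((γ * κ b : H (Adele F)) : GL ι (Adele F))).symm

end Adelic

/-! ### Extension of characters -/

section CharacterExtension

variable {G : Type*} [Group G]

/-- A multiplicative function on `A` that is continuous on `B` and trivial on `Γ` and `X` is
continuous on `A` if `A` is the product of the discrete group `Γ` and of compact subsets of `B` and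
`X`. -/
theorem continuousOn_of_eq_mul_mul [TopologicalSpace G] [IsTopologicalGroup G] [T2Space G]
    {A B X Γ : Subgroup G} (hB : B ≤ A) (hX : X ≤ A)
    (hΓ : Γ ≤ A) (hdisc : ∃ N ∈ 𝓝 (1 : G), ∀ γ ∈ Γ, γ ∈ N → γ = 1) {K K' : Set G}
    (hK : IsCompact K) (hKB : K ⊆ B) (hK' : IsCompact K') (hKX : K' ⊆ X)
    (hcov : ∀ a ∈ A, ∃ γ ∈ Γ, ∃ κ ∈ K, ∃ k ∈ K', a = γ * κ * k) {φ : G → Circle}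
    (hmul : ∀ a ∈ A, ∀ b ∈ A, φ (a * b) = φ a * φ b) (hφΓ : ∀ γ ∈ Γ, φ γ = 1)
    (hφX : ∀ x ∈ X, φ x = 1) (hφ : ContinuousOn φ B) : ContinuousOn φ A := by
  choose! γ hγ κ hκ k hk e using hcov
  have hval : ∀ g ∈ Γ, ∀ b ∈ K, ∀ x ∈ K', φ (g * b * x) = φ b := fun g hg b hb x hx => by
    rw [hmul _ (A.mul_mem (hΓ hg) (hB (hKB hb))) _ (hX (hKX hx)),
      hmul _ (hΓ hg) _ (hB (hKB hb)), hφΓ g hg, hφX x (hKX hx), one_mul, mul_one]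
  intro a ha
  refine (Filter.tendsto_iff_ultrafilter _ _ _).2 fun l hl => ?_
  have hlA : ∀ᶠ x in l, x ∈ A := hl self_mem_nhdsWithin
  have hla : Filter.Tendsto id (l : Filter G) (𝓝 a) := hl.trans nhdsWithin_le_nhds
  obtain ⟨κ₀, hκ₀, hκl⟩ := hK.ultrafilter_le_nhds (l.map κ)
    (Filter.le_principal_iff.2 (hlA.mono fun x hx => hκ x hx))
  obtain ⟨k₀, hk₀, hkl⟩ := hK'.ultrafilter_le_nhds (l.map k)
    (Filter.le_principal_iff.2 (hlA.mono fun x hx => hk x hx))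
  have hκl : Filter.Tendsto κ l (𝓝 κ₀) := hκl
  have hkl : Filter.Tendsto k l (𝓝 k₀) := hkl
  have hγl : Filter.Tendsto γ l (𝓝 (a * (κ₀ * k₀)⁻¹)) := by
    refine (hla.mul (hκl.mul hkl).inv).congr' (hlA.mono fun x hx => ?_)
    change x * (κ x * k x)⁻¹ = γ x
    nth_rewrite 1 [e x hx]
    group
  -- as `Γ` is discrete, `γ` is constant along the ultrafilter
  obtain ⟨N, hN, hN1⟩ := hdisc
  have hpair : Filter.Tendsto (fun p : G × G => p.1⁻¹ * p.2)
      (𝓝 (a * (κ₀ * k₀)⁻¹) ×ˢ 𝓝 (a * (κ₀ * k₀)⁻¹)) (𝓝 1) := by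
    rw [← nhds_prod_eq, show (1 : G) = (a * (κ₀ * k₀)⁻¹)⁻¹ * (a * (κ₀ * k₀)⁻¹) by group]
    exact (continuous_fst.inv.mul continuous_snd).tendsto
      ((a * (κ₀ * k₀)⁻¹, a * (κ₀ * k₀)⁻¹) : G × G)
  obtain ⟨V, hV, hVN⟩ := Filter.mem_prod_same_iff.1 (hpair hN)
  obtain ⟨x₀, hx₀A, hx₀⟩ := (hlA.and (hγl hV)).exists
  have hconst : ∀ᶠ x in l, γ x = γ x₀ := (hlA.and (hγl hV)).mono fun x ⟨hxA, hx⟩ => by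
    have := hN1 _ (Γ.mul_mem (Γ.inv_mem (hγ x₀ hx₀A)) (hγ x hxA))
      (hVN (Set.mk_mem_prod hx₀ hx))
    exact (inv_mul_eq_one.1 this).symm
  have hγ₀ : γ x₀ = a * (κ₀ * k₀)⁻¹ :=
    tendsto_nhds_unique (tendsto_const_nhds.congr' (hconst.mono fun x hx => hx.symm)) hγl
  have ha' : a = γ x₀ * κ₀ * k₀ := by rw [hγ₀]; group
  rw [ha', hval _ (hγ x₀ hx₀A) κ₀ hκ₀ k₀ hk₀]
  have h1 : Filter.Tendsto κ l (𝓝[B] κ₀) :=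
    tendsto_nhdsWithin_iff.2 ⟨hκl, hlA.mono fun x hx => hKB (hκ x hx)⟩
  refine ((hφ κ₀ (hKB hκ₀)).tendsto.comp h1).congr' (hlA.mono fun x hx => ?_)
  rw [Function.comp_apply, ← hval _ (hγ x hx) _ (hκ x hx) _ (hk x hx), ← e x hx]

/-- A character of `B` that is invariant under `X` and trivial on `X ∩ B` extends to `X B`. -/
theorem exists_extension_of_normalizes {X B : Subgroup G}
    (hnorm : ∀ x ∈ X, ∀ b ∈ B, x * b * x⁻¹ ∈ B) {φ : G → Circle}
    (hmul : ∀ a ∈ B, ∀ b ∈ B, φ (a * b) = φ a * φ b)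
    (hinv : ∀ x ∈ X, ∀ b ∈ B, φ (x * b * x⁻¹) = φ b) (htriv : ∀ x ∈ X, x ∈ B → φ x = 1) :
    ∃ χ : (X ⊔ B : Subgroup G) →* Circle, (∀ x (hx : x ∈ X), χ ⟨x, Subgroup.mem_sup_left hx⟩ = 1) ∧
      ∀ b (hb : b ∈ B), χ ⟨b, Subgroup.mem_sup_right hb⟩ = φ b := by
  have hmem : ∀ g, g ∈ X ⊔ B ↔ ∃ x ∈ X, ∃ b ∈ B, g = x * b := fun g => mem_sup_iff_exists_mul hnorm
  have hdec : ∀ g : (X ⊔ B : Subgroup G), ∃ b ∈ B, ∃ x ∈ X, (g : G) = x * b := fun g => by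
    obtain ⟨x, hx, b, hb, e⟩ := (hmem g).1 g.2
    exact ⟨b, hb, x, hx, e⟩
  choose b hb x hx e using hdec
  -- the value does not depend on the decomposition
  have huniq : ∀ (g : (X ⊔ B : Subgroup G)) (x' b' : G), x' ∈ X → b' ∈ B → (g : G) = x' * b' →
      φ (b g) = φ b' := fun g x' b' hx' hb' he => by
    have h1 : x'⁻¹ * x g = b' * (b g)⁻¹ := by
      rw [inv_mul_eq_iff_eq_mul, ← mul_assoc, ← he, e g, mul_inv_cancel_right]
    have h2 : φ (b' * (b g)⁻¹) = 1 := htriv _ (h1 ▸ X.mul_mem (X.inv_mem hx') (hx g))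
      (B.mul_mem hb' (B.inv_mem (hb g)))
    have h3 := hmul _ (B.mul_mem hb' (B.inv_mem (hb g))) _ (hb g)
    rw [inv_mul_cancel_right, h2, one_mul] at h3
    exact h3.symm
  refine ⟨MonoidHom.mk' (fun g => φ (b g)) fun g h => ?_, fun y hy => ?_, fun y hy => ?_⟩
  · have h1 : (x h)⁻¹ * b g * x h ∈ B := by simpa using hnorm _ (X.inv_mem (hx h)) _ (hb g)
    rw [huniq (g * h) (x g * x h) ((x h)⁻¹ * b g * x h * b h) (X.mul_mem (hx g) (hx h))
      (B.mul_mem h1 (hb h)) (by rw [Subgroup.coe_mul, e g, e h]; group), hmul _ h1 _ (hb h),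
      ← hinv _ (hx h) _ h1]
    congr 2
    group
  · change φ (b _) = 1
    rw [huniq _ y 1 hy B.one_mem (mul_one y).symm]
    exact htriv 1 X.one_mem B.one_mem
  · exact huniq _ 1 y X.one_mem hy (one_mul y).symm

end CharacterExtension

/-! ### Rational and adelic points -/

section CharValue

variable {F : Type u} [Field F] [NumberField F] {ι : Type} [Fintype ι] [DecidableEq ι]
variable {H G : MatGroup F ι}

theorem charValue_of_mem (χ : adelic H G →* Circle) {z : H (Adele F)} (hz : z ∈ adelic H G) :
    charValue χ z = χ ⟨z, hz⟩ :=
  dif_pos hz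

theorem charValue_mul (χ : adelic H G →* Circle) {a b : H (Adele F)} (ha : a ∈ adelic H G)
    (hb : b ∈ adelic H G) : charValue χ (a * b) = charValue χ a * charValue χ b := by
  rw [charValue_of_mem χ ha, charValue_of_mem χ hb, charValue_of_mem χ (mul_mem ha hb), ← map_mul]
  rfl

theorem charValue_one (χ : adelic H G →* Circle) : charValue χ 1 = 1 := by
  rw [charValue_of_mem χ (one_mem _)]
  exact map_one χ

theorem charValue_inv (χ : adelic H G →* Circle) {a : H (Adele F)} (ha : a ∈ adelic H G) :
    charValue χ a⁻¹ = (charValue χ a)⁻¹ := by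
  rw [eq_inv_iff_mul_eq_one, ← charValue_mul χ (inv_mem ha) ha, inv_mul_cancel, charValue_one]

theorem eq_of_charValue_eq {χ χ' : adelic H G →* Circle}
    (h : ∀ z ∈ adelic H G, charValue χ z = charValue χ' z) : χ = χ' := by
  ext z
  have := h z z.2
  rw [charValue_of_mem χ z.2, charValue_of_mem χ' z.2] at this
  rw [this]

theorem IsNontrivialCharacter.isCharOn {χ : adelic H G →* Circle} (hχ : IsNontrivialCharacter χ)
    (hG : RootExchange.rational H G ≤ adelic H G) : IsCharOn (adelic H G) (RootExchange.rational H G) (charValue χ) where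
  cont := by
    rw [continuousOn_iff_continuous_domRestrict]
    exact hχ.continuous.congr fun a => (charValue_of_mem χ a.2).symm
  mul a ha b hb := charValue_mul χ ha hb
  triv γ hγ := by rw [charValue_of_mem χ (hG hγ)]; exact hχ.rational _ hγ

end CharValue

section Rational

variable {F : Type u} [Field F] [NumberField F] {ι : Type} [Fintype ι] [DecidableEq ι]
variable {H G U : MatGroup F ι}

/-- A rational matrix in `U(𝔸)` lies in `U(F)`, since `U` is defined by equations. Here
`fun _ _ _ => ⊤` is the functor `GL` itself. -/
theorem IsUnipotentSubgroup.mem_rational_of_mem_adelic (hU : IsUnipotentSubgroup H U)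
    {g : H (Adele F)} (hg : g ∈ rational H (fun _ _ _ => ⊤)) (hg' : g ∈ adelic H U) :
    g ∈ rational H U := by
  obtain ⟨S, hS⟩ := hU.closed
  replace hS : IsEquations U S := hS
  obtain ⟨γ, -, e⟩ := mem_rational.1 hg
  refine mem_rational.2 ⟨γ, ?_, e⟩
  rw [mem_adelic, ← e] at hg'
  exact hS.mem_of_map_mem (Algebra.ofId F (Adele F)) (AdeleRing.algebraMap_injective (𝓞 F) F) hg'

theorem rational_mono {U U' : MatGroup F ι} (h : U F ≤ U' F) : rational H U ≤ rational H U' :=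
  fun _ ⟨γ, hγ, e⟩ => ⟨γ, h hγ, e⟩

/-- The group of rational matrices is discrete in `H(𝔸)`. -/
theorem exists_nhds_one_rational_eq_one :
    ∃ N ∈ 𝓝 (1 : H (Adele F)), ∀ g ∈ rational H (fun _ _ _ => ⊤), g ∈ N → g = 1 := by
  obtain ⟨U, hU, h0⟩ := exists_nhds_rational_eq_zero (F := F)
  let d : ι → ι → H (Adele F) → Adele F := fun i j g =>
    ((g : GL ι (Adele F)) : Matrix ι ι (Adele F)) i j - (1 : Matrix ι ι (Adele F)) i j
  have hd : ∀ i j, Continuous (d i j) := fun i j =>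
    ((Units.continuous_val.comp continuous_subtype_val).matrix_elem i j).sub continuous_const
  refine ⟨⋂ i, ⋂ j, d i j ⁻¹' U, Filter.iInter_mem.2 fun i => Filter.iInter_mem.2 fun j =>
    (hd i j).continuousAt.preimage_mem_nhds (by simpa [d] using hU), fun g hg hgN => ?_⟩
  obtain ⟨γ, -, e⟩ := mem_rational.1 hg
  ext i j
  have h1 : d i j g ∈ U := Set.mem_iInter.1 (Set.mem_iInter.1 hgN i) j
  have h2 : d i j g = algebraMap F (Adele F) ((γ : Matrix ι ι F) i j - (1 : Matrix ι ι F) i j) := by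
    rw [map_sub]
    simp only [d, ← e]
    congr 1
    exact (congrFun (congrFun (Matrix.map_one (algebraMap F (Adele F)) (map_zero _) (map_one _))
      i) j).symm
  rw [h2] at h1
  have h3 := h0 _ h1
  rw [h3, map_zero] at h2
  exact sub_eq_zero.1 h2

theorem adelic_eq_sup {X B : MatGroup F ι} (hX : IsUnipotentSubgroup H X)
    (hB : IsUnipotentSubgroup H B) (hG : ∀ (R : Type u) [CommRing R] [Algebra F R],
      G R = X R ⊔ B R) : adelic H G = adelic H X ⊔ adelic H B := by
  rw [adelic, hG, Subgroup.subgroupOf_sup (hX.le _) (hB.le _)]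
  rfl

theorem IsUnipotentSubgroup.map_le (hU : IsUnipotentSubgroup H U) :
    (U F).map (GeneralLinearGroup.map (algebraMap F (Adele F))) ≤ H (Adele F) := by
  obtain ⟨S, hS⟩ := hU.closed
  rintro _ ⟨γ, hγ, rfl⟩
  exact hU.le _ (IsEquations.map_mem hS (Algebra.ofId F (Adele F)) hγ)

theorem rational_eq_sup {X B : MatGroup F ι} (hX : IsUnipotentSubgroup H X)
    (hB : IsUnipotentSubgroup H B) (hG : ∀ (R : Type u) [CommRing R] [Algebra F R],
      G R = X R ⊔ B R) : rational H G = rational H X ⊔ rational H B := by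
  rw [rational, hG, Subgroup.map_sup, Subgroup.subgroupOf_sup hX.map_le hB.map_le]
  rfl

end Rational

/-! ### Exchange quadruples -/

section Quadruple

open scoped commutatorElement Pointwise

variable {F : Type u} [Field F] [NumberField F] {ι : Type} [Fintype ι] [DecidableEq ι]
variable {H B X Y G : MatGroup F ι} {ψ : adelic H B →* Circle}

theorem rational_sup_le_top :
    rational H X ⊔ rational H B ≤ rational H (fun _ _ _ => ⊤) :=
  sup_le (rational_mono le_top) (rational_mono le_top)

namespace IsExchangeQuadruple

theorem charValue_commutator_swap (h : IsExchangeQuadruple H B ψ X Y) {x y : H (Adele F)}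
    (hx : x ∈ adelic H X) (hy : y ∈ adelic H Y) :
    charValue ψ ⁅y, x⁆ = (charValue ψ ⁅x, y⁆)⁻¹ := by
  rw [← commutatorElement_inv, charValue_inv ψ (h.commutator x hx y hy)]

/-- The conditions are symmetric in `X` and `Y`: exchanging them replaces the pairing by its
inverse. -/
theorem symm (h : IsExchangeQuadruple H B ψ X Y) : IsExchangeQuadruple H B ψ Y X where
  unipotent_C := h.unipotent_C
  unipotent_X := h.unipotent_Y
  unipotent_Y := h.unipotent_X
  character := h.character
  normalize_X := h.normalize_Y
  normalize_Y := h.normalize_X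
  normal_X := h.normal_Y
  normal_Y := h.normal_X
  abelian_X := h.abelian_Y
  abelian_Y := h.abelian_X
  preserve_X := h.preserve_Y
  preserve_Y := h.preserve_X
  trivial_X := h.trivial_Y
  trivial_Y := h.trivial_X
  commutator y hy x hx := by
    rw [← commutatorElement_inv]
    exact inv_mem (h.commutator x hx y hy)
  mul_left y hy y' hy' x hx := by
    rw [h.charValue_commutator_swap hx (mul_mem hy hy'), h.mul_right x hx y hy y' hy', mul_inv,
      h.charValue_commutator_swap hx hy, h.charValue_commutator_swap hx hy']
  mul_right y hy x hx x' hx' := by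
    rw [h.charValue_commutator_swap (mul_mem hx hx') hy, h.mul_left x hx x' hx' y hy, mul_inv,
      h.charValue_commutator_swap hx hy, h.charValue_commutator_swap hx' hy]
  nondegenerate_X y hy h1 := h.nondegenerate_Y y hy fun x hx => by
    have := h1 x hx
    rwa [h.charValue_commutator_swap hx hy, inv_eq_one] at this
  nondegenerate_Y x hx h1 := h.nondegenerate_X x hx fun y hy => by
    have := h1 y hy
    rwa [h.charValue_commutator_swap hx hy, inv_eq_one] at this
  dual_X_injective x hx h1 := h.dual_Y_injective x hx fun y hy => by
    have := h1 y hy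
    rwa [h.charValue_commutator_swap (h.unipotent_X.rational_le hx) hy, inv_eq_one] at this
  dual_X_surjective χ hχ h1 := by
    obtain ⟨x, hx, h2⟩ := h.dual_Y_surjective χ⁻¹ hχ.inv fun y hy => by
      rw [MonoidHom.inv_apply, h1 y hy, inv_one]
    refine ⟨x, hx, fun y => ?_⟩
    rw [h.charValue_commutator_swap (h.unipotent_X.rational_le hx) y.2, ← h2 y,
      MonoidHom.inv_apply, inv_inv]
  dual_Y_injective y hy h1 := h.dual_X_injective y hy fun x hx => by
    have := h1 x hx
    rwa [h.charValue_commutator_swap hx (h.unipotent_Y.rational_le hy), inv_eq_one] at this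
  dual_Y_surjective χ hχ h1 := by
    obtain ⟨y, hy, h2⟩ := h.dual_X_surjective χ⁻¹ hχ.inv fun x hx => by
      rw [MonoidHom.inv_apply, h1 x hx, inv_one]
    refine ⟨y, hy, fun x => ?_⟩
    rw [h.charValue_commutator_swap x.2 (h.unipotent_Y.rational_le hy), ← h2 x,
      MonoidHom.inv_apply, inv_inv]

theorem mem_sup (h : IsExchangeQuadruple H B ψ X Y) {a : H (Adele F)} :
    a ∈ adelic H X ⊔ adelic H B ↔ ∃ x ∈ adelic H X, ∃ b ∈ adelic H B, a = x * b :=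
  mem_sup_iff_exists_mul h.normalize_X

/-- The elements of `XB` are products of a rational point of the group, a point of `B` and a point
of `X`, the last two in compact sets. -/
theorem exists_eq_mul_mul (h : IsExchangeQuadruple H B ψ X Y) :
    ∃ K K' : Set (H (Adele F)), IsCompact K ∧ K ⊆ adelic H B ∧ IsCompact K' ∧ K' ⊆ adelic H X ∧
      ∀ a ∈ adelic H X ⊔ adelic H B, ∃ γ ∈ rational H X ⊔ rational H B, ∃ κ ∈ K, ∃ k ∈ K',
        a = γ * κ * k := by
  obtain ⟨K, hK, hKB, hcovB⟩ := h.unipotent_C.exists_isErgodicMean.1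
  obtain ⟨K', hK', hKX, hcovX⟩ := h.unipotent_X.exists_isErgodicMean.1
  refine ⟨K, K', hK, hKB, hK', hKX, fun a ha => ?_⟩
  obtain ⟨x, hx, b, hb, rfl⟩ := h.mem_sup.1 ha
  obtain ⟨γ, hγ, k, hk, rfl⟩ := hcovX x hx
  obtain ⟨β, hβ, κ, hκ, e⟩ := hcovB _ (h.normalize_X k (hKX hk) b hb)
  refine ⟨γ * β, mul_mem (Subgroup.mem_sup_left hγ) (Subgroup.mem_sup_right hβ), κ, hκ, k, hk, ?_⟩
  rw [mul_assoc γ β κ, ← e]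
  group

theorem isAbelianExtension (h : IsExchangeQuadruple H B ψ X Y) :
    IsAbelianExtension (adelic H X ⊔ adelic H B) (adelic H B) (rational H X ⊔ rational H B) where
  le := le_sup_right
  le' := sup_le_sup h.unipotent_X.rational_le h.unipotent_C.rational_le
  comm a ha a' ha' := by
    obtain ⟨x, hx, b, hb, rfl⟩ := h.mem_sup.1 ha
    obtain ⟨x', hx', b', hb', rfl⟩ := h.mem_sup.1 ha'
    have key : ∀ {b x' : H (Adele F)}, x' ∈ adelic H X → b ∈ adelic H B →
        x'⁻¹ * b * x' ∈ adelic H B := fun {b x'} hx' hb => by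
      simpa using h.normalize_X _ (inv_mem hx') b hb
    have h1 := mul_mem (mul_mem (key hx' hb) hb')
      (inv_mem (mul_mem (key hx hb') hb))
    have h2 := (h.abelian_X x hx x' hx').2
    have h3 := mul_mem (h.normalize_X _ (mul_mem hx hx') _ h1) h2
    convert h3 using 1
    rw [commutatorElement_def]
    group
  cocompact := by
    obtain ⟨K, K', hK, hKB, hK', hKX, hcov⟩ := h.exists_eq_mul_mul
    refine ⟨K * K', hK.mul hK', ?_, fun a ha => ?_⟩
    · rintro _ ⟨x, hx, y, hy, rfl⟩
      exact mul_mem (Subgroup.mem_sup_right (hKB hx)) (Subgroup.mem_sup_left (hKX hy))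
    · obtain ⟨γ, hγ, κ, hκ, k, hk, e⟩ := hcov a ha
      exact ⟨γ, hγ, κ * k, ⟨κ, hκ, k, hk, rfl⟩, by rw [e, mul_assoc]⟩

theorem rational_inf_adelic (h : IsExchangeQuadruple H B ψ X Y) :
    (rational H X ⊔ rational H B) ⊓ adelic H B = rational H B :=
  le_antisymm (fun _ hz => h.unipotent_C.mem_rational_of_mem_adelic (rational_sup_le_top hz.1) hz.2)
    (le_inf le_sup_right h.unipotent_C.rational_le)

/-- The character of `X B` that extends `ψ` and is trivial on `X`. -/
theorem exists_extension (h : IsExchangeQuadruple H B ψ X Y)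
    (hG : ∀ (R : Type u) [CommRing R] [Algebra F R], G R = X R ⊔ B R) :
    ∃ χ : adelic H G →* Circle, (∀ x ∈ adelic H X, charValue χ x = 1) ∧
      ∀ b ∈ adelic H B, charValue χ b = charValue ψ b := by
  have e := adelic_eq_sup h.unipotent_X h.unipotent_C hG
  obtain ⟨χ, hX, hB⟩ := exists_extension_of_normalizes h.normalize_X
    (fun a ha b hb => charValue_mul ψ ha hb) h.preserve_X fun x hx hx' => h.trivial_X x ⟨hx, hx'⟩
  refine ⟨χ.comp (Subgroup.inclusion e.le), fun x hx => ?_, fun b hb => ?_⟩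
  · rw [charValue_of_mem _ (e.ge (Subgroup.mem_sup_left hx))]
    exact hX x hx
  · rw [charValue_of_mem _ (e.ge (Subgroup.mem_sup_right hb))]
    exact hB b hb

variable {χ : adelic H G →* Circle}

/-- The extension of `ψ` to `X B` that is trivial on `X` is automatically continuous and trivial on
rational points. -/
theorem isCharOn (h : IsExchangeQuadruple H B ψ X Y)
    (hG : ∀ (R : Type u) [CommRing R] [Algebra F R], G R = X R ⊔ B R)
    (hχX : ∀ x ∈ adelic H X, charValue χ x = 1)
    (hχB : ∀ b ∈ adelic H B, charValue χ b = charValue ψ b) :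
    IsCharOn (adelic H X ⊔ adelic H B) (rational H X ⊔ rational H B) (charValue χ) := by
  have hmul : ∀ a ∈ adelic H X ⊔ adelic H B, ∀ b ∈ adelic H X ⊔ adelic H B,
      charValue χ (a * b) = charValue χ a * charValue χ b := fun a ha b hb => by
    rw [← adelic_eq_sup h.unipotent_X h.unipotent_C hG] at ha hb
    exact charValue_mul χ ha hb
  have hψ := h.character.isCharOn h.unipotent_C.rational_le
  have htriv : ∀ γ ∈ rational H X ⊔ rational H B, charValue χ γ = 1 := fun γ hγ => by
    obtain ⟨x, hx, b, hb, rfl⟩ := (mem_sup_iff_exists_mul (fun x hx b hb =>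
      h.unipotent_C.mem_rational_of_mem_adelic (mul_mem (mul_mem (rational_mono le_top hx)
        (rational_mono le_top hb)) (inv_mem (rational_mono le_top hx)))
        (h.normalize_X x (h.unipotent_X.rational_le hx) b (h.unipotent_C.rational_le hb)))).1 hγ
    have hx' := h.unipotent_X.rational_le hx
    have hb' := h.unipotent_C.rational_le hb
    rw [hmul _ (Subgroup.mem_sup_left hx') _ (Subgroup.mem_sup_right hb'), hχX x hx', hχB b hb',
      hψ.triv b hb, one_mul]
  obtain ⟨K, K', hK, hKB, hK', hKX, hcov⟩ := h.exists_eq_mul_mul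
  obtain ⟨N, hN, hN1⟩ := exists_nhds_one_rational_eq_one (H := H)
  exact ⟨continuousOn_of_eq_mul_mul le_sup_right le_sup_left h.isAbelianExtension.le'
    ⟨N, hN, fun γ hγ => hN1 γ (rational_sup_le_top hγ)⟩ hK hKB hK' hKX hcov hmul htriv hχX
    (hψ.cont.congr hχB), hmul, htriv⟩

theorem isExchanging (h : IsExchangeQuadruple H B ψ X Y)
    (hχB : ∀ b ∈ adelic H B, charValue χ b = charValue ψ b) :
    IsExchanging (adelic H X ⊔ adelic H B) (adelic H B) (rational H X ⊔ rational H B)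
      (rational H Y) (charValue χ) := by
  have hA : ∀ y ∈ adelic H Y, ∀ a ∈ adelic H X ⊔ adelic H B,
      y * a * y⁻¹ * a⁻¹ ∈ adelic H B := fun y hy a ha => by
    obtain ⟨x, hx, b, hb, rfl⟩ := h.mem_sup.1 ha
    have h1 := h.symm.commutator y hy x hx
    have h2 := h.normalize_X x hx _ (mul_mem (h.normalize_Y y hy b hb) (inv_mem hb))
    convert mul_mem h1 h2 using 1
    rw [commutatorElement_def]
    group
  refine ⟨fun y hy => hA y (h.unipotent_Y.rational_le hy),
    fun y hy => h.normalize_Y y (h.unipotent_Y.rational_le hy), fun y hy γ hγ => ?_,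
    fun y hy c hc => ?_⟩
  · have hγ' := h.isAbelianExtension.le' hγ
    have hy' : y ∈ rational H (fun _ _ _ => ⊤) := rational_mono le_top hy
    have hγ'' := rational_sup_le_top hγ
    have h1 := h.unipotent_C.mem_rational_of_mem_adelic (mul_mem (mul_mem (mul_mem hy' hγ'')
      (inv_mem hy')) (inv_mem hγ'')) (hA y (h.unipotent_Y.rational_le hy) γ hγ')
    have h2 := mul_mem (Subgroup.mem_sup_right (S := rational H X) h1) hγ
    rwa [inv_mul_cancel_right] at h2
  · have hy' := h.unipotent_Y.rational_le hy
    rw [hχB c hc, hχB _ (h.normalize_Y y hy' c hc), h.preserve_Y y hy' c hc]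

theorem commChar_mul (h : IsExchangeQuadruple H B ψ X Y)
    (hχ : IsCharOn (adelic H X ⊔ adelic H B) (rational H X ⊔ rational H B) (charValue χ))
    (hχB : ∀ b ∈ adelic H B, charValue χ b = charValue ψ b) {x y b : H (Adele F)}
    (hx : x ∈ adelic H X) (hy : y ∈ rational H Y) (hb : b ∈ adelic H B) :
    commChar (charValue χ) y (x * b) = charValue ψ ⁅y, x⁆ := by
  have hS := h.isExchanging hχB
  have hxA := Subgroup.mem_sup_left (T := adelic H B) hx
  have h3 : ⁅y, x⁆ ∈ adelic H B := h.symm.commutator y (h.unipotent_Y.rational_le hy) x hx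
  have e2 : y * x * y⁻¹ = ⁅y, x⁆ * x := by rw [commutatorElement_def]; group
  rw [commChar_mul_right h.isAbelianExtension hχ hS hy hxA (Subgroup.mem_sup_right hb),
    commChar_of_mem hS hy hb, mul_one, commChar, e2, hχ.mul _ (Subgroup.mem_sup_right h3) _ hxA,
    mul_inv_cancel_right, hχB _ h3]

/-- The character `y ↦ ψ([x, y])` of `Y(𝔸)`. -/
def pairingHom (h : IsExchangeQuadruple H B ψ X Y) {x : H (Adele F)} (hx : x ∈ adelic H X) :
    adelic H Y →* Circle :=
  MonoidHom.mk' (fun y => charValue ψ ⁅x, (y : H (Adele F))⁆)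
    fun y y' => h.mul_right x hx y y.2 y' y'.2

theorem continuous_pairingHom (h : IsExchangeQuadruple H B ψ X Y) {x : H (Adele F)}
    (hx : x ∈ adelic H X) : Continuous (h.pairingHom hx) := by
  have hc := continuousOn_iff_continuous_domRestrict.1
    (h.character.isCharOn h.unipotent_C.rational_le).cont
  have h1 : Continuous fun y : adelic H Y =>
      (⟨⁅x, (y : H (Adele F))⁆, h.commutator x hx y y.2⟩ : adelic H B) := by
    have hy : Continuous fun y : adelic H Y => (y : H (Adele F)) := continuous_subtype_val
    exact Continuous.subtype_mk (((continuous_const.mul hy).mul continuous_const).mul hy.inv) _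
  exact hc.comp h1

theorem charValue_commutator_eq_one (h : IsExchangeQuadruple H B ψ X Y) {x y : H (Adele F)}
    (hx : x ∈ adelic H X) (h0 : ∀ y ∈ rational H Y, charValue ψ ⁅x, y⁆ = 1)
    (hy : y ∈ rational H Y ⊔ (adelic H Y ⊓ adelic H B)) : charValue ψ ⁅x, y⁆ = 1 := by
  have hnorm : ∀ γ ∈ rational H Y, ∀ c ∈ adelic H Y ⊓ adelic H B,
      γ * c * γ⁻¹ ∈ adelic H Y ⊓ adelic H B := by
    intro γ hγ c hc
    have hγ' := h.unipotent_Y.rational_le hγ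
    obtain ⟨hcY, hcB⟩ := Subgroup.mem_inf.1 hc
    refine Subgroup.mem_inf.2 ⟨?_, ?_⟩
    · exact (adelic H Y).mul_mem ((adelic H Y).mul_mem hγ' hcY) ((adelic H Y).inv_mem hγ')
    · exact h.normalize_Y γ hγ' c hcB
  obtain ⟨γ, hγ, c, hc, rfl⟩ := (mem_sup_iff_exists_mul hnorm).1 hy
  obtain ⟨hcY, hcB⟩ := Subgroup.mem_inf.1 hc
  have h2 : charValue ψ ⁅x, c⁆ = 1 := by
    rw [commutatorElement_def, charValue_mul ψ (h.normalize_X x hx c hcB) (inv_mem hcB),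
      h.preserve_X x hx c hcB, charValue_inv ψ hcB, mul_inv_cancel]
  rw [h.mul_right x hx γ (h.unipotent_Y.rational_le hγ) c hcY, h0 γ hγ, h2, one_mul]

/-- Any point of `X(𝔸)` defines a character of `Y(𝔸)`. If it pairs trivially with `Y(F)`, this
character comes from a point of `X(F)` by duality, and the two points agree modulo `B(𝔸)` by
nondegeneracy. Therefore the characters `a ↦ ψ([y, a])` with `y` in `Y(F)` separate the points of
`A/Γ B(𝔸)`, where `A = X(𝔸) B(𝔸)` and `Γ = X(F) B(F)`. -/
theorem separates (h : IsExchangeQuadruple H B ψ X Y)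
    (hχ : IsCharOn (adelic H X ⊔ adelic H B) (rational H X ⊔ rational H B) (charValue χ))
    (hχB : ∀ b ∈ adelic H B, charValue χ b = charValue ψ b) :
    ∀ a ∈ adelic H X ⊔ adelic H B, (∀ y ∈ rational H Y, commChar (charValue χ) y a = 1) →
      a ∈ (rational H X ⊔ rational H B) ⊔ adelic H B := by
  intro a ha h0
  obtain ⟨x, hx, b, hb, rfl⟩ := h.mem_sup.1 ha
  have h0' : ∀ y ∈ rational H Y, charValue ψ ⁅x, y⁆ = 1 := fun y hy => by
    have h1 := h0 y hy
    rw [h.commChar_mul hχ hχB hx hy hb] at h1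
    rw [h.symm.charValue_commutator_swap (h.unipotent_Y.rational_le hy) hx, h1, inv_one]
  obtain ⟨x', hx', hx'y⟩ := h.dual_Y_surjective (h.pairingHom hx) (h.continuous_pairingHom hx)
    fun y hy => h.charValue_commutator_eq_one hx h0' hy
  have hx'X := h.unipotent_X.rational_le hx'
  have h1 : x'⁻¹ * x ∈ adelic H B := by
    refine (h.nondegenerate_X _ (mul_mem (inv_mem hx'X) hx) fun y hy => ?_).2
    have h2 := h.mul_left x' hx'X _ (mul_mem (inv_mem hx'X) hx) y hy
    have h3 : charValue ψ ⁅x, y⁆ = charValue ψ ⁅x', y⁆ := hx'y ⟨y, hy⟩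
    rw [mul_inv_cancel_left, h3] at h2
    exact left_eq_mul.1 h2
  have h2 : x * b = x' * (x'⁻¹ * x * b) := by group
  rw [h2]
  exact mul_mem (Subgroup.mem_sup_left (Subgroup.mem_sup_left hx'))
    (Subgroup.mem_sup_right (mul_mem h1 hb))

/-- The Fourier coefficients of `f` along `X B` vanish if and only if those along `B` do. -/
theorem mean_eq_zero_iff (h : IsExchangeQuadruple H B ψ X Y)
    (hG : ∀ (R : Type u) [CommRing R] [Algebra F R], G R = X R ⊔ B R)
    (hχX : ∀ x ∈ adelic H X, charValue χ x = 1)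
    (hχB : ∀ b ∈ adelic H B, charValue χ b = charValue ψ b) {f : H (Adele F) → ℂ}
    (hf : Continuous f) (hfH : ∀ γ ∈ rational H H, ∀ g, f (γ * g) = f g)
    {μ : (H (Adele F) → ℂ) → ℂ} (hμ : IsErgodicMean (adelic H B) (rational H B) μ)
    {m : (H (Adele F) → ℂ) → ℂ} (hm : IsMean (adelic H G) (rational H G) m) :
    (∀ g, m (twist f (charValue χ) g) = 0) ↔ ∀ g, μ (twist f (charValue ψ) g) = 0 := by
  have hΓ : rational H X ⊔ rational H B ≤ rational H H :=
    sup_le (rational_mono (h.unipotent_X.le F)) (rational_mono (h.unipotent_C.le F))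
  have hχ := h.isCharOn hG hχX hχB
  rw [adelic_eq_sup h.unipotent_X h.unipotent_C hG,
    rational_eq_sup h.unipotent_X h.unipotent_C hG] at hm
  rw [mean_twist_eq_zero_iff h.isAbelianExtension hχ (h.isExchanging hχB)
    (h.separates hχ hχB) hm (mC := μ) (by rwa [h.rational_inf_adelic]) hf
    (fun γ hγ => hfH γ (hΓ hγ)) fun y hy => hfH y (rational_mono (h.unipotent_Y.le F) hy)]
  have hfB : ∀ γ ∈ rational H B, ∀ g, f (γ * g) = f g := fun γ hγ =>
    hfH γ (hΓ (Subgroup.mem_sup_right hγ))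
  refine forall_congr' fun g => ?_
  rw [hμ.congr ((hχ.mono le_sup_right le_sup_right).isAutomorphic_twist h.unipotent_C.rational_le
    hf hfB g) ((h.character.isCharOn h.unipotent_C.rational_le).isAutomorphic_twist
    h.unipotent_C.rational_le hf hfB g) fun a ha => by rw [twist, twist, hχB a ha]]

theorem exists_isMean (h : IsExchangeQuadruple H B ψ X Y)
    (hG : ∀ (R : Type u) [CommRing R] [Algebra F R], G R = X R ⊔ B R) :
    IsCocompact (adelic H G) (rational H G) ∧ ∃ m, IsMean (adelic H G) (rational H G) m := by
  obtain ⟨μ, hμ⟩ := h.unipotent_C.exists_isErgodicMean.2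
  rw [adelic_eq_sup h.unipotent_X h.unipotent_C hG,
    rational_eq_sup h.unipotent_X h.unipotent_C hG]
  refine ⟨h.isAbelianExtension.cocompact, h.isAbelianExtension.exists_isMean (mC := μ) ?_⟩
  rwa [h.rational_inf_adelic]

end IsExchangeQuadruple

end Quadruple

/-! ### From measures to means -/

section Measure

variable {F : Type u} [Field F] [NumberField F] {ι : Type} [Fintype ι] [DecidableEq ι]
variable {H G : MatGroup F ι} {φ : H (Adele F) → ℂ}

theorem IsAutomorphic.apply_out (hφ : IsAutomorphic (adelic H G) (rational H G) φ)
    (a : adelic H G) :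
    φ ((Quotient.out (Quotient.mk _ a : AutQuot H G) : adelic H G) : H (Adele F)) = φ a := by
  obtain ⟨γ, hγ⟩ := Quotient.mk_out (s := MulAction.orbitRel
    ((rational H G).subgroupOf (adelic H G)) (adelic H G)) a
  refine (congrArg (fun b : adelic H G => φ b) hγ).symm.trans ?_
  exact hφ.inv _ γ.2 a a.2

theorem IsAutomorphic.continuous_out (hφ : IsAutomorphic (adelic H G) (rational H G) φ) :
    Continuous fun q : AutQuot H G => φ (Quotient.out q : adelic H G) := by
  refine isQuotientMap_quotient_mk'.continuous_iff.2 ?_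
  exact (continuousOn_iff_continuous_domRestrict.1 hφ.cont).congr fun a => (hφ.apply_out a).symm

theorem continuous_rightTranslate (h : adelic H G) : Continuous (rightTranslate H G h) := by
  refine isQuotientMap_quotient_mk'.continuous_iff.2 ?_
  exact continuous_quotient_mk'.comp (continuous_mul_const h)

theorem IsAutomorphic.apply_out_mul (hφ : IsAutomorphic (adelic H G) (rational H G) φ)
    {x : H (Adele F)} (hx : x ∈ adelic H G) (q : AutQuot H G) :
    φ ((Quotient.out q : adelic H G) * x) =
      φ (Quotient.out (rightTranslate H G ⟨x, hx⟩ q) : adelic H G) := by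
  induction q using Quotient.inductionOn with
  | h a =>
    have h1 := hφ.apply_out (a * ⟨x, hx⟩)
    exact ((hφ.translate hx).apply_out a).trans h1.symm

/-- Integration over `[G]` is an invariant mean. -/
theorem IsInvariantMeasure.isMean {ν : Measure (AutQuot H G)} (hν : IsInvariantMeasure H G ν)
    (hK : IsCocompact (adelic H G) (rational H G)) :
    IsMean (adelic H G) (rational H G)
      (fun φ => ∫ q : AutQuot H G, φ (Quotient.out q : adelic H G) ∂ν) := by
  have := hν.prob
  have hint : ∀ {φ : H (Adele F) → ℂ}, IsAutomorphic (adelic H G) (rational H G) φ →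
      Integrable (fun q : AutQuot H G => φ (Quotient.out q : adelic H G)) ν := fun {φ} hφ => by
    obtain ⟨b, hb⟩ := hφ.bounded hK
    exact Integrable.of_bound hφ.continuous_out.aestronglyMeasurable b
      (Filter.Eventually.of_forall fun q => hb _ (Quotient.out q : adelic H G).2)
  refine ⟨fun φ φ' h h' => integral_add (hint h) (hint h'), fun c φ _ => integral_const_mul c _,
    by simp, fun φ w h h' hw => ?_, fun φ h x hx => ?_⟩
  · have e : (∫ q : AutQuot H G, (w (Quotient.out q : adelic H G) : ℂ) ∂ν)
        = ((∫ q : AutQuot H G, w (Quotient.out q : adelic H G) ∂ν : ℝ) : ℂ) := integral_ofReal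
    have hw' : Integrable (fun q : AutQuot H G => w (Quotient.out q : adelic H G)) ν :=
      (hint h').re
    rw [e, Complex.ofReal_re]
    exact (norm_integral_le_integral_norm _).trans (integral_mono (hint h).norm hw'
      fun q => hw _ (Quotient.out q : adelic H G).2)
  · have hc := continuous_rightTranslate (⟨x, hx⟩ : adelic H G)
    simp only [h.apply_out_mul hx]
    have h1 := integral_map (μ := ν) hc.measurable.aemeasurable
      (f := fun q : AutQuot H G => φ (Quotient.out q : adelic H G))
      h.continuous_out.aestronglyMeasurable
    rw [hν.invariant] at h1
    exact h1.symm

theorem fourierCoeff_eq (ν : Measure (AutQuot H G)) (χ : adelic H G →* Circle)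
    (f : H (Adele F) → ℂ) (g : H (Adele F)) :
    fourierCoeff H G ν χ f g =
      ∫ q : AutQuot H G, twist f (charValue χ) g (Quotient.out q : adelic H G) ∂ν := by
  refine integral_congr_ae (Filter.Eventually.of_forall fun q => ?_)
  simp only [twist]
  rw [charValue_of_mem χ (Quotient.out q : adelic H G).2]

end Measure

/-! ### Chains of exchanges -/

section Chain

variable {F : Type u} [Field F] [NumberField F] {ι : Type} [Fintype ι] [DecidableEq ι]
variable {H C : MatGroup F ι} {X Y : ℕ → MatGroup F ι} {r a b k : ℕ}

theorem chainGroup_succ_self (R : Type u) [CommRing R] [Algebra F R] :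
    chainGroup C X Y r (k + 1) b R = X (k + 1) R ⊔ chainGroup C X Y r k b R := by
  have : Finset.Ioc 0 (k + 1) = insert (k + 1) (Finset.Ioc 0 k) := by
    ext; simp; omega
  rw [chainGroup, chainGroup, this, Finset.iSup_insert, sup_assoc, sup_assoc, sup_assoc]

theorem chainGroup_self_of_lt (hk : k < r) (R : Type u) [CommRing R] [Algebra F R] :
    chainGroup C X Y r a k R = Y (k + 1) R ⊔ chainGroup C X Y r a (k + 1) R := by
  have : Finset.Ioc k r = insert (k + 1) (Finset.Ioc (k + 1) r) := by
    ext; simp; omega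
  rw [chainGroup, chainGroup, this, Finset.iSup_insert, sup_left_comm]

theorem chainGroup_zero : chainGroup C X Y 0 0 0 = C := by
  funext R _ _
  simp [chainGroup]

theorem le_chainGroup (R : Type u) [CommRing R] [Algebra F R] :
    C R ≤ chainGroup C X Y r a b R :=
  le_sup_of_le_left le_sup_right

theorem left_le_chainGroup {j : ℕ} (hj : j ∈ Finset.Ioc 0 a) (R : Type u) [CommRing R]
    [Algebra F R] : X j R ≤ chainGroup C X Y r a b R :=
  le_sup_of_le_left (le_sup_of_le_left (le_iSup₂_of_le j hj le_rfl))

theorem right_le_chainGroup {j : ℕ} (hj : j ∈ Finset.Ioc b r) (R : Type u) [CommRing R]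
    [Algebra F R] : Y j R ≤ chainGroup C X Y r a b R :=
  le_sup_of_le_right (le_iSup₂_of_le j hj le_rfl)

/-- A character of the group generated by `C`, the `X_j` and the `Y_j` is determined by its
restrictions to these groups. -/
theorem eq_on_chainGroup (hC : IsUnipotentSubgroup H C)
    (hX : ∀ j ∈ Finset.Ioc 0 a, IsUnipotentSubgroup H (X j))
    (hY : ∀ j ∈ Finset.Ioc b r, IsUnipotentSubgroup H (Y j)) {φ φ' : H (Adele F) → Circle}
    (hφ : ∀ x ∈ adelic H (chainGroup C X Y r a b), ∀ y ∈ adelic H (chainGroup C X Y r a b),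
      φ (x * y) = φ x * φ y)
    (hφ' : ∀ x ∈ adelic H (chainGroup C X Y r a b), ∀ y ∈ adelic H (chainGroup C X Y r a b),
      φ' (x * y) = φ' x * φ' y)
    (h : ∀ z ∈ adelic H C, φ z = φ' z)
    (hx : ∀ j ∈ Finset.Ioc 0 a, ∀ z ∈ adelic H (X j), φ z = φ' z)
    (hy : ∀ j ∈ Finset.Ioc b r, ∀ z ∈ adelic H (Y j), φ z = φ' z) :
    ∀ z ∈ adelic H (chainGroup C X Y r a b), φ z = φ' z := by
  let E : Subgroup (H (Adele F)) :=
    { carrier := {z | z ∈ adelic H (chainGroup C X Y r a b) ∧ φ z = φ' z}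
      one_mem' := ⟨one_mem _, h 1 (one_mem _)⟩
      mul_mem' := fun {x y} hx hy => ⟨mul_mem hx.1 hy.1, by
        rw [hφ x hx.1 y hy.1, hφ' x hx.1 y hy.1, hx.2, hy.2]⟩
      inv_mem' := fun {x} hx => ⟨inv_mem hx.1, by
        have h1 := hφ x⁻¹ (inv_mem hx.1) x hx.1
        have h2 := hφ' x⁻¹ (inv_mem hx.1) x hx.1
        rw [inv_mul_cancel] at h1 h2
        have h3 := h 1 (one_mem _)
        rw [h1, h2, hx.2] at h3
        exact mul_right_cancel h3⟩ }
  have key : ∀ {U : MatGroup F ι}, IsUnipotentSubgroup H U →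
      U (Adele F) ≤ chainGroup C X Y r a b (Adele F) → (∀ z ∈ adelic H U, φ z = φ' z) →
      U (Adele F) ≤ E.map (H (Adele F)).subtype := fun {U} hU hle hz z hzU =>
    ⟨⟨z, hU.le _ hzU⟩, ⟨hle hzU, hz _ hzU⟩, rfl⟩
  have hle : chainGroup C X Y r a b (Adele F) ≤ E.map (H (Adele F)).subtype :=
    sup_le (sup_le (iSup₂_le fun j hj => key (hX j hj) (left_le_chainGroup hj _) (hx j hj))
      (key hC (le_chainGroup _) h))
      (iSup₂_le fun j hj => key (hY j hj) (right_le_chainGroup hj _) (hy j hj))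
  intro z hz
  obtain ⟨z', hz', e⟩ := hle hz
  rw [← Subtype.ext e]
  exact hz'.2

/-- The hypothesis that the roots of `X_1, …, X_r` can be exchanged successively for those of
`Y_1, …, Y_r`. The exchange of `X_{k+1}` and `Y_{k+1}` has index `k`. -/
def IsExchangeChain (H C : MatGroup F ι) (X Y : ℕ → MatGroup F ι) (r : ℕ)
    (ψ : adelic H C →* Circle) : Prop :=
  ∀ k < r, ∃ ψk : adelic H (chainGroup C X Y r k (k + 1)) →* Circle,
    IsTrivialExtension ψ X Y r k (k + 1) ψk ∧
    IsExchangeQuadruple H (chainGroup C X Y r k (k + 1)) ψk (X (k + 1)) (Y (k + 1))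

namespace IsExchangeChain

variable {ψ : adelic H C →* Circle}

theorem unipotent (h : IsExchangeChain H C X Y r ψ) {j : ℕ} (hj : 0 < j) (hjr : j ≤ r) :
    IsUnipotentSubgroup H (X j) ∧ IsUnipotentSubgroup H (Y j) := by
  obtain ⟨k, rfl⟩ := Nat.exists_eq_succ_of_ne_zero hj.ne'
  obtain ⟨_, _, hk⟩ := h k (by omega)
  exact ⟨hk.unipotent_X, hk.unipotent_Y⟩

/-- Trivial extensions to two groups of the chain agree on any group of the chain contained in
both. -/
theorem charValue_eq (h : IsExchangeChain H C X Y r ψ) (hC : IsUnipotentSubgroup H C)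
    {a' b' a'' b'' : ℕ} (har : a ≤ r) (ha : a ≤ a') (ha' : a ≤ a'') (hb : b' ≤ b) (hb' : b'' ≤ b)
    {χ : adelic H (chainGroup C X Y r a' b') →* Circle} (hχ : IsTrivialExtension ψ X Y r a' b' χ)
    {χ' : adelic H (chainGroup C X Y r a'' b'') →* Circle}
    (hχ' : IsTrivialExtension ψ X Y r a'' b'' χ') :
    ∀ z ∈ adelic H (chainGroup C X Y r a b), charValue χ z = charValue χ' z := by
  have hmono : ∀ {a' b' : ℕ}, a ≤ a' → b' ≤ b →
      adelic H (chainGroup C X Y r a b) ≤ adelic H (chainGroup C X Y r a' b') :=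
    fun {a' b'} ha hb => by
      refine Subgroup.comap_mono (sup_le (sup_le (iSup₂_le fun j hj => ?_) (le_chainGroup _))
        (iSup₂_le fun j hj => ?_))
      · exact left_le_chainGroup (Finset.Ioc_subset_Ioc_right ha hj) _
      · exact right_le_chainGroup (Finset.Ioc_subset_Ioc_left hb hj) _
  refine eq_on_chainGroup hC (fun j hj => ?_) (fun j hj => ?_)
    (fun x hx y hy => charValue_mul χ (hmono ha hb hx) (hmono ha hb hy))
    (fun x hx y hy => charValue_mul χ' (hmono ha' hb' hx) (hmono ha' hb' hy))
    (fun z hz => (hχ.on_C z hz).trans (hχ'.on_C z hz).symm) (fun j hj z hz => ?_)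
    fun j hj z hz => ?_
  · rw [Finset.mem_Ioc] at hj
    exact (h.unipotent hj.1 (by omega)).1
  · rw [Finset.mem_Ioc] at hj
    exact (h.unipotent (by omega) hj.2).2
  · rw [hχ.on_X j (Finset.Ioc_subset_Ioc_right ha hj) z hz,
      hχ'.on_X j (Finset.Ioc_subset_Ioc_right ha' hj) z hz]
  · rw [hχ.on_Y j (Finset.Ioc_subset_Ioc_left hb hj) z hz,
      hχ'.on_Y j (Finset.Ioc_subset_Ioc_left hb' hj) z hz]

theorem exists_isTrivialExtension (h : IsExchangeChain H C X Y r ψ) (hk : k ≤ r) :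
    ∃ χ : adelic H (chainGroup C X Y r k k) →* Circle, IsTrivialExtension ψ X Y r k k χ := by
  have hmem : ∀ {a b : ℕ}, adelic H C ≤ adelic H (chainGroup C X Y r a b) :=
    fun {a b} _ hz => le_chainGroup (a := a) (b := b) _ hz
  have hmemX : ∀ {a b j : ℕ}, j ∈ Finset.Ioc 0 a →
      adelic H (X j) ≤ adelic H (chainGroup C X Y r a b) := fun hj =>
    Subgroup.comap_mono (left_le_chainGroup hj _)
  have hmemY : ∀ {a b j : ℕ}, j ∈ Finset.Ioc b r →
      adelic H (Y j) ≤ adelic H (chainGroup C X Y r a b) := fun hj =>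
    Subgroup.comap_mono (right_le_chainGroup hj _)
  obtain hk | rfl := hk.lt_or_eq
  · obtain ⟨ψk, hψk, hq⟩ := h k hk
    obtain ⟨χ, hχY, hχ⟩ := hq.symm.exists_extension (chainGroup_self_of_lt hk)
    refine ⟨χ, fun c hc => ?_, fun j hj x hx => ?_, fun j hj y hy => ?_⟩
    · rw [hχ c (hmem hc), hψk.on_C c hc]
    · rw [hχ x (hmemX hj hx), hψk.on_X j hj x hx]
    · obtain rfl | hj' := eq_or_ne j (k + 1)
      · exact hχY y hy
      · have hj' : j ∈ Finset.Ioc (k + 1) r := by rw [Finset.mem_Ioc] at hj ⊢; omega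
        rw [hχ y (hmemY hj' hy), hψk.on_Y j hj' y hy]
  obtain _ | k := k
  · refine ⟨ψ.comp (Subgroup.inclusion (by rw [chainGroup_zero])), fun c hc => ?_,
      fun j hj => by simp at hj, fun j hj => by simp at hj⟩
    rw [charValue_of_mem _ (hmem hc), charValue_of_mem ψ hc]
    rfl
  · obtain ⟨ψk, hψk, hq⟩ := h k k.lt_succ_self
    obtain ⟨χ, hχX, hχ⟩ := hq.exists_extension chainGroup_succ_self
    refine ⟨χ, fun c hc => ?_, fun j hj x hx => ?_, fun j hj y hy => ?_⟩
    · rw [hχ c (hmem hc), hψk.on_C c hc]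
    · obtain rfl | hj' := eq_or_ne j (k + 1)
      · exact hχX x hx
      · have hj' : j ∈ Finset.Ioc 0 k := by rw [Finset.mem_Ioc] at hj ⊢; omega
        rw [hχ x (hmemX hj' hx), hψk.on_X j hj' x hx]
    · rw [hχ y (hmemY hj hy), hψk.on_Y j hj y hy]

theorem existsUnique_isTrivialExtension (h : IsExchangeChain H C X Y r ψ)
    (hC : IsUnipotentSubgroup H C) (hk : k ≤ r) :
    ∃! χ : adelic H (chainGroup C X Y r k k) →* Circle, IsTrivialExtension ψ X Y r k k χ := by
  obtain ⟨χ, hχ⟩ := h.exists_isTrivialExtension hk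
  exact ⟨χ, hχ, fun χ' hχ' =>
    eq_of_charValue_eq (h.charValue_eq hC hk le_rfl le_rfl le_rfl le_rfl hχ' hχ)⟩

theorem exists_isMean (h : IsExchangeChain H C X Y r ψ) (hC : IsUnipotentSubgroup H C)
    (hk : k ≤ r) :
    IsCocompact (adelic H (chainGroup C X Y r k k)) (rational H (chainGroup C X Y r k k)) ∧
      ∃ m, IsMean (adelic H (chainGroup C X Y r k k)) (rational H (chainGroup C X Y r k k)) m := by
  obtain hk | rfl := hk.lt_or_eq
  · obtain ⟨_, _, hq⟩ := h k hk
    exact hq.symm.exists_isMean (chainGroup_self_of_lt hk)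
  obtain _ | k := k
  · rw [chainGroup_zero]
    obtain ⟨h1, μ, hμ⟩ := hC.exists_isErgodicMean
    exact ⟨h1, μ, hμ.toIsMean⟩
  · obtain ⟨_, _, hq⟩ := h k k.lt_succ_self
    exact hq.exists_isMean chainGroup_succ_self

variable {f : H (Adele F) → ℂ}

/-- The vanishing of the coefficients of `f` along two successive groups `X_k ⋯ X_1 C Y_r ⋯ Y_{k+1}`
and `X_{k+1} ⋯ X_1 C Y_r ⋯ Y_{k+2}` of the chain is equivalent to the same condition for their
intersection. -/
theorem exists_iff_step (h : IsExchangeChain H C X Y r ψ) (hC : IsUnipotentSubgroup H C)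
    (hf : Continuous f) (hfH : ∀ γ ∈ rational H H, ∀ g, f (γ * g) = f g) (hk : k < r) :
    ∃ Q : Prop, ∀ l, l = k ∨ l = k + 1 → ∀ m, IsMean (adelic H (chainGroup C X Y r l l))
      (rational H (chainGroup C X Y r l l)) m → ∀ χ : adelic H (chainGroup C X Y r l l) →* Circle,
      IsTrivialExtension ψ X Y r l l χ → ((∀ g, m (twist f (charValue χ) g) = 0) ↔ Q) := by
  obtain ⟨ψk, hψk, hq⟩ := h k hk
  obtain ⟨μ, hμ⟩ := hq.unipotent_C.exists_isErgodicMean.2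
  refine ⟨∀ g, μ (twist f (charValue ψk) g) = 0, ?_⟩
  rintro l (rfl | rfl) m hm χ hχ
  · exact hq.symm.mean_eq_zero_iff (chainGroup_self_of_lt hk)
      (hχ.on_Y (l + 1) (by rw [Finset.mem_Ioc]; omega))
      (h.charValue_eq hC hk.le le_rfl le_rfl l.le_succ le_rfl hχ hψk) hf hfH hμ hm
  · exact hq.mean_eq_zero_iff chainGroup_succ_self
      (hχ.on_X (k + 1) (by rw [Finset.mem_Ioc]; omega))
      (h.charValue_eq hC hk.le k.le_succ le_rfl le_rfl le_rfl hχ hψk) hf hfH hμ hm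

/-- The coefficients along all groups `X_k ⋯ X_1 C Y_r ⋯ Y_{k+1}` of the chain, for any choice of
invariant means, vanish simultaneously with those along `C Y_r ⋯ Y_1`. -/
theorem exists_iff (h : IsExchangeChain H C X Y r ψ) (hC : IsUnipotentSubgroup H C)
    (hψ : IsNontrivialCharacter ψ) (hf : Continuous f)
    (hfH : ∀ γ ∈ rational H H, ∀ g, f (γ * g) = f g) (hk : k ≤ r) :
    ∃ Q : Prop, ∀ l, l = 0 ∨ l = k → ∀ m, IsMean (adelic H (chainGroup C X Y r l l))
      (rational H (chainGroup C X Y r l l)) m → ∀ χ : adelic H (chainGroup C X Y r l l) →* Circle,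
      IsTrivialExtension ψ X Y r l l χ → ((∀ g, m (twist f (charValue χ) g) = 0) ↔ Q) := by
  induction k with
  | zero =>
    obtain rfl | hr := Nat.eq_zero_or_pos r
    · obtain ⟨μ, hμ⟩ := hC.exists_isErgodicMean.2
      refine ⟨∀ g, μ (twist f (charValue ψ) g) = 0, fun l hl => ?_⟩
      obtain rfl : l = 0 := by tauto
      intro m hm χ hχ
      rw [chainGroup_zero] at hm
      have hfC : ∀ γ ∈ rational H C, ∀ g, f (γ * g) = f g := fun γ hγ =>
        hfH γ (rational_mono (hC.le F) hγ)
      have htw := (hψ.isCharOn hC.rational_le).isAutomorphic_twist hC.rational_le hf hfC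
      refine forall_congr' fun g => ?_
      have e : ∀ a ∈ adelic H C, twist f (charValue ψ) g a = twist f (charValue χ) g a :=
        fun a ha => by rw [twist, twist, hχ.on_C a ha]
      rw [← hm.congr (htw g) ((htw g).congr hC.rational_le fun a ha => (e a ha).symm) e, hμ.unique hm (htw g)]
    · obtain ⟨Q, hQ⟩ := h.exists_iff_step hC hf hfH hr
      exact ⟨Q, fun l hl => hQ l (by tauto)⟩
  | succ k ih =>
    obtain ⟨Q, hQ⟩ := ih (by omega)
    obtain ⟨Q', hQ'⟩ := h.exists_iff_step hC hf hfH hk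
    obtain ⟨χ, hχ⟩ := h.exists_isTrivialExtension (k := k) (by omega)
    obtain ⟨-, m, hm⟩ := h.exists_isMean hC (k := k) (by omega)
    have hQQ' : Q ↔ Q' := (hQ k (.inr rfl) m hm χ hχ).symm.trans (hQ' k (.inl rfl) m hm χ hχ)
    refine ⟨Q, ?_⟩
    rintro l (rfl | rfl)
    · exact hQ 0 (.inl rfl)
    · rw [hQQ']
      exact hQ' (k + 1) (.inr rfl)

end IsExchangeChain

end Chain

end RootExchange

end

theorem mainTheorem4 {F : Type u} [Field F] [NumberField F]
    {ι : Type} [Fintype ι] [DecidableEq ι]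
    (D : ClassicalData F ι) (hD : IsQuasisplitClassical D)
    (K : Subgroup (archPoints D.points)) (hK : IsMaximalCompact K)
    (r : ℕ) (C : MatGroup F ι) (X Y : ℕ → MatGroup F ι)
    (hC : IsUnipotentSubgroup D.points C)
    (ψ : adelic D.points C →* Circle) (hψ : IsNontrivialCharacter ψ)
    (hchain : ∀ i ∈ Finset.Icc 1 r,
      ∃ ψi : adelic D.points (chainGroup C X Y r (i - 1) i) →* Circle,
        IsTrivialExtension ψ X Y r (i - 1) i ψi ∧
        IsExchangeQuadruple D.points (chainGroup C X Y r (i - 1) i) ψi (X i) (Y i))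
    (f : D.points (Adele F) → ℂ) (hf : IsAutomorphicForm D K f)
    (νX : MeasureTheory.Measure (AutQuot D.points (chainGroup C X Y r r r)))
    (hνX : IsInvariantMeasure D.points (chainGroup C X Y r r r) νX)
    (νY : MeasureTheory.Measure (AutQuot D.points (chainGroup C X Y r 0 0)))
    (hνY : IsInvariantMeasure D.points (chainGroup C X Y r 0 0) νY) :
    (∃! ψX : adelic D.points (chainGroup C X Y r r r) →* Circle,
      IsTrivialExtension ψ X Y r r r ψX) ∧
    (∃! ψY : adelic D.points (chainGroup C X Y r 0 0) →* Circle,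
      IsTrivialExtension ψ X Y r 0 0 ψY) ∧
    ∀ (ψX : adelic D.points (chainGroup C X Y r r r) →* Circle)
      (ψY : adelic D.points (chainGroup C X Y r 0 0) →* Circle),
      IsTrivialExtension ψ X Y r r r ψX → IsTrivialExtension ψ X Y r 0 0 ψY →
      ((∀ g : D.points (Adele F),
          fourierCoeff D.points (chainGroup C X Y r r r) νX ψX f g = 0) ↔
        (∀ g : D.points (Adele F),
          fourierCoeff D.points (chainGroup C X Y r 0 0) νY ψY f g = 0)) := by
  have hchain' : IsExchangeChain D.points C X Y r ψ := fun k hk =>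
    hchain (k + 1) (Finset.mem_Icc.2 ⟨by omega, by omega⟩)
  refine ⟨hchain'.existsUnique_isTrivialExtension hC le_rfl,
    hchain'.existsUnique_isTrivialExtension hC (Nat.zero_le r), fun ψX ψY hψX hψY => ?_⟩
  obtain ⟨Q, hQ⟩ := hchain'.exists_iff hC hψ hf.smooth.continuous hf.left_invariant le_rfl
  simp only [fourierCoeff_eq]
  exact (hQ r (.inr rfl) _ (hνX.isMean (hchain'.exists_isMean hC le_rfl).1) ψX hψX).trans
    (hQ 0 (.inl rfl) _ (hνY.isMean (hchain'.exists_isMean hC (Nat.zero_le r)).1) ψY hψY).symm
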